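/- All graphs are finite, simple and undirected. For a graph $G=(V,E)$, a vertex $v\in V$, a set $T\subseteq V$ and an integer $k\ge 0$, say that $v$ is $k$-linked to $T$ if there are $k$ distinct paths in $G$, each connecting $v$ to a vertex of $T$, any two of which have only the vertex $v$ in common (if $v\in T$, the path of length zero at $v$ may be one of them). Let $r:V\to\{0,1,2,\dots\}$ and $F\subseteq V$. A set $S\subseteq V$ is a vector connectivity set for $(G,r)$ if every $v\in V\setminus S$ is $r(v)$-linked to $S$, and a vector connectivity set for $(G,F,r)$ if every $v\in V\setminus S$ is $r(v)$-linked to $S\cup F$. The problem VecCon asks, given $(G,r)$, for a vector connectivity set for $(G,r)$ of minimum size; the problem FreeVecCon asks, given $(G,F,r)$, for a vector connectivity set for $(G,F,r)$ of minimum size. A graph is biconnected if it is connected and has no cut vertex, a block of $G$ is a maximal biconnected subgraph of $G$, and $G$ is a block graph if every block of $G$ is complete. **Theorem.** VecCon and FreeVecCon are solvable in polynomial time on block graphs. That is, for each of the two problems there are an algorithm (a program of a random access machine whose arithmetic operations are addition and truncated subtraction, every operation costing one step) and a polynomial $q$ such that, on every instance in which $G$ is a block graph, the algorithm halts after at most $q(L)$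 steps and outputs a vector connectivity set of minimum size, where $L$ is the length of the instance in bits ($G$ given by its adjacency matrix, $F$ by its characteristic vector, the requirements $r(v)$ in binary). -/

import Mathlib

/-! ### Random access machines with a step count

Memory consists of registers and of unbounded arrays, both holding natural numbers. The only
arithmetic is addition and truncated subtraction, so that numbers gain at most a constant number
of bits per step and polynomial time is the same as for Turing machines. A program mentions only
finitely many registers and arrays and is fixed before the input is given. -/

namespace RAM

/-- The memory: register `x` holds `reg x`, position `i` of array `a` holds `arr a i`. -/
@[ext]
structure Store where
  reg : ℕ → ℕ
  arr : ℕ → ℕ → ℕ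

/-- Arithmetic expressions; `read a e` is the entry of array `a` at position `e`. -/
inductive AExp where
  | const (c : ℕ)
  | reg (x : ℕ)
  | read (a : ℕ) (e : AExp)
  | add (e f : AExp)
  | sub (e f : AExp)

/-- The value of an expression. -/
def AExp.eval (s : Store) : AExp → ℕ
  | .const c => c
  | .reg x => s.reg x
  | .read a e => s.arr a (e.eval s)
  | .add e f => e.eval s + f.eval s
  | .sub e f => e.eval s - f.eval s

/-- The cost of evaluating an expression: one step for every operation in it. -/
def AExp.cost : AExp → ℕ
  | .const _ => 1
  | .reg _ => 1
  | .read _ e => e.cost + 1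
  | .add e f => e.cost + f.cost + 1
  | .sub e f => e.cost + f.cost + 1

/-- Programs. In `ite e p q` and `loop e p` the test is `e ≠ 0`. -/
inductive Prog where
  | skip
  | assign (x : ℕ) (e : AExp)
  | write (a : ℕ) (i e : AExp)
  | seq (p q : Prog)
  | ite (e : AExp) (p q : Prog)
  | loop (e : AExp) (p : Prog)

/-- `Runs p s s' t`: started in memory `s`, the program `p` halts after `t` steps in
memory `s'`. -/
inductive Runs : Prog → Store → Store → ℕ → Prop where
  | skip (s : Store) : Runs .skip s s 1
  | assign (s : Store) (x : ℕ) (e : AExp) :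
      Runs (.assign x e) s { s with reg := Function.update s.reg x (e.eval s) } (e.cost + 1)
  | write (s : Store) (a : ℕ) (i e : AExp) :
      Runs (.write a i e) s
        { s with
          arr := Function.update s.arr a (Function.update (s.arr a) (i.eval s) (e.eval s)) }
        (i.cost + e.cost + 1)
  | seq {p q : Prog} {s s' s'' : Store} {t t' : ℕ} :
      Runs p s s' t → Runs q s' s'' t' → Runs (.seq p q) s s'' (t + t' + 1)
  | ite_true {e : AExp} {p q : Prog} {s s' : Store} {t : ℕ} :
      e.eval s ≠ 0 → Runs p s s' t → Runs (.ite e p q) s s' (e.cost + t + 1)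
  | ite_false {e : AExp} {p q : Prog} {s s' : Store} {t : ℕ} :
      e.eval s = 0 → Runs q s s' t → Runs (.ite e p q) s s' (e.cost + t + 1)
  | loop_true {e : AExp} {p : Prog} {s s' s'' : Store} {t t' : ℕ} :
      e.eval s ≠ 0 → Runs p s s' t → Runs (.loop e p) s' s'' t' →
        Runs (.loop e p) s s'' (e.cost + t + t' + 1)
  | loop_false {e : AExp} {p : Prog} {s : Store} :
      e.eval s = 0 → Runs (.loop e p) s s (e.cost + 1)

/-- Runs are deterministic: the final memory and the number of steps are determined. -/
theorem Runs.deterministic {p : Prog} {s s₁ s₂ : Store} {t₁ t₂ : ℕ}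
    (h₁ : Runs p s s₁ t₁) (h₂ : Runs p s s₂ t₂) : s₁ = s₂ ∧ t₁ = t₂ := by
  induction h₁ generalizing s₂ t₂ with
  | skip | assign | write => cases h₂; exact ⟨rfl, rfl⟩
  | seq _ _ ih ih' =>
    cases h₂ with
    | seq a b =>
      obtain ⟨rfl, rfl⟩ := ih a
      obtain ⟨rfl, rfl⟩ := ih' b
      exact ⟨rfl, rfl⟩
  | ite_true he _ ih =>
    cases h₂ with
    | ite_true _ a => obtain ⟨rfl, rfl⟩ := ih a; exact ⟨rfl, rfl⟩
    | ite_false h _ => exact absurd h he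
  | ite_false he _ ih =>
    cases h₂ with
    | ite_false _ a => obtain ⟨rfl, rfl⟩ := ih a; exact ⟨rfl, rfl⟩
    | ite_true h _ => exact absurd he h
  | loop_true he _ _ ih ih' =>
    cases h₂ with
    | loop_true _ a b =>
      obtain ⟨rfl, rfl⟩ := ih a
      obtain ⟨rfl, rfl⟩ := ih' b
      exact ⟨rfl, rfl⟩
    | loop_false h => exact absurd h he
  | loop_false he =>
    cases h₂ with
    | loop_false _ => exact ⟨rfl, rfl⟩
    | loop_true h _ _ => exact absurd he h

end RAM

/-! ### Blocks, fans and vector connectivity sets -/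

namespace VectorConnectivity

variable {V : Type*}

/-- `v` is a cut vertex of `G`: deleting `v` separates two vertices of one component of `G`. -/
def IsCutVertex (G : SimpleGraph V) (v : V) : Prop :=
  ∃ u w : ({v}ᶜ : Set V), G.Reachable u w ∧ ¬ (G.induce ({v}ᶜ : Set V)).Reachable u w

/-- A graph is biconnected if it is connected and has no cut vertex. -/
def IsBiconnected (G : SimpleGraph V) : Prop :=
  G.Connected ∧ ∀ v, ¬ IsCutVertex G v

/-- A block of `G` is a maximal biconnected subgraph of `G`. -/
def IsBlock {G : SimpleGraph V} (B : G.Subgraph) : Prop :=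
  Maximal (fun H : G.Subgraph => IsBiconnected H.coe) B

/-- A block graph is a graph (not necessarily connected) every block of which is complete. -/
def IsBlockGraph (G : SimpleGraph V) : Prop :=
  ∀ B : G.Subgraph, IsBlock B → B.coe = ⊤

/-- `v` is `k`-linked to `T`: there is a `v`–`T` fan of order `k`, that is, `k` distinct paths from
`v` to vertices of `T` of which any two have only `v` in common. Two such paths with the same
end are both the path of length zero, so distinctness of the paths is distinctness of their ends;
if `v ∈ T`, then the path of length zero may serve as one (and only one) of the paths. -/
def IsLinked (G : SimpleGraph V) (v : V) (T : Set V) (k : ℕ) : Prop :=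
  ∃ (e : Fin k → V) (P : ∀ i, G.Path v (e i)),
    Function.Injective e ∧ (∀ i, e i ∈ T) ∧
      ∀ i j, i ≠ j → ∀ w, w ∈ (P i).1.support → w ∈ (P j).1.support → w = v

/-- `S` is a vector connectivity set for `(G, r)`. -/
def IsVCSet (G : SimpleGraph V) (r : V → ℕ) (S : Finset V) : Prop :=
  ∀ v, v ∉ S → IsLinked G v (S : Set V) (r v)

/-- `S` is a vector connectivity set for `(G, F, r)`, where `F` is the set of free vertices. -/
def IsFreeVCSet (G : SimpleGraph V) (F : Finset V) (r : V → ℕ) (S : Finset V) : Prop :=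
  ∀ v, v ∉ S → IsLinked G v ((S : Set V) ∪ (F : Set V)) (r v)

/-- `S` is a solution of the VecCon instance `(G, r)`: a vector connectivity set of minimum
size. -/
def SolvesVecCon (G : SimpleGraph V) (r : V → ℕ) (S : Finset V) : Prop :=
  IsVCSet G r S ∧ ∀ T : Finset V, IsVCSet G r T → S.card ≤ T.card

/-- `S` is a solution of the FreeVecCon instance `(G, F, r)`. -/
def SolvesFreeVecCon (G : SimpleGraph V) (F : Finset V) (r : V → ℕ) (S : Finset V) : Prop :=
  IsFreeVCSet G F r S ∧ ∀ T : Finset V, IsFreeVCSet G F r T → S.card ≤ T.card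

/-! ### Instances as machine inputs

The vertices are `0, …, n - 1`. -/

open Classical in
/-- The initial memory for the VecCon instance `(G, r)`: register `0` holds the number `n` of
vertices, array `0` the adjacency matrix of `G` row by row, array `1` the requirements; the rest
of the memory is zero. -/
noncomputable def vecConInput {n : ℕ} (G : SimpleGraph (Fin n)) (r : Fin n → ℕ) : RAM.Store where
  reg x := if x = 0 then n else 0
  arr a i :=
    if a = 0 then (if ∃ u v : Fin n, i = (u : ℕ) * n + (v : ℕ) ∧ G.Adj u v then 1 else 0)
    else if a = 1 then (if h : i < n then r ⟨i, h⟩ else 0)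
    else 0

open Classical in
/-- The initial memory for the FreeVecCon instance `(G, F, r)`: as for `(G, r)`, and array `2`
holds the characteristic vector of `F`. -/
noncomputable def freeVecConInput {n : ℕ} (G : SimpleGraph (Fin n)) (F : Finset (Fin n))
    (r : Fin n → ℕ) : RAM.Store where
  reg x := if x = 0 then n else 0
  arr a i :=
    if a = 0 then (if ∃ u v : Fin n, i = (u : ℕ) * n + (v : ℕ) ∧ G.Adj u v then 1 else 0)
    else if a = 1 then (if h : i < n then r ⟨i, h⟩ else 0)
    else if a = 2 then (if ∃ v ∈ F, i = (v : ℕ) then 1 else 0)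
    else 0

/-- The length in bits of an instance on `n` vertices: the adjacency matrix has `n ^ 2` bits, the
characteristic vector of the free set has `n` bits, and the requirements are written in binary.
(The `n` bits for the free set do not matter up to a polynomial in an instance without one.) -/
def instanceLength {n : ℕ} (r : Fin n → ℕ) : ℕ :=
  n ^ 2 + n + ∑ v, Nat.size (r v)

/-- The vertex set that the machine outputs: its characteristic vector is in array `3`. -/
def outputSet (n : ℕ) (s : RAM.Store) : Finset (Fin n) :=
  Finset.univ.filter fun v => s.arr 3 v ≠ 0

end VectorConnectivity

/-! In a block graph, two neighbours of `v` that are joined by a walk avoiding `v` are adjacent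
(`IsBlockGraph.adj_of_walk`). Hence every vertex of a shortest path from `a` to `b` lies on every
walk from `a` to `b` (`IsBlockGraph.btw_mem`), shortest paths are unique, and a largest fan from `v`
to `T` has one path for each first vertex of a shortest path from `v` to `T`
(`IsBlockGraph.isLinked_iff`). Linkedness becomes a matter of counting directions.

Fix a root `ρ` and consider only solutions that contain it. A vertex `u ≠ ρ` of its component has a
unique parent, and the neighbours of `u` at the same depth form with `u` a class `K`, a block
without its vertex closest to the root. Outside the solution, `u` sees its parent (the root is
chosen), itself if it is free, and those children and siblings beyond which, or at which, there is a
chosen or free vertex; these are called hit (`IsBlockGraph.card_dirs`). The classes are treated from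
the deepest level upwards. Given the choices below, the greedy rule takes a smallest subset `X` of
`K` that meets the requirements in `K`, and among those one for which most vertices of `K` are hit.

The rule is justified by `IsBlockGraph.exchange`. In a feasible `T` that agrees with the choices
below, replace `T ∩ K` by `X`. If this saves a vertex, the parent of `K` is added, so that it has no
requirement any more; otherwise at least as many of its neighbours in `K` are hit as before. No
other vertex above loses a direction. For a prescribed number of hits, the vertices that must be
chosen are known and the rest is filled up arbitrarily, so an optimal `X` is found by trying all
numbers (`chosen_optimal`).

An optimal set meets a component in some vertex, which may serve as the root, or avoids it because
the free vertices suffice. Comparing the results for all roots with the empty set therefore gives an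
optimum on every component (`BestUpTo.succ`), and components are independent
(`IsBlockGraph.solvesFreeVecCon`).

For the time bound, the algorithm is written in a language whose only loops run over the vertices.
Every compiled program takes time polynomial in `n` (`does_stmt`); the size of the requirements is
irrelevant because each arithmetic operation costs one step. VecCon is the case of no free vertices.
-/

/-! ### Running programs with a time bound -/

namespace RAM

/-- Started in `s`, the program `p` halts within `T` steps in a memory satisfying `Q`. -/
def Does (p : Prog) (s : Store) (T : ℕ) (Q : Store → Prop) : Prop :=
  ∃ s' t, Runs p s s' t ∧ t ≤ T ∧ Q s'

/-- The memory `s` with register `x` set to `v`. -/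
def Store.setReg (s : Store) (x v : ℕ) : Store :=
  { s with reg := Function.update s.reg x v }

/-- The memory `s` with position `i` of array `a` set to `v`. -/
def Store.setArr (s : Store) (a i v : ℕ) : Store :=
  { s with arr := Function.update s.arr a (Function.update (s.arr a) i v) }

@[simp] lemma Store.setReg_arr (s : Store) (x v : ℕ) : (s.setReg x v).arr = s.arr := rfl

@[simp] lemma Store.setArr_reg (s : Store) (a i v : ℕ) : (s.setArr a i v).reg = s.reg := rfl

@[simp] lemma Store.setReg_same (s : Store) (x v : ℕ) : (s.setReg x v).reg x = v := by
  simp [Store.setReg]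

lemma Store.setReg_reg (s : Store) (x v y : ℕ) :
    (s.setReg x v).reg y = if y = x then v else s.reg y := by
  simp [Store.setReg, Function.update_apply]

lemma Store.setReg_ne (s : Store) {x y : ℕ} (v : ℕ) (h : y ≠ x) :
    (s.setReg x v).reg y = s.reg y := by
  simp [Store.setReg, h]

lemma Store.setArr_arr (s : Store) (a i v b j : ℕ) :
    (s.setArr a i v).arr b j = if b = a ∧ j = i then v else s.arr b j := by
  by_cases h : b = a
  · subst h; simp [Store.setArr, Function.update_apply]
  · simp [Store.setArr, h]

lemma Store.setArr_ne (s : Store) {a b : ℕ} (i v : ℕ) (h : b ≠ a) :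
    (s.setArr a i v).arr b = s.arr b := by
  simp [Store.setArr, h]

lemma Does.mono {p : Prog} {s : Store} {T T' : ℕ} {Q Q' : Store → Prop} (h : Does p s T Q)
    (hT : T ≤ T') (hQ : ∀ s', Q s' → Q' s') : Does p s T' Q' := by
  obtain ⟨s', t, h1, h2, h3⟩ := h
  exact ⟨s', t, h1, h2.trans hT, hQ _ h3⟩

lemma does_skip {s : Store} {Q : Store → Prop} (h : Q s) : Does .skip s 1 Q :=
  ⟨_, _, .skip s, le_rfl, h⟩

lemma does_assign {x : ℕ} {e : AExp} {s : Store} {Q : Store → Prop}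
    (h : Q (s.setReg x (e.eval s))) : Does (.assign x e) s (e.cost + 1) Q :=
  ⟨_, _, .assign s x e, le_rfl, h⟩

lemma does_write {a : ℕ} {i e : AExp} {s : Store} {Q : Store → Prop}
    (h : Q (s.setArr a (i.eval s) (e.eval s))) :
    Does (.write a i e) s (i.cost + e.cost + 1) Q :=
  ⟨_, _, .write s a i e, le_rfl, h⟩

lemma Does.seq {p q : Prog} {s : Store} {T T' : ℕ} {Q R : Store → Prop} (h : Does p s T Q)
    (h' : ∀ s', Q s' → Does q s' T' R) : Does (.seq p q) s (T + T' + 1) R := by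
  obtain ⟨s', t, h1, h2, h3⟩ := h
  obtain ⟨s'', t', h4, h5, h6⟩ := h' s' h3
  exact ⟨s'', _, .seq h1 h4, by omega, h6⟩

lemma does_ite {e : AExp} {p q : Prog} {s : Store} {T T' : ℕ} {Q : Store → Prop}
    (h : e.eval s ≠ 0 → Does p s T Q) (h' : e.eval s = 0 → Does q s T' Q) :
    Does (.ite e p q) s (e.cost + T + T' + 1) Q := by
  by_cases he : e.eval s = 0
  · obtain ⟨s', t, h1, h2, h3⟩ := h' he
    exact ⟨s', _, .ite_false he h1, by omega, h3⟩
  · obtain ⟨s', t, h1, h2, h3⟩ := h he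
    exact ⟨s', _, .ite_true he h1, by omega, h3⟩

/-- Run `p` with register `c` counting from `0` to one less than the content of register `0`. -/
def forReg (c : ℕ) (p : Prog) : Prog :=
  .seq (.assign c (.const 0))
    (.loop (.sub (.reg 0) (.reg c)) (.seq p (.assign c (.add (.reg c) (.const 1)))))

/-- By truncated subtraction the test is nonzero exactly while the counter is below `n`. Each round
costs `T` for the body and 9 more: 3 for the test, 4 for the increment, and 1 each for the sequence
and the loop. The body must leave the counter at `i`. -/
lemma does_forReg {c n T : ℕ} {p : Prog} {s : Store} (I : ℕ → Store → Prop)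
    (hI : ∀ i s, I i s → s.reg 0 = n ∧ s.reg c = i)
    (hbody : ∀ i < n, ∀ s, I i s →
      Does p s T fun s' => s'.reg c = i ∧ I (i + 1) (s'.setReg c (i + 1)))
    (h0 : I 0 (s.setReg c 0)) : Does (forReg c p) s (n * (T + 9) + 7) (I n) := by
  have key : ∀ m i s, i + m = n → I i s →
      Does (.loop (.sub (.reg 0) (.reg c)) (.seq p (.assign c (.add (.reg c) (.const 1))))) s
        (m * (T + 9) + 4) (I n) := by
    intro m
    induction m with
    | zero =>
      intro i s him hs
      obtain rfl : i = n := by omega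
      obtain ⟨h1, h2⟩ := hI _ _ hs
      exact ⟨s, _, .loop_false (by simp [AExp.eval, h1, h2]), by simp [AExp.cost], hs⟩
    | succ m ih =>
      intro i s him hs
      obtain ⟨h1, h2⟩ := hI _ _ hs
      have hb : Does (.seq p (.assign c (.add (.reg c) (.const 1)))) s (T + (3 + 1) + 1)
          (I (i + 1)) := by
        refine (hbody i (by omega) s hs).seq fun s' hs' => does_assign ?_
        simpa [AExp.eval, hs'.1] using hs'.2
      obtain ⟨s', t, hr, ht, hs'⟩ := hb
      obtain ⟨s'', t', hr', ht', hs''⟩ := ih (i + 1) s' (by omega) hs'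
      refine ⟨s'', _, .loop_true (by simp [AExp.eval, h1, h2]; omega) hr hr', ?_, hs''⟩
      simp only [AExp.cost]
      rw [Nat.succ_mul]
      omega
  have h1 : Does (.assign c (.const 0)) s 2 (I 0) := does_assign (by simpa [AExp.eval] using h0)
  exact (h1.seq fun s' hs' => key n 0 s' (by omega) hs').mono (by omega) fun _ h => h

/-! ### A language of programs over the vertices

Variables range over `Fin n`, and the memory consists of vectors and matrices indexed by `Fin n`.
Every loop runs over all of `Fin n`, hence every program takes polynomial time. -/

/-- Vectors and matrices indexed by `Fin n`. -/
structure Mem (n : ℕ) where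
  one : ℕ → Fin n → ℕ
  two : ℕ → Fin n → Fin n → ℕ

/-- Expressions with variables ranging over `Fin n`. -/
inductive Expr where
  | num (c : ℕ)
  | idx (x : ℕ)
  | get1 (a x : ℕ)
  | get2 (a x y : ℕ)
  | add (e f : Expr)
  | sub (e f : Expr)
  | ite (c e f : Expr)
  | sum (x : ℕ) (e : Expr)

/-- The value of an expression. -/
def Expr.eval {n : ℕ} (σ : Mem n) : Expr → (ℕ → Fin n) → ℕ
  | .num c, _ => c
  | .idx x, ρ => ρ x
  | .get1 a x, ρ => σ.one a (ρ x)
  | .get2 a x y, ρ => σ.two a (ρ x) (ρ y)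
  | .add e f, ρ => e.eval σ ρ + f.eval σ ρ
  | .sub e f, ρ => e.eval σ ρ - f.eval σ ρ
  | .ite c e f, ρ => if c.eval σ ρ ≠ 0 then e.eval σ ρ else f.eval σ ρ
  | .sum x e, ρ => ∑ i, e.eval σ (Function.update ρ x i)

/-- Apply `f 0, …, f (k - 1)` in turn. -/
def loopN {n : ℕ} {α : Type*} (f : Fin n → α → α) : ℕ → α → α
  | 0, a => a
  | i + 1, a => if h : i < n then f ⟨i, h⟩ (loopN f i a) else loopN f i a

lemma loopN_induction {n : ℕ} {α : Type*} {f : Fin n → α → α} {a : α} (I : ℕ → α → Prop)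
    (h0 : I 0 a) (h : ∀ (i : Fin n) b, I i b → I (i + 1) (f i b)) : I n (loopN f n a) := by
  have : ∀ k ≤ n, I k (loopN f k a) := by
    intro k
    induction k with
    | zero => exact fun _ => h0
    | succ k ih =>
      intro hk
      have hk' : k < n := hk
      simp only [loopN, hk', dif_pos]
      exact h ⟨k, hk'⟩ _ (ih hk'.le)
  exact this n le_rfl

/-- Statements. `vec a e` sets entry `i` of vector `a` to the value of `e` with variable `0` equal
to `i`, for all `i` simultaneously; `row a e` does this for the row of matrix `a` given by
variable `1`; `loop x c` repeats `c` with `x` running over `Fin n`. -/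
inductive Stmt where
  | vec (a : ℕ) (e : Expr)
  | row (a : ℕ) (e : Expr)
  | seq (c d : Stmt)
  | loop (x : ℕ) (c : Stmt)

/-- The effect of a statement. -/
def Stmt.exec {n : ℕ} : Stmt → (ℕ → Fin n) → Mem n → Mem n
  | .vec a e, ρ, σ =>
    { σ with one := Function.update σ.one a fun i => e.eval σ (Function.update ρ 0 i) }
  | .row a e, ρ, σ =>
    { σ with
      two := Function.update σ.two a (Function.update (σ.two a) (ρ 1)
        fun i => e.eval σ (Function.update ρ 0 i)) }
  | .seq c d, ρ, σ => d.exec ρ (c.exec ρ σ)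
  | .loop x c, ρ, σ => loopN (fun i τ => c.exec (Function.update ρ x i) τ) n σ

/-! ### Compilation -/

/-- The array that holds vector `a`. -/
def loc1 : ℕ → ℕ
  | 0 => 1
  | 1 => 3
  | 2 => 2
  | a + 3 => 2 * a + 5

/-- The array that holds matrix `a`. -/
def loc2 : ℕ → ℕ
  | 0 => 0
  | a + 1 => 2 * a + 8

lemma loc1_injective : Function.Injective loc1 := by
  intro a b h
  match a, b with
  | 0, 0 | 1, 1 | 2, 2 => rfl
  | 0, 1 | 0, 2 | 1, 0 | 1, 2 | 2, 0 | 2, 1 => simp [loc1] at h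
  | 0, b + 3 | 1, b + 3 | 2, b + 3 => simp only [loc1] at h; omega
  | a + 3, 0 | a + 3, 1 | a + 3, 2 | a + 3, b + 3 => simp only [loc1] at h; omega

lemma loc2_injective : Function.Injective loc2 := by
  intro a b h
  match a, b with
  | 0, 0 => rfl
  | 0, b + 1 | a + 1, 0 | a + 1, b + 1 => simp only [loc2] at h; omega

lemma loc1_ne_loc2 (a b : ℕ) : loc1 a ≠ loc2 b := by
  match a, b with
  | 0, 0 | 1, 0 | 2, 0 | a + 3, 0 => simp [loc1, loc2]
  | 0, b + 1 | 1, b + 1 | 2, b + 1 | a + 3, b + 1 => simp only [loc1, loc2]; omega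

/-- Array `4` is reserved for the table of the multiples of `n`, which replaces multiplication in
the addressing of matrices, and array `6` is the buffer of `fill`. -/
lemma loc1_ne (a : ℕ) : loc1 a ≠ 4 ∧ loc1 a ≠ 6 := by
  match a with
  | 0 | 1 | 2 => simp [loc1]
  | a + 3 => simp only [loc1]; omega

lemma loc2_ne (a : ℕ) : loc2 a ≠ 4 ∧ loc2 a ≠ 6 := by
  match a with
  | 0 => simp [loc2]
  | a + 1 => simp only [loc2]; omega

/-- The memory `s` holds `n`, the variables `ρ`, and a table of the multiples of `n`. -/
structure Base (n : ℕ) (ρ : ℕ → Fin n) (s : Store) : Prop where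
  size : s.reg 0 = n
  var : ∀ x, s.reg (2 * x + 1) = ρ x
  table : ∀ i : Fin n, s.arr 4 i = i * n

/-- The memory `s` holds the vectors and matrices `σ`. -/
structure Holds {n : ℕ} (σ : Mem n) (s : Store) : Prop where
  one : ∀ a (i : Fin n), s.arr (loc1 a) i = σ.one a i
  two : ∀ a (i j : Fin n), s.arr (loc2 a) (i * n + j) = σ.two a i j

/-- The memories `s` and `s'` differ at most in the work registers `2 * m + 2` with `k ≤ m`. -/
def Frame (k : ℕ) (s s' : Store) : Prop :=
  s'.arr = s.arr ∧ ∀ j, (∀ m, k ≤ m → j ≠ 2 * m + 2) → s'.reg j = s.reg j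

lemma Frame.refl (k : ℕ) (s : Store) : Frame k s s := ⟨rfl, fun _ _ => rfl⟩

lemma Frame.trans {k k' : ℕ} {s s' s'' : Store} (h : Frame k s s') (h' : Frame k' s' s'')
    (hk : k ≤ k') : Frame k s s'' :=
  ⟨h'.1.trans h.1, fun j hj => (h'.2 j fun m hm => hj m (hk.trans hm)).trans (h.2 j hj)⟩

lemma Frame.setReg {k m : ℕ} {s s' : Store} (h : Frame k s s') (hm : k ≤ m) (v : ℕ) :
    Frame k s (s'.setReg (2 * m + 2) v) :=
  ⟨h.1, fun j hj => (Store.setReg_ne _ _ (hj m hm)).trans (h.2 j hj)⟩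

lemma Frame.base {n k : ℕ} {ρ : ℕ → Fin n} {s s' : Store} (h : Frame k s s') (hs : Base n ρ s) :
    Base n ρ s' where
  size := by rw [h.2 0 (by omega), hs.size]
  var x := by rw [h.2 _ (by omega), hs.var]
  table i := by rw [h.1, hs.table]

lemma Frame.holds {n k : ℕ} {σ : Mem n} {s s' : Store} (h : Frame k s s') (hs : Holds σ s) :
    Holds σ s' where
  one a i := by rw [h.1, hs.one]
  two a i j := by rw [h.1, hs.two]

/-- The program that puts the value of an expression into work register `2 * k + 2`. -/
def Expr.comp : Expr → ℕ → Prog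
  | .num c, k => .assign (2 * k + 2) (.const c)
  | .idx x, k => .assign (2 * k + 2) (.reg (2 * x + 1))
  | .get1 a x, k => .assign (2 * k + 2) (.read (loc1 a) (.reg (2 * x + 1)))
  | .get2 a x y, k => .assign (2 * k + 2)
      (.read (loc2 a) (.add (.read 4 (.reg (2 * x + 1))) (.reg (2 * y + 1))))
  | .add e f, k => .seq (e.comp k) (.seq (f.comp (k + 1))
      (.assign (2 * k + 2) (.add (.reg (2 * k + 2)) (.reg (2 * (k + 1) + 2)))))
  | .sub e f, k => .seq (e.comp k) (.seq (f.comp (k + 1))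
      (.assign (2 * k + 2) (.sub (.reg (2 * k + 2)) (.reg (2 * (k + 1) + 2)))))
  | .ite c e f, k => .seq (c.comp k) (.ite (.reg (2 * k + 2)) (e.comp k) (f.comp k))
  | .sum x e, k => .seq (.assign (2 * k + 2) (.const 0))
      (.seq (.assign (2 * (k + 1) + 2) (.reg (2 * x + 1)))
        (.seq (forReg (2 * x + 1) (.seq (e.comp (k + 2))
            (.assign (2 * k + 2) (.add (.reg (2 * k + 2)) (.reg (2 * (k + 2) + 2))))))
          (.assign (2 * x + 1) (.reg (2 * (k + 1) + 2)))))

lemma Base.update {n : ℕ} {ρ : ℕ → Fin n} {s s' : Store} (h : Base n ρ s) {x : ℕ} {i : Fin n}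
    (h4 : s'.arr 4 = s.arr 4) (h0 : s'.reg 0 = s.reg 0) (hx : s'.reg (2 * x + 1) = i)
    (hy : ∀ y, y ≠ x → s'.reg (2 * y + 1) = s.reg (2 * y + 1)) :
    Base n (Function.update ρ x i) s' where
  size := h0.trans h.size
  var y := by
    by_cases hyx : y = x
    · subst hyx; simpa using hx
    · rw [hy y hyx, h.var]; simp [hyx]
  table i := by rw [h4, h.table]

/-- Work register `2 * k + 2` accumulates the sum and the next one keeps the outer value of variable
`x`, which the loop overwrites. The summands are computed from depth `k + 2` on, so both survive. -/
lemma does_sum {n x k T : ℕ} {ρ : ℕ → Fin n} {σ : Mem n} {s : Store} {e : Expr}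
    (hb : Base n ρ s) (hh : Holds σ s)
    (ih : ∀ (ρ : ℕ → Fin n) (s : Store), Base n ρ s → Holds σ s →
      Does (e.comp (k + 2)) s T
        fun s' => s'.reg (2 * (k + 2) + 2) = e.eval σ ρ ∧ Frame (k + 2) s s') :
    Does ((Expr.sum x e).comp k) s (n * (T + 14) + 18)
      fun s' => s'.reg (2 * k + 2) = (Expr.sum x e).eval σ ρ ∧ Frame k s s' := by
  -- Extending the summand by 0 to all of `ℕ` lets the accumulator be a sum over `Finset.range i`.
  set g : ℕ → ℕ := fun j => if h : j < n then e.eval σ (Function.update ρ x ⟨j, h⟩) else 0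
  let J : ℕ → Store → Prop := fun i s' =>
    s'.arr = s.arr ∧ s'.reg (2 * k + 2) = ∑ j ∈ Finset.range i, g j ∧
      s'.reg (2 * (k + 1) + 2) = ρ x ∧
      ∀ j, j ≠ 2 * x + 1 → (∀ m, k ≤ m → j ≠ 2 * m + 2) → s'.reg j = s.reg j
  have hsum : ∑ j ∈ Finset.range n, g j = (Expr.sum x e).eval σ ρ := by
    simp [Finset.sum_range, g, Expr.eval]
  -- The invariant says nothing about the register of variable `x`, so it survives every change of
  -- the loop counter.
  have hJ : ∀ i s' v, J i s' → J i (s'.setReg (2 * x + 1) v) := by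
    rintro i s' v ⟨h1, h2, h3, h4⟩
    refine ⟨h1, ?_, ?_, fun j hj hj' => ?_⟩
    · rw [Store.setReg_ne _ _ (by omega), h2]
    · rw [Store.setReg_ne _ _ (by omega), h3]
    · rw [Store.setReg_ne _ _ hj, h4 j hj hj']
  have h1 : Does (.assign (2 * k + 2) (.const 0)) s 2 fun s' =>
      s' = s.setReg (2 * k + 2) 0 := does_assign rfl
  refine (h1.seq (T' := n * (T + 14) + 15) ?_).mono (by omega) fun _ h => h
  rintro s1 rfl
  have h2 : Does (.assign (2 * (k + 1) + 2) (.reg (2 * x + 1))) (s.setReg (2 * k + 2) 0) 2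
      (J 0) := by
    refine does_assign ⟨rfl, ?_, ?_, fun j hj hj' => ?_⟩
    · rw [Store.setReg_ne _ _ (by omega)]; simp
    · rw [Store.setReg_same]
      simp only [AExp.eval]
      rw [Store.setReg_ne _ _ (by omega), hb.var]
    · rw [Store.setReg_ne _ _ (hj' _ (by omega)), Store.setReg_ne _ _ (hj' _ (by omega))]
  refine (h2.seq (T' := n * (T + 14) + 12) ?_).mono (by omega) fun _ h => h
  intro s2 hs2
  have h3 : Does (forReg (2 * x + 1) (.seq (e.comp (k + 2))
            (.assign (2 * k + 2) (.add (.reg (2 * k + 2)) (.reg (2 * (k + 2) + 2))))))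
      s2 (n * ((T + 5) + 9) + 7) fun s' => J n s' ∧ s'.reg (2 * x + 1) = n := by
    refine does_forReg (n := n) (T := T + 5) (fun i s' => J i s' ∧ s'.reg (2 * x + 1) = i) ?_ ?_ ?_
    · rintro i s' ⟨hs', hi⟩
      exact ⟨by rw [hs'.2.2.2 0 (by omega) (by omega), hb.size], hi⟩
    · rintro i hi s' ⟨hs', hsi⟩
      have hb' : Base n (Function.update ρ x ⟨i, hi⟩) s' := by
        refine hb.update (by rw [hs'.1]) (hs'.2.2.2 0 (by omega) (by omega)) hsi
          fun y hy => hs'.2.2.2 _ (by omega) (by omega)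
      have hh' : Holds σ s' := ⟨fun a i => by rw [hs'.1, hh.one],
        fun a i j => by rw [hs'.1, hh.two]⟩
      refine ((ih _ _ hb' hh').seq (T' := 4) ?_).mono (by omega) fun _ h => h
      rintro s3 ⟨he, hf⟩
      refine does_assign ⟨?_, hJ _ _ _ ⟨?_, ?_, ?_, ?_⟩, by simp⟩
      · rw [Store.setReg_ne _ _ (by omega), hf.2 _ (by omega), hsi]
      · rw [Store.setReg_arr, hf.1, hs'.1]
      · rw [Store.setReg_same]
        simp only [AExp.eval]
        rw [hf.2 _ (by omega), hs'.2.1, he, Finset.sum_range_succ]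
        simp [g, hi]
      · rw [Store.setReg_ne _ _ (by omega), hf.2 _ (by omega), hs'.2.2.1]
      · intro j hj hj'
        rw [Store.setReg_ne _ _ (hj' _ le_rfl), hf.2 _ fun m hm => hj' _ (by omega),
          hs'.2.2.2 j hj hj']
    · exact ⟨hJ _ _ _ hs2, by simp⟩
  refine (h3.seq (T' := 2) ?_).mono (by rw [show T + 5 + 9 = T + 14 by rfl]; omega) fun _ h => h
  rintro s3 ⟨hs3, -⟩
  refine does_assign ⟨?_, hs3.1, fun j hj => ?_⟩
  · rw [Store.setReg_ne _ _ (by omega), hs3.2.1, hsum]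
  · rw [Store.setReg_reg]
    split_ifs with hjx
    · simp only [AExp.eval]
      rw [hs3.2.2.1, hjx, hb.var]
    · exact hs3.2.2.2 j hjx hj

/-- The program for an expression computes its value in polynomial time. -/
lemma does_expr (e : Expr) (k : ℕ) : ∃ q : Polynomial ℕ, ∀ (n : ℕ) (ρ : ℕ → Fin n) (σ : Mem n)
    (s : Store), Base n ρ s → Holds σ s → Does (e.comp k) s (q.eval n)
      fun s' => s'.reg (2 * k + 2) = e.eval σ ρ ∧ Frame k s s' := by
  induction e generalizing k with
  | num c =>
    exact ⟨2, fun n ρ σ s hb hh => (does_assign ⟨by simp [AExp.eval, Expr.eval],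
      (Frame.refl k s).setReg le_rfl _⟩).mono (by simp [AExp.cost]) fun _ h => h⟩
  | idx x =>
    exact ⟨2, fun n ρ σ s hb hh => (does_assign ⟨by simp [AExp.eval, Expr.eval, hb.var],
      (Frame.refl k s).setReg le_rfl _⟩).mono (by simp [AExp.cost]) fun _ h => h⟩
  | get1 a x =>
    exact ⟨3, fun n ρ σ s hb hh => (does_assign ⟨by simp [AExp.eval, Expr.eval, hb.var, hh.one],
      (Frame.refl k s).setReg le_rfl _⟩).mono (by simp [AExp.cost]) fun _ h => h⟩
  | get2 a x y =>
    exact ⟨6, fun n ρ σ s hb hh => (does_assign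
      ⟨by simp [AExp.eval, Expr.eval, hb.var, hb.table, hh.two],
      (Frame.refl k s).setReg le_rfl _⟩).mono (by simp [AExp.cost]) fun _ h => h⟩
  | add e f ihe ihf =>
    obtain ⟨p, hp⟩ := ihe k
    obtain ⟨q, hq⟩ := ihf (k + 1)
    refine ⟨p + q + 6, fun n ρ σ s hb hh => ?_⟩
    refine ((hp n ρ σ s hb hh).seq (T' := q.eval n + 5) ?_).mono (by simp; omega) fun _ h => h
    rintro s' ⟨h1, h2⟩
    refine ((hq n ρ σ s' (h2.base hb) (h2.holds hh)).seq (T' := 4) ?_).mono (by omega)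
      fun _ h => h
    rintro s'' ⟨h3, h4⟩
    refine does_assign ⟨?_, (h2.trans h4 (by omega)).setReg le_rfl _⟩
    simp only [Store.setReg_same, AExp.eval, Expr.eval]
    rw [h4.2 _ (by omega), h1, h3]
  | sub e f ihe ihf =>
    obtain ⟨p, hp⟩ := ihe k
    obtain ⟨q, hq⟩ := ihf (k + 1)
    refine ⟨p + q + 6, fun n ρ σ s hb hh => ?_⟩
    refine ((hp n ρ σ s hb hh).seq (T' := q.eval n + 5) ?_).mono (by simp; omega) fun _ h => h
    rintro s' ⟨h1, h2⟩
    refine ((hq n ρ σ s' (h2.base hb) (h2.holds hh)).seq (T' := 4) ?_).mono (by omega)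
      fun _ h => h
    rintro s'' ⟨h3, h4⟩
    refine does_assign ⟨?_, (h2.trans h4 (by omega)).setReg le_rfl _⟩
    simp only [Store.setReg_same, AExp.eval, Expr.eval]
    rw [h4.2 _ (by omega), h1, h3]
  | ite c e f ihc ihe ihf =>
    obtain ⟨o, ho⟩ := ihc k
    obtain ⟨p, hp⟩ := ihe k
    obtain ⟨q, hq⟩ := ihf k
    refine ⟨o + p + q + 3, fun n ρ σ s hb hh => ?_⟩
    refine ((ho n ρ σ s hb hh).seq (T' := 1 + p.eval n + q.eval n + 1) ?_).mono
      (by simp; omega) fun _ h => h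
    rintro s' ⟨h1, h2⟩
    refine does_ite (fun hc => ?_) fun hc => ?_
    · simp only [AExp.eval, h1] at hc
      refine (hp n ρ σ s' (h2.base hb) (h2.holds hh)).mono le_rfl fun s'' h3 => ?_
      exact ⟨by simp [Expr.eval, hc, h3.1], h2.trans h3.2 le_rfl⟩
    · simp only [AExp.eval, h1] at hc
      refine (hq n ρ σ s' (h2.base hb) (h2.holds hh)).mono le_rfl fun s'' h3 => ?_
      exact ⟨by simp [Expr.eval, hc, h3.1], h2.trans h3.2 le_rfl⟩
  | sum x e ih =>
    obtain ⟨p, hp⟩ := ih (k + 2)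
    refine ⟨Polynomial.X * (p + 14) + 18, fun n ρ σ s hb hh => ?_⟩
    exact (does_sum hb hh fun ρ' s' hb' hh' => hp n ρ' σ s' hb' hh').mono (by simp)
      fun _ h => h

end RAM

/-! ### Compilation of statements and whole programs -/

namespace RAM

/-- For `i = 0, …, n - 1` put the value of `e` with variable `0` equal to `i` into array `l` at
position `i` of a temporary array, then copy these values to the positions `w` of array `l`. -/
def fill (l : ℕ) (w : AExp) (e : Expr) (k : ℕ) : Prog :=
  .seq (.assign (2 * k + 2) (.reg 1))
    (.seq (forReg 1 (.seq (e.comp (k + 1)) (.write 6 (.reg 1) (.reg (2 * (k + 1) + 2)))))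
      (.seq (forReg 1 (.write l w (.read 6 (.reg 1)))) (.assign 1 (.reg (2 * k + 2)))))

/-- Two passes are needed because `e` may read array `l`: all new values are computed into the
buffer before any of them is written back. Injectivity of `g` keeps the writes of the second pass
apart. -/
lemma does_fill {l k n T : ℕ} {w : AExp} {e : Expr} {ρ : ℕ → Fin n} {σ : Mem n} {s : Store}
    {g : Fin n → ℕ} (hb : Base n ρ s) (hh : Holds σ s) (hl4 : l ≠ 4) (hl6 : l ≠ 6)
    (hg : Function.Injective g)
    (hw : ∀ i s', Base n (Function.update ρ 0 i) s' → w.eval s' = g i)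
    (he : ∀ (ρ : ℕ → Fin n) (s : Store), Base n ρ s → Holds σ s →
      Does (e.comp (k + 1)) s T
        fun s' => s'.reg (2 * (k + 1) + 2) = e.eval σ ρ ∧ Frame (k + 1) s s') :
    Does (fill l w e k) s (n * (T + 13) + n * (w.cost + 12) + 21) fun s' =>
      (∀ a, a ≠ l → a ≠ 6 → s'.arr a = s.arr a) ∧
      (∀ i, s'.arr l (g i) = e.eval σ (Function.update ρ 0 i)) ∧
      (∀ j, (∀ i, g i ≠ j) → s'.arr l j = s.arr l j) ∧
      (∀ j, (∀ m, k ≤ m → j ≠ 2 * m + 2) → s'.reg j = s.reg j) := by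
  let J : Store → Prop := fun s' =>
    s'.reg (2 * k + 2) = ρ 0 ∧
      ∀ j, j ≠ 1 → (∀ m, k ≤ m → j ≠ 2 * m + 2) → s'.reg j = s.reg j
  have hJ : ∀ s' v, J s' → J (s'.setReg 1 v) := by
    rintro s' v ⟨h1, h2⟩
    refine ⟨?_, fun j hj hj' => ?_⟩
    · rw [Store.setReg_ne _ _ (by omega), h1]
    · rw [Store.setReg_ne _ _ hj, h2 j hj hj']
  let A : ℕ → Store → Prop := fun i s' => (∀ a, a ≠ 6 → s'.arr a = s.arr a) ∧
    ∀ j : Fin n, j < i → s'.arr 6 j = e.eval σ (Function.update ρ 0 j)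
  let B : ℕ → Store → Prop := fun i s' => (∀ a, a ≠ l → a ≠ 6 → s'.arr a = s.arr a) ∧
    (∀ j : Fin n, s'.arr 6 j = e.eval σ (Function.update ρ 0 j)) ∧
    (∀ j : Fin n, j < i → s'.arr l (g j) = e.eval σ (Function.update ρ 0 j)) ∧
    ∀ j, (∀ i, g i ≠ j) → s'.arr l j = s.arr l j
  have hbase : ∀ (i : Fin n) s', J s' → s'.reg 1 = i → s'.arr 4 = s.arr 4 →
      Base n (Function.update ρ 0 i) s' := fun i s' hs' h1 h4 =>
    hb.update h4 (hs'.2 0 (by omega) (by omega)) h1 fun y hy => hs'.2 _ (by omega) (by omega)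
  have h1 : Does (.assign (2 * k + 2) (.reg 1)) s 2 fun s' => J s' ∧ A 0 s' := by
    refine does_assign ⟨⟨?_, fun j hj hj' => ?_⟩, fun a ha => rfl, fun j hj => by omega⟩
    · rw [Store.setReg_same]; exact hb.var 0
    · rw [Store.setReg_ne _ _ (hj' k le_rfl)]
  refine (h1.seq (T' := n * (T + 13) + n * (w.cost + 12) + 18) ?_).mono (by omega)
    fun _ h => h
  rintro s1 ⟨hJ1, hA1⟩
  have h2 : Does (forReg 1 (.seq (e.comp (k + 1)) (.write 6 (.reg 1) (.reg (2 * (k + 1) + 2)))))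
      s1 (n * ((T + 4) + 9) + 7) fun s' => (J s' ∧ A n s') ∧ s'.reg 1 = n := by
    refine does_forReg (n := n) (T := T + 4) (fun i s' => (J s' ∧ A i s') ∧ s'.reg 1 = i)
      ?_ ?_ ⟨⟨hJ _ _ hJ1, hA1⟩, by simp⟩
    · rintro i s' ⟨⟨hs', -⟩, hi⟩
      exact ⟨by rw [hs'.2 0 (by omega) (by omega), hb.size], hi⟩
    · rintro i hi s' ⟨⟨hs', hA⟩, hsi⟩
      have hh' : Holds σ s' := ⟨fun a i => by rw [hA.1 _ (loc1_ne a).2, hh.one],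
        fun a i j => by rw [hA.1 _ (loc2_ne a).2, hh.two]⟩
      refine ((he _ _ (hbase ⟨i, hi⟩ s' hs' hsi (hA.1 4 (by omega))) hh').seq (T' := 3)
        ?_).mono (by omega) fun _ h => h
      rintro s3 ⟨hev, hf⟩
      have hs3 : s3.reg 1 = i := by rw [hf.2 _ (by omega), hsi]
      refine does_write ⟨by simpa using hs3, ⟨hJ _ _ ⟨?_, fun j hj hj' => ?_⟩,
        fun a ha => ?_, fun j hj => ?_⟩, by simp⟩
      · rw [Store.setArr_reg, hf.2 _ (by omega), hs'.1]
      · rw [Store.setArr_reg, hf.2 _ fun m hm => hj' _ (by omega), hs'.2 j hj hj']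
      · rw [Store.setReg_arr, Store.setArr_ne _ _ _ ha, hf.1, hA.1 a ha]
      · rw [Store.setReg_arr, Store.setArr_arr]
        simp only [AExp.eval, hs3, hev, true_and]
        split_ifs with hji
        · rw [show (⟨i, hi⟩ : Fin n) = j from Fin.ext hji.symm]
        · rw [hf.1, hA.2 j (by omega)]
  refine (h2.seq (T' := n * (w.cost + 12) + 10) ?_).mono
    (by rw [show T + 4 + 9 = T + 13 by rfl]; omega) fun _ h => h
  rintro s2 ⟨⟨hJ2, hA2⟩, -⟩
  have h3 : Does (forReg 1 (.write l w (.read 6 (.reg 1)))) s2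
      (n * ((w.cost + 2 + 1) + 9) + 7) fun s' => (J s' ∧ B n s') ∧ s'.reg 1 = n := by
    refine does_forReg (n := n) (T := w.cost + 2 + 1) (fun i s' => (J s' ∧ B i s') ∧ s'.reg 1 = i)
      ?_ ?_ ⟨⟨hJ _ _ hJ2, ?_⟩, by simp⟩
    · rintro i s' ⟨⟨hs', -⟩, hi⟩
      exact ⟨by rw [hs'.2 0 (by omega) (by omega), hb.size], hi⟩
    · rintro i hi s' ⟨⟨hs', hB⟩, hsi⟩
      have hwi := hw _ _ (hbase ⟨i, hi⟩ s' hs' hsi (hB.1 4 hl4.symm (by omega)))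
      have h6i := hB.2.1 ⟨i, hi⟩
      refine does_write ⟨by simpa using hsi, ⟨hJ _ _ hs', fun a ha ha' => ?_, fun j => ?_,
        fun j hj => ?_, fun j hj => ?_⟩, by simp⟩
      · rw [Store.setReg_arr, Store.setArr_ne _ _ _ ha, hB.1 a ha ha']
      · rw [Store.setReg_arr, Store.setArr_ne _ _ _ hl6.symm, hB.2.1]
      · rw [Store.setReg_arr, Store.setArr_arr]
        simp only [AExp.eval, hsi, hwi, true_and]
        split_ifs with hji
        · rw [hg hji]; exact h6i
        · have : (j : ℕ) ≠ i := fun h => hji (congrArg g (Fin.ext h))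
          exact hB.2.2.1 j (by omega)
      · rw [Store.setReg_arr, Store.setArr_arr, hwi, if_neg fun h => hj _ h.2.symm, hB.2.2.2 j hj]
    · exact ⟨fun a _ ha => hA2.1 a ha, fun j => hA2.2 j j.2, fun j hj => by omega,
        fun j hj => by rw [Store.setReg_arr, hA2.1 l hl6]⟩
  refine (h3.seq (T' := 2) ?_).mono (by rw [show w.cost + 2 + 1 + 9 = w.cost + 12 by rfl])
    fun _ h => h
  rintro s3 ⟨⟨hJ3, hB⟩, -⟩
  refine does_assign ⟨hB.1, fun i => hB.2.2.1 i i.2, hB.2.2.2, fun j hj => ?_⟩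
  rw [Store.setReg_reg]
  split_ifs with hj1
  · subst hj1
    simp only [AExp.eval]
    rw [hJ3.1, ← hb.var 0]
  · exact hJ3.2 j hj1 hj

/-- The program for a statement. -/
def Stmt.comp : Stmt → ℕ → Prog
  | .vec a e, k => fill (loc1 a) (.reg 1) e k
  | .row a e, k => fill (loc2 a) (.add (.read 4 (.reg 3)) (.reg 1)) e k
  | .seq c d, k => .seq (c.comp k) (d.comp k)
  | .loop x c, k => .seq (.assign (2 * k + 2) (.reg (2 * x + 1)))
      (.seq (forReg (2 * x + 1) (c.comp (k + 1))) (.assign (2 * x + 1) (.reg (2 * k + 2))))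

lemma row_position {n : ℕ} {i i' j j' : Fin n} (h : (i : ℕ) * n + j = i' * n + j') :
    i = i' ∧ j = j' := by
  have hi : (i : ℕ) = i' := by
    have h1 : ((i : ℕ) * n + j) / n = i := by
      rw [Nat.mul_comm, Nat.mul_add_div (by omega), Nat.div_eq_of_lt j.2, add_zero]
    have h2 : ((i' : ℕ) * n + j') / n = i' := by
      rw [Nat.mul_comm, Nat.mul_add_div (by omega), Nat.div_eq_of_lt j'.2, add_zero]
    rw [← h1, h, h2]
  exact ⟨Fin.ext hi, by rw [hi] at h; exact Fin.ext (by omega)⟩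

/-- The program for a statement has the prescribed effect and takes polynomial time. -/
lemma does_stmt (c : Stmt) (k : ℕ) : ∃ q : Polynomial ℕ, ∀ (n : ℕ) (ρ : ℕ → Fin n) (σ : Mem n)
    (s : Store), Base n ρ s → Holds σ s → Does (c.comp k) s (q.eval n)
      fun s' => Base n ρ s' ∧ Holds (c.exec ρ σ) s' ∧
        ∀ m < k, s'.reg (2 * m + 2) = s.reg (2 * m + 2) := by
  induction c generalizing k with
  | vec a e =>
    obtain ⟨p, hp⟩ := does_expr e (k + 1)
    refine ⟨.X * (p + 13) + .X * 13 + 21, fun n ρ σ s hb hh => ?_⟩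
    refine (does_fill (g := Fin.val) hb hh (loc1_ne a).1 (loc1_ne a).2 Fin.val_injective
      (fun i s' hs' => by simpa [AExp.eval] using hs'.var 0)
      fun ρ' s' hb' hh' => hp n ρ' σ s' hb' hh').mono (by simp [AExp.cost]) ?_
    rintro s' ⟨h1, h2, h3, h4⟩
    refine ⟨⟨by rw [h4 0 (by omega), hb.size], fun x => by rw [h4 _ (by omega), hb.var],
      fun i => by rw [h1 4 (loc1_ne a).1.symm (by omega), hb.table]⟩,
      ⟨fun b i => ?_, fun b i j => ?_⟩, fun m hm => h4 _ (by omega)⟩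
    · simp only [Stmt.exec]
      by_cases hba : b = a
      · subst hba; simp [h2]
      · rw [h1 _ (fun h => hba (loc1_injective h)) (loc1_ne b).2, hh.one]; simp [hba]
    · rw [h1 _ (loc1_ne_loc2 a b).symm (loc2_ne b).2, hh.two]; rfl
  | row a e =>
    obtain ⟨p, hp⟩ := does_expr e (k + 1)
    refine ⟨.X * (p + 13) + .X * 16 + 21, fun n ρ σ s hb hh => ?_⟩
    refine (does_fill (g := fun i => (ρ 1 : ℕ) * n + i) hb hh (loc2_ne a).1 (loc2_ne a).2
      (fun i j hij => (row_position hij).2)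
      (fun i s' hs' => ?_)
      fun ρ' s' hb' hh' => hp n ρ' σ s' hb' hh').mono (by simp [AExp.cost]) ?_
    · have h0 := hs'.var 0
      have h1 := hs'.var 1
      simp only [mul_zero, zero_add, mul_one, Function.update_self, Nat.reduceAdd] at h0 h1
      simp [AExp.eval, h0, h1, hs'.table]
    rintro s' ⟨h1, h2, h3, h4⟩
    refine ⟨⟨by rw [h4 0 (by omega), hb.size], fun x => by rw [h4 _ (by omega), hb.var],
      fun i => by rw [h1 4 (loc2_ne a).1.symm (by omega), hb.table]⟩,
      ⟨fun b i => ?_, fun b i j => ?_⟩, fun m hm => h4 _ (by omega)⟩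
    · rw [h1 _ (loc1_ne_loc2 b a) (loc1_ne b).2, hh.one]; rfl
    · simp only [Stmt.exec]
      by_cases hba : b = a
      · subst hba
        by_cases hi : i = ρ 1
        · subst hi; simp [h2]
        · rw [h3 _ fun i' h => hi (row_position h).1.symm, hh.two]; simp [hi]
      · rw [h1 _ (fun h => hba (loc2_injective h)) (loc2_ne b).2, hh.two]; simp [hba]
  | seq c d ihc ihd =>
    obtain ⟨p, hp⟩ := ihc k
    obtain ⟨q, hq⟩ := ihd k
    refine ⟨p + q + 1, fun n ρ σ s hb hh => ?_⟩
    refine ((hp n ρ σ s hb hh).seq (T' := q.eval n) ?_).mono (by simp) fun _ h => h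
    rintro s' ⟨h1, h2, h3⟩
    refine (hq n ρ _ s' h1 h2).mono le_rfl ?_
    rintro s'' ⟨h4, h5, h6⟩
    exact ⟨h4, h5, fun m hm => (h6 m hm).trans (h3 m hm)⟩
  | loop x c ih =>
    obtain ⟨p, hp⟩ := ih (k + 1)
    refine ⟨.X * (p + 9) + 13, fun n ρ σ s hb hh => ?_⟩
    set f := fun i τ => c.exec (Function.update ρ x i) τ with hf
    -- Register `2 * k + 2` keeps the value that `x` had outside the loop. The clause on `m < k`
    -- protects the values saved in this way by enclosing loops.
    let J : ℕ → Store → Prop := fun i s' => s'.reg 0 = n ∧ Holds (loopN f i σ) s' ∧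
      (∀ y, y ≠ x → s'.reg (2 * y + 1) = ρ y) ∧ (∀ i : Fin n, s'.arr 4 i = i * n) ∧
      s'.reg (2 * k + 2) = ρ x ∧ ∀ m < k, s'.reg (2 * m + 2) = s.reg (2 * m + 2)
    have hJ : ∀ i s' v, J i s' → J i (s'.setReg (2 * x + 1) v) := by
      rintro i s' v ⟨h1, h2, h3, h4, h5, h6⟩
      refine ⟨?_, ⟨h2.one, h2.two⟩, fun y hy => ?_, h4, ?_, fun m hm => ?_⟩
      · rw [Store.setReg_ne _ _ (by omega), h1]
      · rw [Store.setReg_ne _ _ (by omega), h3 y hy]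
      · rw [Store.setReg_ne _ _ (by omega), h5]
      · rw [Store.setReg_ne _ _ (by omega), h6 m hm]
    have h1 : Does (.assign (2 * k + 2) (.reg (2 * x + 1))) s 2 (J 0) := by
      refine does_assign ⟨?_, ⟨hh.one, hh.two⟩, fun y hy => ?_, hb.table, ?_, fun m hm => ?_⟩
      · rw [Store.setReg_ne _ _ (by omega), hb.size]
      · rw [Store.setReg_ne _ _ (by omega), hb.var]
      · rw [Store.setReg_same]; exact hb.var x
      · rw [Store.setReg_ne _ _ (by omega)]
    refine (h1.seq (T' := n * (p.eval n + 9) + 10) ?_).mono (by simp; omega) fun _ h => h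
    intro s1 hs1
    have h2 : Does (forReg (2 * x + 1) (c.comp (k + 1))) s1 (n * (p.eval n + 9) + 7)
        fun s' => J n s' ∧ s'.reg (2 * x + 1) = n := by
      refine does_forReg (n := n) (T := p.eval n) (fun i s' => J i s' ∧ s'.reg (2 * x + 1) = i)
        ?_ ?_ ⟨hJ _ _ _ hs1, by simp⟩
      · rintro i s' ⟨hs', hi⟩
        exact ⟨hs'.1, hi⟩
      · rintro i hi s' ⟨hs', hsi⟩
        have hb' : Base n (Function.update ρ x ⟨i, hi⟩) s' := by
          refine ⟨hs'.1, fun y => ?_, hs'.2.2.2.1⟩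
          by_cases hy : y = x
          · subst hy; simpa using hsi
          · rw [hs'.2.2.1 y hy]; simp [hy]
        refine (hp n _ _ s' hb' hs'.2.1).mono le_rfl ?_
        rintro s3 ⟨hb3, hh3, hm3⟩
        refine ⟨by simpa using hb3.var x, hJ _ _ _ ⟨hb3.size, ?_, fun y hy => ?_, hb3.table,
          by rw [hm3 k (by omega), hs'.2.2.2.2.1], fun m hm => by
            rw [hm3 m (by omega), hs'.2.2.2.2.2 m hm]⟩, by simp⟩
        · simpa [loopN, hi, hf] using hh3
        · rw [hb3.var]; simp [hy]
    refine (h2.seq (T' := 2) ?_).mono le_rfl fun _ h => h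
    rintro s2 ⟨⟨h3, h4, h5, h6, h7, h8⟩, -⟩
    refine does_assign ⟨⟨?_, fun y => ?_, h6⟩, ⟨h4.one, h4.two⟩, fun m hm => ?_⟩
    · rw [Store.setReg_ne _ _ (by omega), h3]
    · rw [Store.setReg_reg]
      split_ifs with hy
      · obtain rfl : y = x := by omega
        exact h7
      · exact h5 y (by omega)
    · rw [Store.setReg_ne _ _ (by omega), h8 m hm]

/-- Started with `n` in register `0` and with zeros in the other registers, fill in the table of
the multiples of `n` and then execute `c`. -/
def Stmt.program (c : Stmt) : Prog :=
  .ite (.reg 0) (.seq (forReg 2 (.seq (.write 4 (.reg 2) (.reg 4))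
    (.assign 4 (.add (.reg 4) (.reg 0))))) (c.comp 0)) .skip

/-- For `n = 0` the variables have no possible value, so the program skips everything. For `n > 0`
the registers, being zero, make every variable the vertex `0`. -/
lemma does_program (c : Stmt) : ∃ q : Polynomial ℕ,
    (∀ s, s.reg 0 = 0 → Does c.program s (q.eval 0) fun _ => True) ∧
    ∀ (n : ℕ) (z : Fin n) (σ : Mem n) (s : Store), (z : ℕ) = 0 → s.reg 0 = n →
      (∀ x, x ≠ 0 → s.reg x = 0) → Holds σ s →
        Does c.program s (q.eval n) (Holds (c.exec (fun _ => z) σ)) := by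
  obtain ⟨p, hp⟩ := does_stmt c 0
  refine ⟨.X * 17 + p + 11, fun s hs => ?_, fun n z σ s hz h0 hs hh => ?_⟩
  · exact (does_ite (e := .reg 0) (T := 0) (T' := 1) (fun h => absurd hs h) fun _ => does_skip trivial).mono
      (by simp [AExp.cost]) fun _ h => h
  · have h1 : Does (forReg 2 (.seq (.write 4 (.reg 2) (.reg 4))
        (.assign 4 (.add (.reg 4) (.reg 0))))) s (n * (8 + 9) + 7)
        fun s' => (∀ x, x ≠ 2 → x ≠ 4 → s'.reg x = s.reg x) ∧ s'.reg 4 = n * n ∧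
          (∀ a, a ≠ 4 → s'.arr a = s.arr a) ∧ (∀ j < n, s'.arr 4 j = j * n) ∧ s'.reg 2 = n := by
      refine does_forReg (n := n) (T := 8) (fun i s' => (∀ x, x ≠ 2 → x ≠ 4 → s'.reg x = s.reg x) ∧
        s'.reg 4 = i * n ∧ (∀ a, a ≠ 4 → s'.arr a = s.arr a) ∧ (∀ j < i, s'.arr 4 j = j * n) ∧
        s'.reg 2 = i) ?_ ?_ ?_
      · rintro i s' ⟨h1, h2, h3, h4, h5⟩
        exact ⟨by rw [h1 0 (by omega) (by omega), h0], h5⟩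
      · rintro i hi s' ⟨h1, h2, h3, h4, h5⟩
        refine ((does_write (Q := fun s'' => s'' = s'.setArr 4 i (i * n))
          (by simp only [AExp.eval, h2, h5])).seq (T' := 4) ?_).mono
          (by simp [AExp.cost]) fun _ h => h
        rintro s'' rfl
        refine does_assign ⟨?_, fun x hx hx' => ?_, ?_, fun a ha => ?_, fun j hj => ?_, by simp⟩
        · rw [Store.setReg_ne _ _ (by omega)]; exact h5
        · rw [Store.setReg_ne _ _ hx, Store.setReg_ne _ _ hx', Store.setArr_reg, h1 x hx hx']
        · rw [Store.setReg_ne _ _ (by omega)]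
          simp only [Store.setReg_same, AExp.eval, Store.setArr_reg]
          rw [h2, h1 0 (by omega) (by omega), h0, Nat.succ_mul]
        · simp only [Store.setReg_arr]
          rw [Store.setArr_ne _ _ _ ha, h3 a ha]
        · simp only [Store.setReg_arr]
          rw [Store.setArr_arr]
          split_ifs with hji
          · rw [hji.2]
          · exact h4 j (by omega)
      · refine ⟨fun x hx _ => Store.setReg_ne _ _ hx, ?_, fun a _ => rfl,
          fun j hj => by omega, by simp⟩
        rw [Store.setReg_ne _ _ (by omega), hs 4 (by omega)]; simp
    refine (does_ite (e := .reg 0) (T := n * (8 + 9) + 7 + p.eval n + 1) (T' := 1)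
      (fun _ => h1.seq fun s' hs' => ?_) fun h => ?_).mono
      (by simp [AExp.cost]; omega) fun _ h => h
    · obtain ⟨h2, h3, h4, h5, h6⟩ := hs'
      refine (hp n (fun _ => z) σ s' ⟨by rw [h2 0 (by omega) (by omega), h0], fun x => ?_,
        fun i => h5 i i.2⟩ ⟨fun a i => ?_, fun a i j => ?_⟩).mono le_rfl fun s'' h => h.2.1
      · rw [h2 _ (by omega) (by omega), hs _ (by omega), hz]
      · rw [h4 _ (loc1_ne a).1, hh.one]
      · rw [h4 _ (loc2_ne a).1, hh.two]
    · have := z.2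
      simp only [AExp.eval] at h
      omega

end RAM

/-! ### Neighbours of a vertex in one block -/

namespace VectorConnectivity

open SimpleGraph

variable {V : Type*} {G : SimpleGraph V}

lemma reachable_induce_coe {H : G.Subgraph} {x : H.verts} (hH : ∀ a b, a ∈ H.verts → b ∈ H.verts →
    G.Adj a b → H.Adj a b) {a b : V} (q : G.Walk a b)
    (hq : ∀ z ∈ q.support, z ∈ H.verts ∧ z ≠ x) :
    ∀ (ha : a ∈ H.verts) (hb : b ∈ H.verts) (ha' : (⟨a, ha⟩ : H.verts) ∈ ({x}ᶜ : Set H.verts))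
      (hb' : (⟨b, hb⟩ : H.verts) ∈ ({x}ᶜ : Set H.verts)),
      (H.coe.induce ({x}ᶜ : Set H.verts)).Reachable ⟨⟨a, ha⟩, ha'⟩ ⟨⟨b, hb⟩, hb'⟩ := by
  induction q with
  | nil => exact fun _ _ _ _ => Reachable.refl _
  | @cons a c b h p ih =>
    intro ha hb ha' hb'
    have hc := hq c (by simp)
    have hc' : (⟨c, hc.1⟩ : H.verts) ∈ ({x}ᶜ : Set H.verts) := by
      simpa [Subtype.ext_iff] using hc.2
    refine Reachable.trans (Adj.reachable ?_)
      (ih (fun z hz => hq z (by simp [hz])) hc.1 hb hc' hb')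
    simpa using hH a c ha hc.1 h

lemma reachable_coe {H : G.Subgraph} (hH : ∀ a b, a ∈ H.verts → b ∈ H.verts →
    G.Adj a b → H.Adj a b) {a b : V} (q : G.Walk a b) (hq : ∀ z ∈ q.support, z ∈ H.verts) :
    ∀ (ha : a ∈ H.verts) (hb : b ∈ H.verts), H.coe.Reachable ⟨a, ha⟩ ⟨b, hb⟩ := by
  induction q with
  | nil => exact fun _ _ => Reachable.refl _
  | @cons a c b h p ih =>
    intro ha hb
    have hc := hq c (by simp)
    exact Reachable.trans (Adj.reachable (by simpa using hH a c ha hc h))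
      (ih (fun z hz => hq z (by simp [hz])) hc hb)

/-- In a block graph, two neighbours of `v` in the same component of `G - v` are adjacent. -/
lemma IsBlockGraph.adj_of_walk [Finite V] (hG : IsBlockGraph G) {v u w : V} (hu : G.Adj v u)
    (hw : G.Adj v w) (huw : u ≠ w) (p : G.Walk u w) (hp : v ∉ p.support) : G.Adj u w := by
  classical
  set P := p.bypass with hP
  have hPp : P.IsPath := p.bypass_isPath
  have hvP : v ∉ P.support := fun h => hp (p.support_bypass_subset_support h)
  -- The path `P` closes to a cycle through `v`. The subgraph induced on the vertices of this cycle
  -- is biconnected, hence contained in a block, and that block is complete.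
  set s : Set V := insert v {z | z ∈ P.support} with hs
  let H : G.Subgraph := (⊤ : G.Subgraph).induce s
  have hH : ∀ a b, a ∈ H.verts → b ∈ H.verts → G.Adj a b → H.Adj a b := fun a b ha hb hab => by
    simp only [H, Subgraph.induce_adj, Subgraph.top_adj]
    exact ⟨ha, hb, hab⟩
  have hvs : v ∈ H.verts := Set.mem_insert _ _
  have hPs : ∀ z ∈ P.support, z ∈ H.verts := fun z hz => Set.mem_insert_of_mem _ hz
  -- Of the two arcs of the cycle from `y` to `v`, one avoids `x`: the part of `P` after `y` if `x`
  -- comes before `y`, and the part before `y` otherwise.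
  have toV : ∀ (x : V), x ≠ v → ∀ y ∈ H.verts, y ≠ x →
      ∃ q : G.Walk y v, ∀ z ∈ q.support, z ∈ H.verts ∧ z ≠ x := by
    intro x hx y hy hyx
    rcases hy with rfl | hy
    · exact ⟨.nil, by simpa using ⟨hvs, hx.symm⟩⟩
    · have hy' : y ∈ P.support := hy
      by_cases hxt : x ∈ (P.takeUntil y hy').support
      · have hxd : x ∉ (P.dropUntil y hy').support := by
          intro hxd
          have hnd := hPp.support_nodup
          rw [← P.take_spec hy', Walk.support_append] at hnd
          rw [← Walk.cons_tail_support, List.mem_cons] at hxd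
          rcases hxd with h | h
          · exact hyx h.symm
          · exact (List.nodup_append.1 hnd).2.2 _ hxt _ h rfl
        refine ⟨(P.dropUntil y hy').append (.cons hw.symm .nil), fun z hz => ?_⟩
        rw [Walk.mem_support_append_iff] at hz
        rcases hz with hz | hz
        · exact ⟨hPs z (P.support_dropUntil_subset_support hy' hz), fun h => hxd (h ▸ hz)⟩
        · simp only [Walk.support_cons, Walk.support_nil, List.mem_cons, List.not_mem_nil,
            or_false] at hz
          rcases hz with rfl | rfl
          · exact ⟨hPs _ P.end_mem_support, fun h => hxd (h ▸ Walk.end_mem_support _)⟩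
          · exact ⟨hvs, hx.symm⟩
      · refine ⟨(P.takeUntil y hy').reverse.append (.cons hu.symm .nil), fun z hz => ?_⟩
        rw [Walk.mem_support_append_iff, Walk.support_reverse, List.mem_reverse] at hz
        rcases hz with hz | hz
        · exact ⟨hPs z (P.support_takeUntil_subset_support hy' hz), fun h => hxt (h ▸ hz)⟩
        · simp only [Walk.support_cons, Walk.support_nil, List.mem_cons, List.not_mem_nil,
            or_false] at hz
          rcases hz with rfl | rfl
          · exact ⟨hPs _ P.start_mem_support, fun h => hxt (h ▸ Walk.start_mem_support _)⟩
          · exact ⟨hvs, hx.symm⟩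
  have hbi : IsBiconnected H.coe := by
    refine ⟨?_, ?_⟩
    · have hc : ∀ y : H.verts, H.coe.Reachable y ⟨v, hvs⟩ := by
        rintro ⟨y, hy⟩
        rcases id hy with rfl | hy'
        · exact Reachable.refl _
        · refine reachable_coe hH
            ((P.takeUntil y hy').reverse.append (.cons hu.symm .nil)) (fun z hz => ?_) _ _
          rw [Walk.mem_support_append_iff, Walk.support_reverse, List.mem_reverse] at hz
          rcases hz with hz | hz
          · exact hPs z (P.support_takeUntil_subset_support hy' hz)
          · simp only [Walk.support_cons, Walk.support_nil, List.mem_cons, List.not_mem_nil,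
              or_false] at hz
            rcases hz with rfl | rfl
            · exact hPs _ P.start_mem_support
            · exact hvs
      exact (connected_iff _).2 ⟨fun a b => (hc a).trans (hc b).symm, ⟨⟨v, hvs⟩⟩⟩
    · rintro ⟨x, hx⟩ ⟨⟨⟨a, ha⟩, ha'⟩, ⟨⟨b, hb⟩, hb'⟩, -, hab⟩
      have hax : a ≠ x := by simpa using ha'
      have hbx : b ≠ x := by simpa using hb'
      apply hab
      by_cases hxv : x = v
      · subst hxv
        have haP : a ∈ P.support := ha.resolve_left hax
        have hbP : b ∈ P.support := hb.resolve_left hbx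
        refine reachable_induce_coe hH ((P.takeUntil a haP).reverse.append (P.takeUntil b hbP))
          (fun z hz => ?_) _ _ _ _
        have hz' : z ∈ P.support := by
          rw [Walk.mem_support_append_iff, Walk.support_reverse, List.mem_reverse] at hz
          exact hz.elim (fun h => P.support_takeUntil_subset_support _ h)
            fun h => P.support_takeUntil_subset_support _ h
        exact ⟨hPs z hz', by rintro rfl; exact hvP hz'⟩
      · obtain ⟨q, hq⟩ := toV x hxv a ha hax
        obtain ⟨q', hq'⟩ := toV x hxv b hb hbx
        have hv' : (⟨v, hvs⟩ : H.verts) ∈ ({⟨x, hx⟩}ᶜ : Set H.verts) := by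
          simpa using fun h : v = x => hxv h.symm
        exact (reachable_induce_coe hH q hq ha hvs ha' hv').trans
          (reachable_induce_coe hH q' hq' hb hvs hb' hv').symm
  obtain ⟨B, hHB, hB⟩ := Finite.exists_le_maximal
    (p := fun H : G.Subgraph => IsBiconnected H.coe) hbi
  have huB : u ∈ B.verts := hHB.1 (hPs _ P.start_mem_support)
  have hwB : w ∈ B.verts := hHB.1 (hPs _ P.end_mem_support)
  have h : B.coe.Adj ⟨u, huB⟩ ⟨w, hwB⟩ := by
    rw [hG B hB, top_adj]
    simpa using huw
  exact B.adj_sub h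

/-! ### Betweenness -/

/-- `x` lies on a shortest path from `a` to `b`. -/
structure Btw (G : SimpleGraph V) (a x b : V) : Prop where
  left : G.Reachable a x
  right : G.Reachable x b
  dist_eq : G.dist a x + G.dist x b = G.dist a b

lemma Btw.symm {a x b : V} (h : Btw G a x b) : Btw G b x a :=
  ⟨h.right.symm, h.left.symm, by rw [dist_comm, add_comm, dist_comm, h.dist_eq, dist_comm]⟩

lemma exists_walk_btw {a b : V} (h : G.Reachable a b) :
    ∃ p : G.Walk a b, ∀ z ∈ p.support, Btw G a z b := by
  classical
  obtain ⟨p, hp⟩ := h.exists_walk_length_eq_dist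
  refine ⟨p, fun z hz => ⟨(p.takeUntil z hz).reachable, (p.dropUntil z hz).reachable, ?_⟩⟩
  have h1 := dist_le (p.takeUntil z hz)
  have h2 := dist_le (p.dropUntil z hz)
  have h3 := congrArg Walk.length (p.take_spec hz)
  rw [Walk.length_append] at h3
  have h4 := (p.takeUntil z hz).reachable.dist_triangle_left b
  omega

lemma exists_adj_dist {a b : V} (h : G.Reachable a b) (hab : a ≠ b) :
    ∃ y, G.Adj a y ∧ G.dist a b = G.dist y b + 1 := by
  obtain ⟨p, hp⟩ := h.exists_walk_length_eq_dist
  cases p with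
  | nil => exact absurd rfl hab
  | @cons _ y _ hy q =>
    refine ⟨y, hy, ?_⟩
    have h1 := dist_le q
    have h2 := hy.reachable.dist_triangle_left b
    rw [dist_eq_one_iff_adj.2 hy] at h2
    rw [Walk.length_cons] at hp
    omega

/-- In a block graph, the vertices between `a` and `b` separate `a` from `b`. -/
lemma IsBlockGraph.btw_mem [Finite V] (hG : IsBlockGraph G) {a x b : V} (h : Btw G a x b)
    (p : G.Walk a b) : x ∈ p.support := by
  by_contra hx
  have hxa : x ≠ a := fun h => hx (h ▸ p.start_mem_support)
  have hxb : x ≠ b := fun h => hx (h ▸ p.end_mem_support)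
  obtain ⟨y, hy, hya⟩ := exists_adj_dist h.left.symm hxa
  obtain ⟨z, hz, hzb⟩ := exists_adj_dist h.right hxb
  have hyr : G.Reachable y a := hy.symm.reachable.trans h.left.symm
  have hzr : G.Reachable z b := hz.symm.reachable.trans h.right
  obtain ⟨q, hq⟩ := exists_walk_btw hyr
  obtain ⟨q', hq'⟩ := exists_walk_btw hzr
  have h0 := h.dist_eq
  have h1 := hyr.symm.dist_triangle_left b
  rw [dist_comm (u := a) (v := y)] at h1
  rw [dist_comm (u := a) (v := x)] at h0
  by_cases hyz : y = z
  · subst hyz; omega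
  -- The neighbours `y` and `z` of `x` towards `a` and `b` are joined by a walk through `a`, `p` and
  -- `b` that avoids `x`. So they are adjacent, and passing directly from `y` to `z` shortens the
  -- path from `a` to `b` by one.
  · have hadj := hG.adj_of_walk hy hz hyz (q.append (p.append q'.reverse)) fun hxs => by
      simp only [Walk.mem_support_append_iff, Walk.support_reverse, List.mem_reverse] at hxs
      rcases hxs with hxs | hxs | hxs
      · have := (hq x hxs).dist_eq; omega
      · exact hx hxs
      · have := (hq' x hxs).dist_eq; omega
    have h2 := hadj.reachable.dist_triangle_left b
    rw [dist_eq_one_iff_adj.2 hadj] at h2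
    omega

/-- By `btw_mem`, `y` lies on the walk composed of shortest walks from `a` to `x` and from `x` to
`b`. On either part, having the distance of `x` from `a` forces `y = x`. -/
lemma IsBlockGraph.btw_unique [Finite V] (hG : IsBlockGraph G) {a x y b : V} (hx : Btw G a x b)
    (hy : Btw G a y b) (h : G.dist a x = G.dist a y) : x = y := by
  obtain ⟨q, hq⟩ := exists_walk_btw hx.left
  obtain ⟨q', hq'⟩ := exists_walk_btw hx.right
  have hm := hG.btw_mem hy (q.append q')
  rw [Walk.mem_support_append_iff] at hm
  rcases hm with hm | hm
  · have h1 := hq y hm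
    have h2 := h1.dist_eq
    exact ((h1.right.dist_eq_zero_iff).1 (by omega)).symm
  · have h1 := hq' y hm
    have h2 := h1.dist_eq
    have h3 := hx.dist_eq
    have h4 := hy.dist_eq
    exact (h1.left.dist_eq_zero_iff).1 (by omega)

/-! ### Fans in block graphs -/

/-- `x` is the first vertex after `v` on a shortest path from `v` to `w`, or `x = v = w`. -/
def FirstStep (G : SimpleGraph V) (v x w : V) : Prop :=
  (x = v ∧ w = v) ∨ (G.Adj v x ∧ G.Reachable v w ∧ G.dist v w = G.dist x w + 1)

lemma FirstStep.btw {v x w : V} (h : FirstStep G v x w) : Btw G v x w := by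
  rcases h with ⟨rfl, rfl⟩ | ⟨h1, h2, h3⟩
  · exact ⟨.rfl, .rfl, by simp⟩
  · exact ⟨h1.reachable, h1.symm.reachable.trans h2, by rw [dist_eq_one_iff_adj.2 h1, h3, add_comm]⟩

lemma IsBlockGraph.firstStep_unique [Finite V] (hG : IsBlockGraph G) {v x y w : V}
    (hx : FirstStep G v x w) (hy : FirstStep G v y w) : x = y := by
  refine hG.btw_unique hx.btw hy.btw ?_
  rcases hx with ⟨rfl, rfl⟩ | ⟨h1, h2, h3⟩ <;> rcases hy with ⟨rfl, h⟩ | ⟨h4, h5, h6⟩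
  · rfl
  · simp at h6
  · subst h; simp at h3
  · rw [dist_eq_one_iff_adj.2 h1, dist_eq_one_iff_adj.2 h4]

lemma exists_firstStep {v w : V} (h : G.Reachable v w) : ∃ x, FirstStep G v x w := by
  by_cases hvw : v = w
  · exact ⟨v, .inl ⟨rfl, hvw.symm⟩⟩
  · obtain ⟨x, h1, h2⟩ := exists_adj_dist h hvw
    exact ⟨x, .inr ⟨h1, h, h2⟩⟩

open Classical in
/-- The first vertices of the shortest paths from `v` to `T`. -/
noncomputable def dirs [Fintype V] (G : SimpleGraph V) (v : V) (T : Set V) : Finset V :=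
  Finset.univ.filter fun x => ∃ w ∈ T, FirstStep G v x w

lemma mem_dirs [Fintype V] {v x : V} {T : Set V} :
    x ∈ dirs G v T ↔ ∃ w ∈ T, FirstStep G v x w := by
  simp [dirs]

/-- All vertices of the path except `v` lie in direction `x`. As the direction of a vertex is
unique, paths chosen in different directions meet only in `v` and thus form a fan. -/
lemma FirstStep.exists_path {v x w : V} (h : FirstStep G v x w) :
    ∃ P : G.Path v w, ∀ z ∈ P.1.support, z = v ∨ FirstStep G v x z := by
  classical
  rcases id h with ⟨rfl, rfl⟩ | ⟨h1, h2, h3⟩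
  · exact ⟨.nil, by simp⟩
  · obtain ⟨q, hq⟩ := exists_walk_btw (h1.symm.reachable.trans h2)
    refine ⟨(Walk.cons h1 q).toPath, fun z hz => ?_⟩
    have hz' := Walk.support_toPath_subset_support _ hz
    rw [Walk.support_cons, List.mem_cons] at hz'
    refine hz'.imp_right fun hz' => .inr ⟨h1, h1.reachable.trans (hq z hz').left, ?_⟩
    have h4 := (hq z hz').dist_eq
    have h5 := (h1.reachable.trans (hq z hz').left).dist_triangle_left w
    have h6 := h1.reachable.dist_triangle_left z
    rw [dist_eq_one_iff_adj.2 h1] at h6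
    omega

/-- In a block graph the order of a largest fan from `v` to `T` is the number of directions in
which `v` sees `T`. -/
lemma IsBlockGraph.isLinked_iff [Fintype V] (hG : IsBlockGraph G) {v : V} {T : Set V} {k : ℕ} :
    IsLinked G v T k ↔ k ≤ (dirs G v T).card := by
  constructor
  · rintro ⟨e, P, he, hT, hP⟩
    choose x hx using fun i => exists_firstStep (P i).1.reachable
    -- Two paths of the fan in the same direction would both contain its first vertex, which must
    -- then be `v`; so both would end at `v`, but the ends are distinct.
    have hinj : Function.Injective x := by
      intro i j hij
      by_contra hne
      have hi := hG.btw_mem (hx i).btw (P i).1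
      have hj := hG.btw_mem (hx j).btw (P j).1
      rw [← hij] at hj
      have hv := hP i j hne _ hi hj
      have hend : ∀ l, x l = v → e l = v := by
        intro l hl
        rcases hx l with h | h
        · exact h.2
        · rw [hl] at h; exact absurd h.1 (G.irrefl)
      exact hne (he ((hend i hv).trans (hend j (hij ▸ hv)).symm))
    calc k = (Finset.univ.map ⟨x, hinj⟩).card := by simp
      _ ≤ _ := Finset.card_le_card fun y hy => by
        obtain ⟨i, -, rfl⟩ := Finset.mem_map.1 hy
        exact mem_dirs.2 ⟨e i, hT i, hx i⟩
  · intro hk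
    obtain ⟨f⟩ := Function.Embedding.nonempty_of_card_le
      (α := Fin k) (β := dirs G v T) (by simpa using hk)
    choose w hw hx using fun i => mem_dirs.1 (f i).2
    choose P hP using fun i => (hx i).exists_path
    have hf : ∀ i j, (f i : V) = f j → i = j := fun i j h => f.injective (Subtype.ext h)
    refine ⟨w, P, fun i j hij => ?_, hw, fun i j hij z hi hj => ?_⟩
    · have := hx j
      rw [← hij] at this
      exact hf i j (hG.firstStep_unique (hx i) this)
    · by_contra hz
      exact hij (hf i j (hG.firstStep_unique ((hP i z hi).resolve_left hz)
        ((hP j z hj).resolve_left hz)))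

end VectorConnectivity

namespace VectorConnectivity

open SimpleGraph

variable {V : Type*} {G : SimpleGraph V}

/-! ### Rooted block graphs -/

lemma FirstStep.adj {v p a : V} (h : FirstStep G v p a) (hva : v ≠ a) : G.Adj v p :=
  h.elim (fun h => absurd h.2.symm hva) fun h => h.1

lemma FirstStep.dist_eq {v p a : V} (h : FirstStep G v p a) (hva : v ≠ a) :
    G.dist a v = G.dist a p + 1 := by
  rcases h with h | h
  · exact absurd h.2.symm hva
  · rw [dist_comm, h.2.2, dist_comm]

lemma firstStep_of_adj {v p a : V} (h : G.Adj v p) (hr : G.Reachable a v)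
    (hd : G.dist a v = G.dist a p + 1) : FirstStep G v p a :=
  .inr ⟨h, hr.symm, by rw [dist_comm, hd, dist_comm]⟩

lemma dist_le_succ_of_adj {a v u : V} (h : G.Adj v u) : G.dist a u ≤ G.dist a v + 1 := by
  have := h.reachable.dist_triangle_right a
  rwa [dist_eq_one_iff_adj.2 h] at this

lemma dist_le_succ_of_adj_left {b v u : V} (h : G.Adj v u) : G.dist v b ≤ G.dist u b + 1 := by
  have := h.reachable.dist_triangle_left b
  rw [dist_eq_one_iff_adj.2 h] at this
  omega

lemma Btw.refl_right {a b : V} (h : G.Reachable a b) : Btw G a b b := ⟨h, .rfl, by simp⟩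

lemma Btw.trans {a x y b : V} (h : Btw G a x y) (h' : Btw G a y b) : Btw G a x b := by
  refine ⟨h.left, h.right.trans h'.right, ?_⟩
  have h1 := h.dist_eq
  have h2 := h'.dist_eq
  have h3 := h.right.dist_triangle_left b
  have h4 := h.left.dist_triangle_left b
  omega

lemma Btw.dist_lt {a x b : V} (h : Btw G a x b) (hxb : x ≠ b) : G.dist a x < G.dist a b := by
  have h1 := h.dist_eq
  have h2 := h.right.pos_dist_of_ne hxb
  omega

/-- Shortest paths leaving `v` in different blocks can be glued together at `v`. -/
lemma IsBlockGraph.btw_of_firstStep [Finite V] (hG : IsBlockGraph G) {v p u a b : V}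
    (hp : FirstStep G v p a) (hu : FirstStep G v u b) (hva : v ≠ a) (hvb : v ≠ b) (hpu : p ≠ u)
    (hadj : ¬ G.Adj p u) : Btw G a v b := by
  have h1 := hp.adj hva
  have h2 := hu.adj hvb
  obtain ⟨q, hq⟩ := exists_walk_btw hp.btw.right
  obtain ⟨q', hq'⟩ := exists_walk_btw hu.btw.right
  obtain ⟨s, hs⟩ := exists_walk_btw (hp.btw.left.trans hp.btw.right |>.symm.trans
    (hu.btw.left.trans hu.btw.right))
  by_contra hv
  -- If `v` is not between `a` and `b`, then the shortest walk `s` avoids it, and so does the walk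
  -- from `p` through `a` and `b` to `u`.
  refine hadj (hG.adj_of_walk h1 h2 hpu (q.append (s.append q'.reverse)) fun hm => ?_)
  simp only [Walk.mem_support_append_iff, Walk.support_reverse, List.mem_reverse] at hm
  rcases hm with hm | hm | hm
  · have h3 := (hq v hm).dist_eq
    have h4 := hp.dist_eq hva
    rw [dist_comm (u := a), dist_comm (u := a)] at h4
    omega
  · exact hv (hs v hm)
  · have h3 := (hq' v hm).dist_eq
    have h4 := hu.dist_eq hvb
    rw [dist_comm (u := b), dist_comm (u := b)] at h4
    omega

/-- The parent of `v` and the child `c` have depths differing by 2, so they are not adjacent, and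
the shortest paths from `v` to `ρ` and to `w` can be glued at `v`. -/
lemma IsBlockGraph.firstStep_child [Finite V] (hG : IsBlockGraph G) {ρ v c w : V}
    (hv : G.Reachable ρ v) (hc : G.Adj v c) (hd : G.dist ρ c = G.dist ρ v + 1) :
    FirstStep G v c w ↔ Btw G ρ c w := by
  constructor
  · intro h
    by_cases hvρ : v = ρ
    · subst hvρ; exact h.btw
    have hvw : v ≠ w := by
      rintro rfl
      rcases h with ⟨rfl, -⟩ | ⟨-, -, h⟩
      · exact G.irrefl hc
      · simp at h
    obtain ⟨p, hp⟩ := exists_firstStep hv.symm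
    have hpd := hp.dist_eq hvρ
    have hb := hG.btw_of_firstStep hp h hvρ hvw (by rintro rfl; omega) fun hpc => by
      have := dist_le_succ_of_adj (a := ρ) hpc
      omega
    have h1 := hb.dist_eq
    have h2 := h.dist_eq hvw
    rw [dist_comm (u := w), dist_comm (u := w)] at h2
    exact ⟨hv.trans hc.reachable, h.btw.right, by omega⟩
  · intro h
    refine .inr ⟨hc, hc.reachable.trans h.right, ?_⟩
    have h1 := h.dist_eq
    have h2 := hv.dist_triangle_left w
    have h3 := dist_le_succ_of_adj_left (b := w) hc
    omega

/-- The parent `p` of `v` separates `v` from `ρ`, hence it lies on the walk that goes to `u` and on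
to `ρ` by a shortest path. So siblings have the same parent. -/
lemma IsBlockGraph.firstStep_of_sibling [Finite V] (hG : IsBlockGraph G) {ρ v u p : V}
    (hv : G.Reachable ρ v) (hvρ : v ≠ ρ) (hu : G.Adj v u) (hd : G.dist ρ u = G.dist ρ v)
    (hp : FirstStep G v p ρ) : FirstStep G u p ρ := by
  obtain ⟨q, hq⟩ := exists_walk_btw (hu.symm.reachable.trans hv.symm)
  have hm := hG.btw_mem hp.btw (.cons hu q)
  rw [Walk.support_cons, List.mem_cons] at hm
  rcases hm with hm | hm
  · exact absurd hm (hp.adj hvρ).ne'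
  · have h1 := (hq p hm).dist_eq
    have h2 := hp.dist_eq hvρ
    rw [dist_comm (v := ρ), dist_comm (v := ρ)] at h1
    exact firstStep_of_adj (dist_eq_one_iff_adj.1 (by omega)) (hv.trans hu.reachable) (by omega)

/-- Forwards, the paths from `u` to `ρ` and to `w` are glued at `u`: if the common parent `p` were
adjacent to the next vertex `u'` towards `w`, then so would be `v`, and `v` would be too close to
`w`. Backwards, if `u` were not the first step, `v` and `u` would be two vertices between `ρ` and
`w` at the same depth. -/
lemma IsBlockGraph.firstStep_sibling [Finite V] (hG : IsBlockGraph G) {ρ v u w : V}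
    (hv : G.Reachable ρ v) (hvρ : v ≠ ρ) (hu : G.Adj v u) (hd : G.dist ρ u = G.dist ρ v) :
    FirstStep G v u w ↔ Btw G ρ u w := by
  constructor
  · intro h
    have hvw : v ≠ w := by
      rintro rfl
      rcases h with ⟨rfl, -⟩ | ⟨-, -, h⟩
      · exact G.irrefl hu
      · simp at h
    by_cases huw : u = w
    · subst huw; exact .refl_right (hv.trans hu.reachable)
    have huρ : u ≠ ρ := by
      rintro rfl
      rw [SimpleGraph.dist_self] at hd
      exact hvρ (hv.dist_eq_zero_iff.1 hd.symm).symm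
    obtain ⟨p, hp⟩ := exists_firstStep hv.symm
    have hp' := hG.firstStep_of_sibling hv hvρ hu hd hp
    obtain ⟨u', hu'⟩ := exists_firstStep (h.btw.right)
    have h1 := h.dist_eq hvw
    have h2 := hu'.dist_eq huw
    rw [dist_comm (u := w), dist_comm (u := w)] at h1 h2
    have hpv := hp.adj hvρ
    have h3 := dist_le_succ_of_adj_left (b := w) hpv
    refine hG.btw_of_firstStep hp' hu' huρ huw (by rintro rfl; omega) fun hpu => ?_
    have hvu' : v ≠ u' := by rintro rfl; omega
    have hadj := hG.adj_of_walk hu.symm (hu'.adj huw) hvu' (.cons hpv (.cons hpu .nil)) (by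
      simp only [Walk.support_cons, Walk.support_nil, List.mem_cons, List.not_mem_nil, or_false,
        not_or]
      exact ⟨hu.ne', (hp'.adj huρ).ne, (hu'.adj huw).ne⟩)
    have h4 := dist_le_succ_of_adj_left (b := w) hadj
    omega
  · intro h
    refine .inr ⟨hu, hu.reachable.trans h.right, ?_⟩
    have h1 := h.dist_eq
    have h2 := hv.dist_triangle_left w
    have h3 := dist_le_succ_of_adj_left (b := w) hu
    by_contra hne
    have hb : Btw G ρ v w := ⟨hv, hu.reachable.trans h.right, by omega⟩
    exact hu.ne (hG.btw_unique hb h hd.symm)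

/-- `u` equals `v`, or it is a neighbour of `v` with the same distance from `ρ`. -/
def Sib (G : SimpleGraph V) (ρ v u : V) : Prop :=
  u = v ∨ (G.Adj v u ∧ G.dist ρ u = G.dist ρ v)

lemma Sib.dist_eq {ρ v u : V} (h : Sib G ρ v u) : G.dist ρ u = G.dist ρ v := by
  rcases h with rfl | h
  · rfl
  · exact h.2

lemma Sib.reachable {ρ v u : V} (h : Sib G ρ v u) (hv : G.Reachable ρ v) : G.Reachable ρ u := by
  rcases h with rfl | h
  · exact hv
  · exact hv.trans h.1.reachable

lemma Sib.ne {ρ v u : V} (h : Sib G ρ v u) (hv : G.Reachable ρ v) (hvρ : v ≠ ρ) : u ≠ ρ := by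
  rintro rfl
  have := h.dist_eq
  rw [SimpleGraph.dist_self] at this
  exact hvρ (hv.dist_eq_zero_iff.1 this.symm).symm

lemma Sib.symm {ρ v u : V} (h : Sib G ρ v u) : Sib G ρ u v := by
  rcases h with rfl | h
  · exact .inl rfl
  · exact .inr ⟨h.1.symm, h.2.symm⟩

lemma IsBlockGraph.sib_firstStep [Finite V] (hG : IsBlockGraph G) {ρ v u p : V}
    (hv : G.Reachable ρ v) (hvρ : v ≠ ρ) (hu : Sib G ρ v u) (hp : FirstStep G v p ρ) :
    FirstStep G u p ρ := by
  rcases hu with rfl | hu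
  · exact hp
  · exact hG.firstStep_of_sibling hv hvρ hu.1 hu.2 hp

/-- Two siblings of `v` are both adjacent to the common parent and joined through `v` by a walk that
avoids the parent, so they are adjacent. -/
lemma IsBlockGraph.sib_trans [Finite V] (hG : IsBlockGraph G) {ρ v u w : V}
    (hv : G.Reachable ρ v) (hvρ : v ≠ ρ) (hu : Sib G ρ v u) (hw : Sib G ρ v w) : Sib G ρ u w := by
  by_cases huw : w = u
  · exact .inl huw
  rcases hu with rfl | hu
  · exact hw
  rcases hw with rfl | hw
  · exact .inr ⟨hu.1.symm, hu.2.symm⟩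
  obtain ⟨p, hp⟩ := exists_firstStep hv.symm
  have hup := hG.firstStep_of_sibling hv hvρ hu.1 hu.2 hp
  have hwp := hG.firstStep_of_sibling hv hvρ hw.1 hw.2 hp
  have h1 := hup.adj (Sib.ne (.inr hu) hv hvρ)
  have h2 := hwp.adj (Sib.ne (.inr hw) hv hvρ)
  refine .inr ⟨hG.adj_of_walk h1.symm h2.symm (Ne.symm huw)
    (.cons hu.1.symm (.cons hw.1 .nil)) ?_, hw.2.trans hu.2.symm⟩
  simp only [Walk.support_cons, Walk.support_nil, List.mem_cons, List.not_mem_nil, or_false,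
    not_or]
  exact ⟨h1.ne', (hp.adj hvρ).ne', h2.ne'⟩

/-! ### Hit vertices and the number of directions -/

/-- A shortest path from `ρ` through `u` contains a vertex of `T`. -/
def Hit (G : SimpleGraph V) (ρ : V) (T : Set V) (u : V) : Prop := ∃ w ∈ T, Btw G ρ u w

section

variable [Fintype V]

open Classical in
/-- The neighbours of `v` not closer to `ρ` than `v` that are hit by `T`. -/
noncomputable def hitNb (G : SimpleGraph V) (ρ : V) (T : Set V) (v : V) : Finset V :=
  Finset.univ.filter fun u => G.Adj v u ∧ G.dist ρ v ≤ G.dist ρ u ∧ Hit G ρ T u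

open Classical in
/-- The neighbours of `v` farther from `ρ` than `v` that are hit by `T`. -/
noncomputable def hitKids (G : SimpleGraph V) (ρ : V) (T : Set V) (v : V) : Finset V :=
  Finset.univ.filter fun u => G.Adj v u ∧ G.dist ρ u = G.dist ρ v + 1 ∧ Hit G ρ T u

lemma mem_hitNb {ρ v u : V} {T : Set V} :
    u ∈ hitNb G ρ T v ↔ G.Adj v u ∧ G.dist ρ v ≤ G.dist ρ u ∧ Hit G ρ T u := by
  simp [hitNb]

lemma mem_hitKids {ρ v u : V} {T : Set V} :
    u ∈ hitKids G ρ T v ↔ G.Adj v u ∧ G.dist ρ u = G.dist ρ v + 1 ∧ Hit G ρ T u := by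
  simp [hitKids]

open Classical in
-- The three summands are the direction `v` itself, the parent, and the remaining neighbours. The
-- parent always counts because `ρ ∈ T`, and by uniqueness it is the only neighbour closer to the
-- root. In the direction of any other neighbour `u`, the vertices seen are those beyond `u` as
-- viewed from the root.
lemma IsBlockGraph.card_dirs (hG : IsBlockGraph G) {ρ v : V} {T : Set V} (hv : G.Reachable ρ v)
    (hvρ : v ≠ ρ) (hT : ρ ∈ T) :
    (dirs G v T).card = (if v ∈ T then 1 else 0) + 1 + (hitNb G ρ T v).card := by
  obtain ⟨p, hp⟩ := exists_firstStep hv.symm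
  have hpd := hp.dist_eq hvρ
  have hpv := hp.adj hvρ
  have hset : dirs G v T = (if v ∈ T then {v} else ∅) ∪ {p} ∪ hitNb G ρ T v := by
    ext x
    simp only [mem_dirs, Finset.mem_union, Finset.mem_singleton, mem_hitNb]
    constructor
    · rintro ⟨w, hw, h⟩
      rcases id h with ⟨rfl, rfl⟩ | ⟨h1, h2, h3⟩
      · simp [hw]
      · have h4 := dist_le_succ_of_adj (a := ρ) h1
        have h5 := dist_le_succ_of_adj (a := ρ) h1.symm
        by_cases hlt : G.dist ρ x < G.dist ρ v
        · exact .inl (.inr (hG.firstStep_unique (firstStep_of_adj h1 hv (by omega)) hp))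
        · refine .inr ⟨h1, by omega, w, hw, ?_⟩
          by_cases heq : G.dist ρ x = G.dist ρ v
          · exact (hG.firstStep_sibling hv hvρ h1 heq).1 h
          · exact (hG.firstStep_child hv h1 (by omega)).1 h
    · rintro ((h | rfl) | ⟨h1, h2, w, hw, h3⟩)
      · split_ifs at h with hvT
        · rw [Finset.mem_singleton] at h
          exact ⟨v, hvT, .inl ⟨h, rfl⟩⟩
        · simp at h
      · exact ⟨ρ, hT, hp⟩
      · have h4 := dist_le_succ_of_adj (a := ρ) h1
        refine ⟨w, hw, ?_⟩
        by_cases heq : G.dist ρ x = G.dist ρ v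
        · exact (hG.firstStep_sibling hv hvρ h1 heq).2 h3
        · exact (hG.firstStep_child hv h1 (by omega)).2 h3
  rw [hset, Finset.card_union_of_disjoint, Finset.card_union_of_disjoint]
  · split_ifs <;> simp
  · split_ifs <;> simp [hpv.ne]
  · rw [Finset.disjoint_union_left]
    constructor
    · split_ifs
      · simp [mem_hitNb]
      · simp
    · rw [Finset.disjoint_singleton_left, mem_hitNb]
      rintro ⟨-, h, -⟩
      omega

end

end VectorConnectivity

namespace VectorConnectivity

open SimpleGraph

variable {V : Type*} {G : SimpleGraph V}

/-! ### Exchanging the part of a solution in one block -/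

/-- A vertex that witnesses a hit of `u` is at least as deep as `u`, hence in the region where `S`
and `T` agree. So choices nearer to the root do not affect what is hit below. -/
lemma hit_iff_of_agree {ρ v u : V} {F : Set V} {S T : Finset V}
    (hv : G.dist ρ v < G.dist ρ u)
    (hST : ∀ x, G.Reachable ρ x → G.dist ρ v < G.dist ρ x → (x ∈ T ↔ x ∈ S)) :
    Hit G ρ (T ∪ F) u ↔ Hit G ρ (S ∪ F) u := by
  have key : ∀ w, Btw G ρ u w → (w ∈ T ↔ w ∈ S) := fun w hw =>
    hST w (hw.left.trans hw.right) (by have := hw.dist_eq; omega)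
  constructor
  · rintro ⟨w, hw, hb⟩
    exact ⟨w, hw.imp_left fun h => (key w hb).1 h, hb⟩
  · rintro ⟨w, hw, hb⟩
    exact ⟨w, hw.imp_left fun h => (key w hb).2 h, hb⟩

lemma hit_iff_of_agree_below {ρ u : V} {F : Set V} {S T : Finset V} (hu : G.Reachable ρ u)
    (huS : u ∉ S)
    (hST : ∀ x, G.Reachable ρ x → G.dist ρ u < G.dist ρ x → (x ∈ T ↔ x ∈ S)) :
    Hit G ρ (T ∪ F) u ↔ Hit G ρ (S ∪ F) u ∨ u ∈ T := by
  have key : ∀ w, Btw G ρ u w → w ≠ u → (w ∈ T ↔ w ∈ S) := fun w hw hne =>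
    hST w (hw.left.trans hw.right) (hw.dist_lt hne.symm)
  constructor
  · rintro ⟨w, hw, hb⟩
    by_cases hwu : w = u
    · subst hwu
      exact hw.elim .inr fun h => .inl ⟨w, .inr h, hb⟩
    · exact .inl ⟨w, hw.imp_left fun h => (key w hb hwu).1 h, hb⟩
  · rintro (⟨w, hw, hb⟩ | h)
    · by_cases hwu : w = u
      · subst hwu
        exact ⟨w, hw.elim (fun h => absurd h huS) .inr, hb⟩
      · exact ⟨w, hw.imp_left fun h => (key w hb hwu).2 h, hb⟩
    · exact ⟨u, .inl h, .refl_right hu⟩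

variable [Fintype V]

open Classical in
/-- `v` together with its neighbours at the same distance from `ρ`. -/
noncomputable def sibs (G : SimpleGraph V) (ρ v : V) : Finset V :=
  Finset.univ.filter fun u => Sib G ρ v u

lemma mem_sibs {ρ v u : V} : u ∈ sibs G ρ v ↔ Sib G ρ v u := by simp [sibs]

open Classical in
/-- The number of vertices of `K` that are hit by `A` or belong to `X`. -/
noncomputable def hits (G : SimpleGraph V) (ρ : V) (A : Set V) (K X : Finset V) : ℕ :=
  (K.filter fun u => Hit G ρ A u ∨ u ∈ X).card

open Classical in
/-- The number of directions other than those of its siblings that are available to `u`. -/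
noncomputable def capacity (G : SimpleGraph V) (ρ : V) (F A : Set V) (u : V) : ℕ :=
  1 + (if u ∈ F then 1 else 0) + (hitKids G ρ A u).card

open Classical in
/-- The requirements in `K` are met when `X` is added to the solution, provided that the solution
contains the root. -/
def LocalOK (G : SimpleGraph V) (ρ : V) (F : Set V) (r : V → ℕ) (A : Set V) (K X : Finset V) :
    Prop :=
  ∀ u ∈ K, u ∉ X → r u + (if Hit G ρ A u then 1 else 0) ≤ hits G ρ A K X + capacity G ρ F A u

/-- The requirements in the component of `ρ` are met by `T` and the free vertices `F`. -/
def Feasible (G : SimpleGraph V) (ρ : V) (F : Set V) (r : V → ℕ) (T : Finset V) : Prop :=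
  ∀ v, G.Reachable ρ v → v ∉ T → r v ≤ (dirs G v ((T : Set V) ∪ F)).card

open Classical in
/-- The requirement of a vertex outside a solution that contains the root, in terms of the part of
the solution at least as far from the root. -/
lemma IsBlockGraph.le_card_dirs_iff (hG : IsBlockGraph G) {ρ v u : V} {F : Set V} {r : V → ℕ}
    {S T X : Finset V} (hv : G.Reachable ρ v) (hvρ : v ≠ ρ) (hu : Sib G ρ v u) (hρ : ρ ∈ T)
    (huT : u ∉ T) (hS : ∀ x, Sib G ρ v x → x ∉ S) (hX : ∀ x, Sib G ρ v x → (x ∈ X ↔ x ∈ T))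
    (hST : ∀ x, G.Reachable ρ x → G.dist ρ v < G.dist ρ x → (x ∈ T ↔ x ∈ S)) :
    r u ≤ (dirs G u (T ∪ F)).card ↔
      r u + (if Hit G ρ (S ∪ F) u then 1 else 0) ≤
        hits G ρ (S ∪ F) (sibs G ρ v) X + capacity G ρ F (S ∪ F) u := by
  have hur := hu.reachable hv
  have huρ := hu.ne hv hvρ
  have hhit : ∀ x, Sib G ρ v x → (Hit G ρ (T ∪ F) x ↔ Hit G ρ (S ∪ F) x ∨ x ∈ X) := by
    intro x hx
    rw [hX x hx]
    refine hit_iff_of_agree_below (hx.reachable hv) (hS x hx) fun y hy hxy => hST y hy ?_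
    rwa [hx.dist_eq] at hxy
  set B := (sibs G ρ v).filter fun x => Hit G ρ (S ∪ F) x ∨ x ∈ X with hB
  have hset : hitNb G ρ (T ∪ F) u = hitKids G ρ (S ∪ F) u ∪ B.erase u := by
    ext x
    simp only [mem_hitNb, Finset.mem_union, mem_hitKids, Finset.mem_erase, hB, Finset.mem_filter,
      mem_sibs]
    constructor
    · rintro ⟨h1, h2, h3⟩
      have h4 := dist_le_succ_of_adj (a := ρ) h1
      by_cases heq : G.dist ρ x = G.dist ρ u
      · have hvx : Sib G ρ v x := hG.sib_trans hur huρ hu.symm (.inr ⟨h1, heq⟩)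
        exact .inr ⟨h1.ne', hvx, (hhit x hvx).1 h3⟩
      · exact .inl ⟨h1, by omega, (hit_iff_of_agree (by rw [← hu.dist_eq]; omega) hST).1 h3⟩
    · rintro (⟨h1, h2, h3⟩ | ⟨h1, h2, h3⟩)
      · exact ⟨h1, by omega, (hit_iff_of_agree (by rw [← hu.dist_eq]; omega) hST).2 h3⟩
      · have hux := (hG.sib_trans hv hvρ hu h2).resolve_left h1
        exact ⟨hux.1, hux.2.ge, (hhit x h2).2 h3⟩
  have hcard : (hitNb G ρ (T ∪ F) u).card = (hitKids G ρ (S ∪ F) u).card + (B.erase u).card := by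
    rw [hset, Finset.card_union_of_disjoint]
    rw [Finset.disjoint_left]
    intro x hx hx'
    have h1 := (mem_hitKids.1 hx).2.1
    have h2 : Sib G ρ v x := mem_sibs.1 (Finset.mem_filter.1 (Finset.mem_erase.1 hx').2).1
    have h3 := hu.dist_eq
    have h4 := h2.dist_eq
    omega
  -- If `u` is hit, it is counted among the hit vertices of its class although it is not its own
  -- neighbour; this explains the indicator term in the local condition.
  have hBe : (B.erase u).card + (if Hit G ρ (S ∪ F) u then 1 else 0) = B.card := by
    have huX : u ∉ X := fun h => huT ((hX u hu).1 h)
    by_cases huB : Hit G ρ (S ∪ F) u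
    · rw [if_pos huB]
      exact Finset.card_erase_add_one (by simp [hB, mem_sibs, hu, huB])
    · rw [if_neg huB, Finset.erase_eq_of_notMem (by simp [hB, huB, huX]), add_zero]
  have huF : u ∈ ((T : Set V) ∪ F) ↔ u ∈ F := by simp [huT]
  rw [hG.card_dirs hur huρ (.inl hρ), hcard, hits, capacity, ← hB, ← hBe]
  simp only [huF]
  omega

open Classical in
/-- An optimal local choice in one block can be built into every feasible set that agrees with the
choices made farther from the root. -/
lemma IsBlockGraph.exchange (hG : IsBlockGraph G) {ρ v : V} {F D : Set V} {r : V → ℕ}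
    {S T X : Finset V} (hv : G.Reachable ρ v) (hvρ : v ≠ ρ)
    (hdeep : ∀ x, G.Reachable ρ x → G.dist ρ v < G.dist ρ x → x ∈ D)
    (hhigh : ∀ x ∈ D, G.dist ρ v ≤ G.dist ρ x) (hdisj : ∀ x ∈ D, ¬ Sib G ρ v x)
    (hS : ∀ x, x ∈ S ↔ x ∈ T ∧ x ∈ D) (hρ : ρ ∈ T) (hTr : ∀ x ∈ T, G.Reachable ρ x)
    (hT : Feasible G ρ F r T) (hX : X ⊆ sibs G ρ v)
    (hXok : LocalOK G ρ F r (S ∪ F) (sibs G ρ v) X)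
    (hXopt : ∀ Y ⊆ sibs G ρ v, LocalOK G ρ F r (S ∪ F) (sibs G ρ v) Y → X.card ≤ Y.card ∧
      (X.card = Y.card → hits G ρ (S ∪ F) (sibs G ρ v) Y ≤ hits G ρ (S ∪ F) (sibs G ρ v) X)) :
    ∃ T' : Finset V, ρ ∈ T' ∧ (∀ x ∈ T', G.Reachable ρ x) ∧ Feasible G ρ F r T' ∧
      T'.card ≤ T.card ∧ ∀ x, x ∈ S ∪ X ↔ x ∈ T' ∧ (x ∈ D ∨ Sib G ρ v x) := by
  set K := sibs G ρ v with hK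
  obtain ⟨p, hp⟩ := exists_firstStep hv.symm
  have hpd := hp.dist_eq hvρ
  have hpr : G.Reachable ρ p := hp.btw.right.symm
  have hpD : p ∉ D := fun h => by have := hhigh p h; omega
  have hpK : ¬ Sib G ρ v p := fun h => by have := h.dist_eq; omega
  have hSK : ∀ x, Sib G ρ v x → x ∉ S := fun x hx h => hdisj x ((hS x).1 h).2 hx
  have hTS : ∀ x, G.Reachable ρ x → G.dist ρ v < G.dist ρ x → (x ∈ T ↔ x ∈ S) := fun x hx h => by
    simp [hS, hdeep x hx h]
  -- Feasibility of `T` makes its own part in `K` a competitor of `X`.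
  have hY : LocalOK G ρ F r (S ∪ F) K (T ∩ K) := by
    intro u hu huY
    have huK := mem_sibs.1 hu
    have huT : u ∉ T := fun h => huY (Finset.mem_inter.2 ⟨h, hu⟩)
    exact (hG.le_card_dirs_iff hv hvρ huK hρ huT hSK
      (fun x hx => by simp [hK, mem_sibs, hx]) hTS).1 (hT u (huK.reachable hv) huT)
  obtain ⟨hle, heq⟩ := hXopt _ Finset.inter_subset_right hY
  -- The parent is added exactly when `X` saves a vertex to pay for it; this removes the requirement
  -- of `p`.
  set P : Finset V := if X.card < (T ∩ K).card then {p} else ∅ with hP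
  have hPp : ∀ x ∈ P, x = p := by
    intro x hx
    rw [hP] at hx
    split_ifs at hx
    · simpa using hx
    · simp at hx
  set T' : Finset V := (T \ K) ∪ X ∪ P with hT'
  have hmem : ∀ x, x ∈ T' ↔ (x ∈ T ∧ x ∉ K) ∨ x ∈ X ∨ x ∈ P := by
    intro x; simp [hT']
  have hρK : ρ ∉ K := fun h => (mem_sibs.1 h).ne hv hvρ rfl
  have hρT' : ρ ∈ T' := (hmem ρ).2 (.inl ⟨hρ, hρK⟩)
  have hT'K : ∀ x, Sib G ρ v x → (x ∈ X ↔ x ∈ T') := by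
    intro x hx
    rw [hmem]
    refine ⟨fun h => .inr (.inl h), ?_⟩
    rintro (h | h | h)
    · exact absurd (mem_sibs.2 hx) h.2
    · exact h
    · rw [hPp x h] at hx; exact absurd hx hpK
  have hT'n : ∀ x, ¬ Sib G ρ v x → x ≠ p → (x ∈ T' ↔ x ∈ T) := by
    intro x hx hxp
    have hxK : x ∉ K := fun h => hx (mem_sibs.1 h)
    rw [hmem]
    constructor
    · rintro (h | h | h)
      · exact h.1
      · exact absurd (hX h) hxK
      · exact absurd (hPp x h) hxp
    · exact fun h => .inl ⟨h, hxK⟩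
  have hT'S : ∀ x, G.Reachable ρ x → G.dist ρ v < G.dist ρ x → (x ∈ T' ↔ x ∈ S) := by
    intro x hx h
    rw [hT'n x (fun hs => by have := hs.dist_eq; omega) (by rintro rfl; omega), hTS x hx h]
  -- If the witness `w` lies in `K`, then `u` is on the path from `ρ` to the parent `p`. The new
  -- witness is `p` itself when it was added. Otherwise `X` has as many elements as `T ∩ K`, so it
  -- is nonempty, and any element of it lies beyond `p`.
  have hhitup : ∀ u, ¬ Sib G ρ v u → Hit G ρ (T ∪ F) u → Hit G ρ (T' ∪ F) u := by
    rintro u hu ⟨w, hw, hb⟩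
    by_cases hwF : w ∈ F
    · exact ⟨w, .inr hwF, hb⟩
    have hwT : w ∈ T := hw.resolve_right hwF
    by_cases hwK : w ∈ K
    · have hws := mem_sibs.1 hwK
      have huw : u ≠ w := by rintro rfl; exact hu hws
      have hwp := hG.sib_firstStep hv hvρ hws hp
      have hwρ := hws.ne hv hvρ
      have hwpd := hwp.dist_eq hwρ
      obtain ⟨z, hz⟩ := exists_firstStep hb.right.symm
      have hzd := hz.dist_eq huw.symm
      have hzb := hz.btw.symm
      have hbz : Btw G ρ u z := by
        refine ⟨hb.left, hzb.left, ?_⟩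
        have h1 := hb.dist_eq
        have h2 := hb.left.dist_triangle_left z
        have h3 := dist_le_succ_of_adj (a := ρ) (hz.adj huw.symm).symm
        omega
      have hzp : z = p := by
        refine hG.firstStep_unique (firstStep_of_adj (hz.adj huw.symm)
          (hws.reachable hv) ?_) hwp
        have h1 := hb.dist_eq
        have h2 := hbz.dist_eq
        omega
      subst hzp
      by_cases hlt : X.card < (T ∩ K).card
      · exact ⟨z, .inl ((hmem z).2 (.inr (.inr (by rw [hP, if_pos hlt]; simp)))), hbz⟩
      · have hpos : 0 < X.card := by
          have : 0 < (T ∩ K).card := Finset.card_pos.2 ⟨w, Finset.mem_inter.2 ⟨hwT, hwK⟩⟩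
          omega
        obtain ⟨x, hx⟩ := Finset.card_pos.1 hpos
        have hxs := mem_sibs.1 (hX hx)
        have hxp := hG.sib_firstStep hv hvρ hxs hp
        exact ⟨x, .inl ((hmem x).2 (.inr (.inl hx))), hbz.trans hxp.btw.symm⟩
    · exact ⟨w, .inl ((hmem w).2 (.inl ⟨hwT, hwK⟩)), hb⟩
  refine ⟨T', hρT', fun x hx => ?_, ?_, ?_, fun x => ?_⟩
  · rcases (hmem x).1 hx with h | h | h
    · exact hTr x h.1
    · exact (mem_sibs.1 (hX h)).reachable hv
    · rw [hPp x h]; exact hpr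
  · intro u hu huT'
    by_cases huK : Sib G ρ v u
    · exact (hG.le_card_dirs_iff hv hvρ huK hρT' huT' hSK hT'K hT'S).2
        (hXok u (mem_sibs.2 huK) fun h => huT' ((hT'K u huK).1 h))
    have huT : u ∉ T := fun h => huT' ((hmem u).2 (.inl ⟨h, fun h => huK (mem_sibs.1 h)⟩))
    have huρ : u ≠ ρ := by rintro rfl; exact huT' hρT'
    refine (hT u hu huT).trans ?_
    rw [hG.card_dirs hu huρ (.inl hρ), hG.card_dirs hu huρ (.inl hρT')]
    refine Nat.add_le_add (le_of_eq (by simp [huT, huT'])) ?_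
    -- The parent can be outside `T'` only if no vertex was saved. The tie-breaking rule then bounds
    -- its hit neighbours in `K`, and `hhitup` deals with the others.
    by_cases hup : u = p
    · subst hup
      have hcardeq : X.card = (T ∩ K).card := by
        by_contra hne
        exact huT' ((hmem u).2 (.inr (.inr (by rw [hP, if_pos (by omega)]; simp))))
      have hhits := heq hcardeq
      have hin : ∀ (R Z : Finset V), (∀ x, Sib G ρ v x → (x ∈ Z ↔ x ∈ R)) →
          (∀ x, G.Reachable ρ x → G.dist ρ v < G.dist ρ x → (x ∈ R ↔ x ∈ S)) →
          ((hitNb G ρ (R ∪ F) u).filter fun x => x ∈ K) =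
            K.filter fun x => Hit G ρ (S ∪ F) x ∨ x ∈ Z := by
        intro R Z hZ hRS
        ext x
        simp only [Finset.mem_filter, mem_hitNb]
        have hiff : Sib G ρ v x → (Hit G ρ (R ∪ F) x ↔ Hit G ρ (S ∪ F) x ∨ x ∈ Z) := fun hx => by
          rw [hZ x hx]
          refine hit_iff_of_agree_below (hx.reachable hv) (hSK x hx) fun y hy hxy => hRS y hy ?_
          rwa [hx.dist_eq] at hxy
        constructor
        · rintro ⟨⟨-, -, h⟩, hx⟩
          exact ⟨hx, (hiff (mem_sibs.1 hx)).1 h⟩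
        · rintro ⟨hx, h⟩
          have hxs := mem_sibs.1 hx
          have hxp := hG.sib_firstStep hv hvρ hxs hp
          refine ⟨⟨(hxp.adj (hxs.ne hv hvρ)).symm, ?_, (hiff hxs).2 h⟩, hx⟩
          have := hxs.dist_eq
          omega
      rw [← Finset.card_filter_add_card_filter_not (s := hitNb G ρ (T ∪ F) u) (fun x => x ∈ K),
        ← Finset.card_filter_add_card_filter_not (s := hitNb G ρ (T' ∪ F) u) (fun x => x ∈ K),
        hin T (T ∩ K) (fun x hx => by simp [hK, mem_sibs, hx]) hTS, hin T' X hT'K hT'S]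
      refine Nat.add_le_add hhits (Finset.card_le_card fun x hx => ?_)
      simp only [Finset.mem_filter, mem_hitNb] at hx ⊢
      exact ⟨⟨hx.1.1, hx.1.2.1, hhitup x (fun h => hx.2 (mem_sibs.2 h)) hx.1.2.2⟩, hx.2⟩
    · refine Finset.card_le_card fun x hx => ?_
      rw [mem_hitNb] at hx ⊢
      refine ⟨hx.1, hx.2.1, hhitup x (fun hxs => ?_) hx.2.2⟩
      -- A vertex outside `K` other than `p` has no neighbour in `K` at its own depth or deeper: at
      -- equal depth it would be a sibling, and otherwise it would be the parent.
      by_cases hd : G.dist ρ x = G.dist ρ u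
      · exact huK (hG.sib_trans (hxs.reachable hv) (hxs.ne hv hvρ) hxs.symm
          (.inr ⟨hx.1.symm, hd.symm⟩))
      · have h1 := dist_le_succ_of_adj (a := ρ) hx.1
        exact hup (hG.firstStep_unique (firstStep_of_adj hx.1.symm (hxs.reachable hv) (by omega))
          (hG.sib_firstStep hv hvρ hxs hp))
  · have h1 : T'.card ≤ (T \ K).card + X.card + P.card :=
      (Finset.card_union_le _ _).trans (Nat.add_le_add_right (Finset.card_union_le _ _) _)
    have h2 := Finset.card_sdiff_add_card_inter T K
    have h3 : P.card ≤ (T ∩ K).card - X.card := by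
      rw [hP]
      split_ifs
      · rw [Finset.card_singleton]; omega
      · simp
    omega
  · rw [Finset.mem_union]
    by_cases hxK : Sib G ρ v x
    · simp [hxK, hSK x hxK, hT'K x hxK]
    · have hxX : x ∉ X := fun h => hxK (mem_sibs.1 (hX h))
      by_cases hxp : x = p
      · subst hxp
        simp [hxX, hxK, hpD, hS]
      · simp [hxX, hxK, hS, hT'n x hxK hxp]

end VectorConnectivity

namespace VectorConnectivity

/-! ### The optimal choice in one block -/

/-- Taking the elements with fewer than `m` predecessors is a way to select `m` elements of `A` by a
formula. -/
lemma card_filter_card_lt {α : Type*} [LinearOrder α] (A : Finset α) (m : ℕ) :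
    (A.filter fun x => (A.filter fun y => y < x).card < m).card = min m A.card := by
  induction A using Finset.induction_on_max with
  | empty => simp
  | insert a A ha ih =>
    have haA : a ∉ A := fun h => lt_irrefl _ (ha a h)
    have h1 : (insert a A).filter (fun y => y < a) = A := by
      ext y
      simp only [Finset.mem_filter, Finset.mem_insert]
      refine ⟨?_, fun h => ⟨.inr h, ha y h⟩⟩
      rintro ⟨rfl | h, h'⟩
      · exact absurd h' (lt_irrefl _)
      · exact h
    have h2 : ∀ x ∈ A, (insert a A).filter (fun y => y < x) = A.filter fun y => y < x := by
      intro x hx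
      ext y
      simp only [Finset.mem_filter, Finset.mem_insert]
      refine ⟨?_, fun h => ⟨.inr h.1, h.2⟩⟩
      rintro ⟨rfl | h, h'⟩
      · exact absurd h' (ha x hx).not_gt
      · exact ⟨h, h'⟩
    rw [Finset.filter_insert, h1, Finset.filter_congr fun x hx => by rw [h2 x hx],
      Finset.card_insert_of_notMem haA]
    split_ifs with h
    · rw [Finset.card_insert_of_notMem (by simp [haA]), ih]
      omega
    · rw [ih]
      omega

section

open Classical

variable {n : ℕ} (K : Finset (Fin n)) (a : Fin n → Prop) (r c : Fin n → ℕ)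

/-- With `h` vertices of the block hit, the requirement of `x` is not met. -/
def Short (x : Fin n) (h : ℕ) : Prop := h + c x < r x + (if a x then 1 else 0)

/-- The number of vertices of the block that are hit before the choice. -/
noncomputable def hitCount : ℕ := (K.filter fun x => a x).card

/-- The number of vertices not yet hit that have to be chosen if `h` vertices are to be hit. -/
noncomputable def freshCount (h : ℕ) : ℕ := (K.filter fun x => ¬ a x ∧ Short a r c x h).card

/-- It is possible to have `h` vertices of the block hit. -/
def Attainable (h : ℕ) : Prop := freshCount K a r c h + hitCount K a ≤ h ∧ h ≤ K.card

/-- Up to a constant, the least number of vertices to be chosen if `h` vertices are to be hit. -/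
noncomputable def price (h : ℕ) : ℕ := (K.filter fun x => a x ∧ Short a r c x h).card + h

/-- `h` is the best number of vertices to be hit. -/
def IsBest (h : Fin n) : Prop := Attainable K a r c h ∧ ∀ h' : Fin n, Attainable K a r c h' →
  price K a r c h < price K a r c h' ∨ (price K a r c h = price K a r c h' ∧ h' ≤ h)

/-- The vertex `x` is chosen if `h` vertices are to be hit. -/
def Chosen (h : ℕ) (x : Fin n) : Prop := x ∈ K ∧ (Short a r c x h ∨ (¬ a x ∧
  (K.filter fun y => (¬ a y ∧ ¬ Short a r c y h) ∧ y < x).card + freshCount K a r c h +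
    hitCount K a < h))

variable {K a r c}

lemma hits_eq {Y : Finset (Fin n)} (hY : Y ⊆ K) :
    (K.filter fun u => a u ∨ u ∈ Y).card = hitCount K a + (Y.filter fun u => ¬ a u).card := by
  rw [hitCount, ← Finset.card_union_of_disjoint]
  · congr 1
    ext u
    have := @hY u
    simp only [Finset.mem_filter, Finset.mem_union]
    tauto
  · rw [Finset.disjoint_left]
    intro u hu hu'
    exact (Finset.mem_filter.1 hu').2 (Finset.mem_filter.1 hu).2

/-- A valid choice with `h` hits contains all vertices that are short for `h`. The fresh ones among
them are new hits, so there is room for them; the others add to the size without changing the number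
of hits. -/
lemma attainable_hits {Y : Finset (Fin n)} (hY : Y ⊆ K)
    (hok : ∀ u ∈ K, u ∉ Y → ¬ Short a r c u (K.filter fun u => a u ∨ u ∈ Y).card) :
    Attainable K a r c (K.filter fun u => a u ∨ u ∈ Y).card ∧
      price K a r c (K.filter fun u => a u ∨ u ∈ Y).card ≤ Y.card + hitCount K a := by
  set h := (K.filter fun u => a u ∨ u ∈ Y).card with hh
  have h1 : h = hitCount K a + (Y.filter fun u => ¬ a u).card := hits_eq hY
  have h2 : freshCount K a r c h ≤ (Y.filter fun u => ¬ a u).card := by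
    refine Finset.card_le_card fun u hu => ?_
    rw [Finset.mem_filter] at hu ⊢
    exact ⟨by_contra fun huY => hok u hu.1 huY hu.2.2, hu.2.1⟩
  have h3 : (K.filter fun x => a x ∧ Short a r c x h).card ≤ (Y.filter fun u => a u).card := by
    refine Finset.card_le_card fun u hu => ?_
    rw [Finset.mem_filter] at hu ⊢
    exact ⟨by_contra fun huY => hok u hu.1 huY hu.2.2, hu.2.1⟩
  have h4 := Finset.card_filter_add_card_filter_not (s := Y) (fun u => a u)
  refine ⟨⟨by omega, Finset.card_filter_le _ _⟩, ?_⟩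
  rw [price]
  omega

/-- Choosing the whole block is always possible, so `h = K.card` is attainable, and `K.card < n`
lets this number be a value of a program variable. Among the attainable numbers of least price the
largest is taken. -/
lemma exists_isBest (hK : K.card < n) : ∃ h, IsBest K a r c h := by
  have hne : (Finset.univ.filter fun h : Fin n => Attainable K a r c h).Nonempty := by
    refine ⟨⟨K.card, hK⟩, Finset.mem_filter.2 ⟨Finset.mem_univ _, ?_, le_rfl⟩⟩
    rw [freshCount, hitCount, ← Finset.card_union_of_disjoint]
    · exact Finset.card_le_card (Finset.union_subset (Finset.filter_subset _ _)
        (Finset.filter_subset _ _))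
    · rw [Finset.disjoint_left]
      intro u hu hu'
      exact (Finset.mem_filter.1 hu).2.1 (Finset.mem_filter.1 hu').2
  obtain ⟨h0, hh0, hmin⟩ := Finset.exists_min_image _ (fun h : Fin n => price K a r c h) hne
  have hne' : (Finset.univ.filter fun h : Fin n => Attainable K a r c h ∧
      price K a r c h = price K a r c h0).Nonempty :=
    ⟨h0, by simpa using (Finset.mem_filter.1 hh0).2⟩
  obtain ⟨h1, hh1, hmax⟩ := Finset.exists_max_image _ id hne'
  simp only [Finset.mem_filter, Finset.mem_univ, true_and, id] at hh0 hh1 hmin hmax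
  refine ⟨h1, hh1.1, fun h' hh' => ?_⟩
  have h2 := hmin h' hh'
  by_cases heq : price K a r c h' = price K a r c h0
  · exact .inr ⟨hh1.2.trans heq.symm, hmax h' ⟨hh', heq⟩⟩
  · exact .inl (by omega)

/-- The choice consists of all short vertices and of the first remaining vertices not yet hit, as
many as are missing to reach `h`. Attainability ensures that this number is neither negative nor too
large. -/
lemma card_chosen {h : ℕ} (hh : Attainable K a r c h) :
    ((K.filter fun x => Chosen K a r c h x).filter fun x => ¬ a x).card + hitCount K a = h ∧
      (K.filter fun x => Chosen K a r c h x).card + hitCount K a = price K a r c h := by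
  set A := K.filter fun y => ¬ a y ∧ ¬ Short a r c y h with hA
  have hK : hitCount K a + freshCount K a r c h + A.card = K.card := by
    have h1 := Finset.card_filter_add_card_filter_not (s := K) (fun u => a u)
    have h2 := Finset.card_filter_add_card_filter_not (s := K.filter fun u => ¬ a u)
      (fun u => Short a r c u h)
    rw [Finset.filter_filter, Finset.filter_filter] at h2
    rw [hitCount, freshCount, hA]
    omega
  have hun : ((K.filter fun x => Chosen K a r c h x).filter fun x => ¬ a x) =
      (K.filter fun x => ¬ a x ∧ Short a r c x h) ∪
        A.filter fun x => (A.filter fun y => y < x).card <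
          h - freshCount K a r c h - hitCount K a := by
    ext x
    simp only [Finset.mem_filter, Finset.mem_union, hA, Finset.filter_filter,
      Nat.lt_sub_iff_add_lt]
    simp only [Chosen]
    rw [show ∀ p q s : ℕ, p + q + s = p + s + q by intros; omega]
    tauto
  have h1 : ((K.filter fun x => Chosen K a r c h x).filter fun x => ¬ a x).card +
      hitCount K a = h := by
    rw [hun, Finset.card_union_of_disjoint, card_filter_card_lt]
    · have := hh.1
      have := hh.2
      rw [freshCount] at *
      omega
    · rw [Finset.disjoint_left]
      intro u hu hu'
      simp only [hA, Finset.mem_filter] at hu hu'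
      exact hu'.1.2.2 hu.2.2
  refine ⟨h1, ?_⟩
  have h2 : ((K.filter fun x => Chosen K a r c h x).filter fun x => a x) =
      K.filter fun x => a x ∧ Short a r c x h := by
    ext x
    simp only [Finset.mem_filter]
    simp only [Chosen]
    tauto
  have h3 := Finset.card_filter_add_card_filter_not (s := K.filter fun x => Chosen K a r c h x)
    (fun u => a u)
  rw [h2] at h3
  rw [price]
  omega

/-- The vertices chosen for the best number of hits are an optimal choice. -/
lemma chosen_optimal {X : Finset (Fin n)} (hK : K.card < n)
    (hX : ∀ x, x ∈ X ↔ ∃ h : Fin n, IsBest K a r c h ∧ Chosen K a r c h x) :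
    X ⊆ K ∧ (∀ u ∈ K, u ∉ X → ¬ Short a r c u (K.filter fun u => a u ∨ u ∈ X).card) ∧
      ∀ Y ⊆ K, (∀ u ∈ K, u ∉ Y → ¬ Short a r c u (K.filter fun u => a u ∨ u ∈ Y).card) →
        X.card ≤ Y.card ∧ (X.card = Y.card →
          (K.filter fun u => a u ∨ u ∈ Y).card ≤ (K.filter fun u => a u ∨ u ∈ X).card) := by
  obtain ⟨h, hh⟩ := exists_isBest (a := a) (r := r) (c := c) hK
  have huniq : ∀ h', IsBest K a r c h' → h' = h := by
    intro h' hh'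
    rcases hh.2 h' hh'.1 with h1 | h1 <;> rcases hh'.2 h hh.1 with h2 | h2
    · omega
    · omega
    · omega
    · exact le_antisymm h1.2 h2.2
  have hXeq : X = K.filter fun x => Chosen K a r c h x := by
    ext x
    rw [hX, Finset.mem_filter]
    constructor
    · rintro ⟨h', hb, hc⟩
      rw [huniq h' hb] at hc
      exact ⟨hc.1, hc⟩
    · exact fun hx => ⟨h, hh, hx.2⟩
  have hXK : X ⊆ K := hXeq ▸ Finset.filter_subset _ _
  obtain ⟨h1, h2⟩ := card_chosen hh.1
  rw [← hXeq] at h1 h2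
  have h3 : (K.filter fun u => a u ∨ u ∈ X).card = h := by rw [hits_eq hXK]; omega
  refine ⟨hXK, fun u hu huX hs => huX ?_, fun Y hY hok => ?_⟩
  · rw [h3] at hs
    exact (hX u).2 ⟨h, hh, hu, .inl hs⟩
  · obtain ⟨h4, h5⟩ := attainable_hits hY hok
    rw [h3]
    -- Prices are sizes up to the constant `hitCount K a`, so the comparison of `h` with the number
    -- of hits of `Y` gives both claims.
    have h6 := hh.2 ⟨_, h4.2.trans_lt hK⟩ h4
    simp only [Fin.le_def] at h6
    omega

end

end VectorConnectivity

namespace RAM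

/-! ### Logical and counting expressions -/

namespace Expr

/-- Negation. -/
def not (e : Expr) : Expr := .sub (.num 1) e

/-- Conjunction. -/
def and (e f : Expr) : Expr := .ite e f (.num 0)

/-- Disjunction. -/
def or (e f : Expr) : Expr := .ite e (.num 1) f

/-- Comparison. -/
def le (e f : Expr) : Expr := .not (.sub e f)

/-- Strict comparison. -/
def lt (e f : Expr) : Expr := .not (.le f e)

/-- Equality. -/
def eq (e f : Expr) : Expr := .and (.le e f) (.le f e)

/-- The truth value `0` or `1`. -/
def ind (e : Expr) : Expr := .ite e (.num 1) (.num 0)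

/-- The number of values of variable `x` for which `e` is true. -/
def count (x : ℕ) (e : Expr) : Expr := .sum x (.ind e)

/-- The formula `e` is true for some value of variable `x`. -/
def ex (x : ℕ) (e : Expr) : Expr := .sum x e

/-- The formula `e` is true for all values of variable `x`. -/
def all (x : ℕ) (e : Expr) : Expr := .not (.ex x (.not e))

/-- Expressions are true if their value is not `0`. -/
def IsTrue {n : ℕ} (σ : Mem n) (ρ : ℕ → Fin n) (e : Expr) : Prop := e.eval σ ρ ≠ 0

variable {n : ℕ} {σ : Mem n} {ρ : ℕ → Fin n} {e f g : Expr} {a x y : ℕ}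

@[simp] lemma eval_num {c : ℕ} : (num c).eval σ ρ = c := rfl

@[simp] lemma eval_idx : (idx x).eval σ ρ = ρ x := rfl

@[simp] lemma eval_get1 : (get1 a x).eval σ ρ = σ.one a (ρ x) := rfl

@[simp] lemma eval_get2 : (get2 a x y).eval σ ρ = σ.two a (ρ x) (ρ y) := rfl

@[simp] lemma eval_add : (add e f).eval σ ρ = e.eval σ ρ + f.eval σ ρ := rfl

lemma true_get1 : IsTrue σ ρ (get1 a x) ↔ σ.one a (ρ x) ≠ 0 := Iff.rfl

lemma true_get2 : IsTrue σ ρ (get2 a x y) ↔ σ.two a (ρ x) (ρ y) ≠ 0 := Iff.rfl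

@[simp] lemma true_not : IsTrue σ ρ (not e) ↔ ¬ IsTrue σ ρ e := by
  simp only [IsTrue, not, eval]; omega

@[simp] lemma true_and : IsTrue σ ρ (and e f) ↔ IsTrue σ ρ e ∧ IsTrue σ ρ f := by
  simp only [IsTrue, and, eval]; split_ifs <;> simp [*]

@[simp] lemma true_or : IsTrue σ ρ (or e f) ↔ IsTrue σ ρ e ∨ IsTrue σ ρ f := by
  simp only [IsTrue, or, eval]; split_ifs <;> simp [*]

@[simp] lemma true_le : IsTrue σ ρ (le e f) ↔ e.eval σ ρ ≤ f.eval σ ρ := by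
  simp only [IsTrue, le, not, eval]; omega

@[simp] lemma true_lt : IsTrue σ ρ (lt e f) ↔ e.eval σ ρ < f.eval σ ρ := by
  simp [lt]

@[simp] lemma true_eq : IsTrue σ ρ (eq e f) ↔ e.eval σ ρ = f.eval σ ρ := by
  simp only [eq, true_and, true_le]; omega

@[simp] lemma true_ex : IsTrue σ ρ (ex x e) ↔ ∃ i, IsTrue σ (Function.update ρ x i) e := by
  simp [IsTrue, ex, eval]

@[simp] lemma true_all : IsTrue σ ρ (all x e) ↔ ∀ i, IsTrue σ (Function.update ρ x i) e := by
  simp [all]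

open Classical in
@[simp] lemma eval_ind : (ind e).eval σ ρ = if IsTrue σ ρ e then 1 else 0 := by
  simp only [ind, eval, IsTrue]; congr

open Classical in
@[simp] lemma eval_count : (count x e).eval σ ρ =
    (Finset.univ.filter fun i => IsTrue σ (Function.update ρ x i) e).card := by
  simp [count, eval]

lemma eval_ite : (ite e f g).eval σ ρ =
    @_root_.ite _ (IsTrue σ ρ e) (Classical.dec _) (f.eval σ ρ) (g.eval σ ρ) := by
  simp only [IsTrue, eval]; congr

end Expr

variable {n : ℕ}

/-- Set all rows of matrix `a`. -/
def rows (a : ℕ) (e : Expr) : Stmt := .loop 1 (.row a e)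

/-- When row `i` is computed, the rows before it have already changed. So `e` may depend on other
matrices and on the old row `i` of `a`, but on no other row of `a`. -/
lemma exec_rows {a : ℕ} {e : Expr} {ρ : ℕ → Fin n} {σ : Mem n} (f : Fin n → Fin n → ℕ)
    (h : ∀ (τ : Mem n) i j, τ.one = σ.one → (∀ b, b ≠ a → τ.two b = σ.two b) →
      τ.two a i = σ.two a i → e.eval τ (Function.update (Function.update ρ 1 i) 0 j) = f i j) :
    (rows a e).exec ρ σ = { σ with two := Function.update σ.two a f } := by
  have key : ((rows a e).exec ρ σ).one = σ.one ∧
      (∀ b, b ≠ a → ((rows a e).exec ρ σ).two b = σ.two b) ∧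
      (∀ i : Fin n, (i : ℕ) < n → ((rows a e).exec ρ σ).two a i = f i) ∧
      (∀ i : Fin n, n ≤ (i : ℕ) → ((rows a e).exec ρ σ).two a i = σ.two a i) := by
    simp only [rows, Stmt.exec]
    refine loopN_induction (fun k (τ : Mem n) => τ.one = σ.one ∧
      (∀ b, b ≠ a → τ.two b = σ.two b) ∧ (∀ i : Fin n, (i : ℕ) < k → τ.two a i = f i) ∧
      ∀ i : Fin n, k ≤ (i : ℕ) → τ.two a i = σ.two a i) ⟨rfl, fun _ _ => rfl, by simp, by simp⟩ ?_
    rintro i τ ⟨h1, h2, h3, h4⟩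
    refine ⟨h1, fun b hb => by simp [hb, h2], fun j hj => ?_, fun j hj => ?_⟩
    · by_cases hji : j = i
      · subst hji
        ext l
        simpa using h τ j l h1 h2 (h4 j le_rfl)
      · have : (j : ℕ) ≠ i := fun h => hji (Fin.ext h)
        simp only [Function.update_self]
        rw [Function.update_of_ne (by simpa using hji), h3 j (by omega)]
    · have hji : j ≠ i := by rintro rfl; omega
      simp only [Function.update_self]
      rw [Function.update_of_ne (by simpa using hji), h4 j (by omega)]
  obtain ⟨h1, h2, h3, -⟩ := key
  have h4 : ((rows a e).exec ρ σ).two = Function.update σ.two a f := by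
    funext b
    by_cases hb : b = a
    · subst hb; funext i; rw [h3 i i.2]; simp
    · rw [h2 b hb]; simp [hb]
  cases hτ : (rows a e).exec ρ σ
  rw [hτ] at h1 h4
  simp only at h1 h4
  rw [h1, h4]

end RAM

namespace VectorConnectivity

open SimpleGraph RAM

/-! ### Computing reachability and distances -/

/-- Matrix `1` becomes the reachability relation and matrix `2` the distance. -/
def distances : Stmt :=
  .seq (rows 1 (.ind (.eq (.idx 1) (.idx 0))))
    (.loop 2 (.seq (rows 2 (.add (.get2 2 1 0) (.ind (.not (.get2 1 1 0)))))
      (.seq (rows 3 (.or (.get2 1 1 0) (.ex 3 (.and (.get2 1 1 3) (.get2 0 3 0)))))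
        (rows 1 (.get2 3 1 0)))))

variable {n : ℕ} {G : SimpleGraph (Fin n)}

/-- The memory holds the instance `(G, F, r)` together with reachability and distances. -/
structure Data (G : SimpleGraph (Fin n)) (F : Set (Fin n)) (r : Fin n → ℕ) (σ : Mem n) :
    Prop where
  req : σ.one 0 = r
  free : ∀ v, σ.one 2 v ≠ 0 ↔ v ∈ F
  adj : ∀ u v, σ.two 0 u v ≠ 0 ↔ G.Adj u v
  reach : ∀ u v, σ.two 1 u v ≠ 0 ↔ G.Reachable u v
  dist : ∀ u v, G.Reachable u v → σ.two 2 u v = G.dist u v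

lemma Data.congr {F : Set (Fin n)} {r : Fin n → ℕ} {σ τ : Mem n} (h : Data G F r σ)
    (h0 : τ.one 0 = σ.one 0) (h2 : τ.one 2 = σ.one 2) (ht : τ.two = σ.two) : Data G F r τ :=
  ⟨h0.trans h.req, by rw [h2]; exact h.free, by rw [ht]; exact h.adj, by rw [ht]; exact h.reach,
    by rw [ht]; exact h.dist⟩

lemma dist_lt_of_reachable {u v : Fin n} (h : G.Reachable u v) : G.dist u v < n := by
  obtain ⟨p, hp, hl⟩ := h.exists_path_of_dist
  rw [← hl]
  simpa using hp.length_lt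

/-- After `k` rounds matrix `1` marks the pairs at distance at most `k`. Each round adds 1 to matrix
`2` at the pairs not yet marked, which gives `min k (G.dist u v)` for reachable pairs. Matrix `3` is
a buffer, so that a round extends paths by one edge only; `n` rounds suffice since distances are
below `n`. -/
lemma exec_distances (ρ : ℕ → Fin n) {σ : Mem n}
    (hadj : ∀ u v, σ.two 0 u v ≠ 0 ↔ G.Adj u v) (h2 : ∀ u v, σ.two 2 u v = 0) :
    (distances.exec ρ σ).one = σ.one ∧ (distances.exec ρ σ).two 0 = σ.two 0 ∧
      (∀ u v, (distances.exec ρ σ).two 1 u v ≠ 0 ↔ G.Reachable u v) ∧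
      ∀ u v, G.Reachable u v → (distances.exec ρ σ).two 2 u v = G.dist u v := by
  have key : (distances.exec ρ σ).one = σ.one ∧ (distances.exec ρ σ).two 0 = σ.two 0 ∧
      (∀ u v, (distances.exec ρ σ).two 1 u v ≠ 0 ↔ G.Reachable u v ∧ G.dist u v ≤ n) ∧
      ∀ u v, G.Reachable u v → (distances.exec ρ σ).two 2 u v = min n (G.dist u v) := by
    simp only [distances, Stmt.exec]
    refine loopN_induction (fun k (τ : Mem n) => τ.one = σ.one ∧ τ.two 0 = σ.two 0 ∧
      (∀ u v, τ.two 1 u v ≠ 0 ↔ G.Reachable u v ∧ G.dist u v ≤ k) ∧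
      ∀ u v, G.Reachable u v → τ.two 2 u v = min k (G.dist u v)) ?_ ?_
    · rw [exec_rows (fun i j => if i = j then 1 else 0) ?_]
      · refine ⟨rfl, by simp, fun u v => ?_, fun u v _ => by simp [h2]⟩
        simp only [Function.update_self, ne_eq, ite_eq_right_iff, one_ne_zero, imp_false, not_not]
        constructor
        · rintro rfl; simp
        · rintro ⟨h, h'⟩
          exact h.dist_eq_zero_iff.1 (by omega)
      · intro τ i j _ _ _
        simp [Fin.ext_iff]
    · rintro k τ ⟨h1, h0, h3, h4⟩
      classical
      set f : Fin n → Fin n → ℕ :=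
        fun i j => τ.two 2 i j + (if τ.two 1 i j ≠ 0 then 0 else 1) with hf
      have e1 : ∀ ρ : ℕ → Fin n, (rows 2 (.add (.get2 2 1 0) (.ind (.not (.get2 1 1 0))))).exec ρ τ =
          { τ with two := Function.update τ.two 2 f } := by
        intro ρ
        refine exec_rows _ fun τ' i j g1 g2 g3 => ?_
        simp only [Expr.eval_add, Expr.eval_get2, Expr.eval_ind, Expr.true_not, Expr.true_get2]
        simp [g2 1, g3, hf]
      set τ1 : Mem n := { τ with two := Function.update τ.two 2 f } with hτ1
      let g : (ℕ → Fin n) → Fin n → Fin n → ℕ := fun ρ i j =>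
        (Expr.or (.get2 1 1 0) (.ex 3 (.and (.get2 1 1 3) (.get2 0 3 0)))).eval τ1
          (Function.update (Function.update ρ 1 i) 0 j)
      have e2 : ∀ ρ : ℕ → Fin n,
          (rows 3 (.or (.get2 1 1 0) (.ex 3 (.and (.get2 1 1 3) (.get2 0 3 0))))).exec ρ τ1 =
          { τ1 with two := Function.update τ1.two 3 (g ρ) } := by
        intro ρ
        refine exec_rows _ fun τ' i j g1 g2 g3 => ?_
        simp [g, Expr.or, Expr.ex, Expr.and, Expr.eval, g2 1, g2 0]
      have e3 : ∀ (ρ : ℕ → Fin n) (τ2 : Mem n), (rows 1 (.get2 3 1 0)).exec ρ τ2 =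
          { τ2 with two := Function.update τ2.two 1 fun i j => τ2.two 3 i j } := by
        intro ρ τ2
        refine exec_rows _ fun τ' i j g1 g2 g3 => ?_
        simp [Expr.eval, g2 3]
      rw [e1, e2, e3]
      refine ⟨h1, by simp [hτ1, h0], fun u v => ?_, fun u v huv => ?_⟩
      · simp only [Function.update_self]
        change Expr.IsTrue τ1 _ (Expr.or (.get2 1 1 0) (.ex 3 (.and (.get2 1 1 3) (.get2 0 3 0)))) ↔ _
        simp only [Expr.true_or, Expr.true_ex, Expr.true_and, Expr.true_get2, hτ1]
        simp only [Function.update_self, ne_eq, not_false_eq_true, one_ne_zero,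
          Function.update_of_ne, OfNat.zero_ne_ofNat, OfNat.one_ne_ofNat]
        simp only [h3, h0, hadj]
        constructor
        · rintro (⟨h, h'⟩ | ⟨w, ⟨h, h'⟩, hw⟩)
          · exact ⟨h, by omega⟩
          · exact ⟨h.trans hw.reachable, (dist_le_succ_of_adj hw).trans (by omega)⟩
        · rintro ⟨h, h'⟩
          by_cases huv : u = v
          · subst huv; exact .inl ⟨h, by simp⟩
          · obtain ⟨w, hw, hd⟩ := exists_adj_dist h.symm (Ne.symm huv)
            rw [dist_comm, dist_comm (u := w)] at hd
            exact .inr ⟨w, ⟨h.trans hw.reachable, by omega⟩, hw.symm⟩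
      · simp only [hτ1, hf, Function.update_self, ne_eq, OfNat.ofNat_ne_one, not_false_eq_true,
          Function.update_of_ne, Nat.reduceEqDiff]
        simp only [h3, h4 u v huv, huv, true_and]
        split_ifs <;> omega
  obtain ⟨k1, k2, k3, k4⟩ := key
  refine ⟨k1, k2, fun u v => (k3 u v).trans ⟨fun h => h.1, fun h =>
    ⟨h, (dist_lt_of_reachable h).le⟩⟩, fun u v h => ?_⟩
  rw [k4 u v h, min_eq_right (dist_lt_of_reachable h).le]

end VectorConnectivity

namespace VectorConnectivity

open SimpleGraph RAM

/-! ### The choice in one block as a program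

Variable `10` is the root and variable `12` a vertex of the block. Vector `0` holds the
requirements, vector `2` the free vertices, vector `3` the solution. -/

/-- Vector `4`: the vertices hit by the solution and the free vertices. -/
def hitStmt : Stmt := .vec 4 (.ind (.ex 5 (.and (.and (.get2 1 10 0) (.get2 1 0 5))
  (.and (.eq (.get2 2 10 5) (.add (.get2 2 10 0) (.get2 2 0 5)))
    (.or (.get1 3 5) (.get1 2 5))))))

/-- Vector `5`: the capacities. -/
def capacityStmt : Stmt := .vec 5 (.add (.add (.num 1) (.ind (.get1 2 0)))
  (.count 1 (.and (.get2 0 0 1)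
    (.and (.get1 4 1) (.eq (.get2 2 10 1) (.add (.get2 2 10 0) (.num 1)))))))

/-- Vector `6`: the block of variable `12` without its vertex closest to the root. -/
def blockStmt : Stmt := .vec 6 (.ind (.or (.eq (.idx 0) (.idx 12))
  (.and (.get2 0 12 0) (.eq (.get2 2 10 0) (.get2 2 10 12)))))

/-- The formula for `Short`. -/
def shortE (x h : ℕ) : Expr :=
  .lt (.add (.idx h) (.get1 5 x)) (.add (.get1 0 x) (.ind (.get1 4 x)))

/-- The expression for `hitCount`. -/
def hitCountE : Expr := .count 5 (.and (.get1 6 5) (.get1 4 5))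

/-- The expression for `freshCount`. -/
def freshCountE (h : ℕ) : Expr :=
  .count 5 (.and (.get1 6 5) (.and (.not (.get1 4 5)) (shortE 5 h)))

/-- The formula for `Attainable`. -/
def attainableE (h : ℕ) : Expr :=
  .and (.le (.add (freshCountE h) hitCountE) (.idx h)) (.le (.idx h) (.count 5 (.get1 6 5)))

/-- The expression for `price`. -/
def priceE (h : ℕ) : Expr :=
  .add (.count 5 (.and (.get1 6 5) (.and (.get1 4 5) (shortE 5 h)))) (.idx h)

/-- The formula for `IsBest`. -/
def isBestE (h : ℕ) : Expr :=
  .and (attainableE h) (.all 4 (.or (.not (attainableE 4)) (.or (.lt (priceE h) (priceE 4))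
    (.and (.eq (priceE h) (priceE 4)) (.le (.idx 4) (.idx h))))))

/-- The formula for `Chosen`. -/
def chosenE (h x : ℕ) : Expr :=
  .and (.get1 6 x) (.or (shortE x h) (.and (.not (.get1 4 x))
    (.lt (.add (.add (.count 5 (.and (.get1 6 5)
      (.and (.and (.not (.get1 4 5)) (.not (shortE 5 h))) (.lt (.idx 5) (.idx x)))))
        (freshCountE h)) hitCountE) (.idx h))))

/-- The formula saying that the block of variable `12` is to be treated now: this happens when
variable `11` corresponds to the distance from the root, and variable `12` is the first vertex of
the block. -/
def activeE : Expr :=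
  .and (.and (.get2 1 10 12) (.not (.eq (.idx 12) (.idx 10))))
    (.and (.eq (.add (.add (.get2 2 10 12) (.idx 11)) (.num 1)) (.count 5 (.num 1)))
      (.all 5 (.or (.not (.lt (.idx 5) (.idx 12))) (.not (.get1 6 5)))))

/-- Treat the block of variable `12`. -/
def chooseStmt : Stmt := .seq hitStmt (.seq capacityStmt (.seq blockStmt
  (.vec 3 (.or (.get1 3 0) (.and activeE (.ex 3 (.and (isBestE 3) (chosenE 3 0))))))))

/-! ### Meaning of the formulas for one block -/

section

open Classical

variable {n : ℕ} {σ : Mem n} {ρ : ℕ → Fin n} {K : Finset (Fin n)} {a : Fin n → Prop}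
  {r c : Fin n → ℕ}

/-- Vectors `0`, `4`, `5` and `6` hold the requirements, the vertices that are hit, the capacities
and the block. -/
structure BlockData (σ : Mem n) (K : Finset (Fin n)) (a : Fin n → Prop) (r c : Fin n → ℕ) :
    Prop where
  req : ∀ x, σ.one 0 x = r x
  hit : ∀ x, σ.one 4 x ≠ 0 ↔ a x
  cap : ∀ x, σ.one 5 x = c x
  block : ∀ x, σ.one 6 x ≠ 0 ↔ x ∈ K

lemma BlockData.short (hσ : BlockData σ K a r c) (x h : ℕ) :
    Expr.IsTrue σ ρ (shortE x h) ↔ Short a r c (ρ x) (ρ h) := by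
  simp only [shortE, Expr.true_lt, Expr.eval_add, Expr.eval_idx, Expr.eval_get1, Expr.eval_ind,
    Expr.true_get1, hσ.req, hσ.hit, hσ.cap, Short]

lemma BlockData.hitCount (hσ : BlockData σ K a r c) :
    hitCountE.eval σ ρ = hitCount K a := by
  simp only [hitCountE, Expr.eval_count, Expr.true_and, Expr.true_get1, hσ.hit, hσ.block,
    Function.update_self, VectorConnectivity.hitCount]
  congr 1
  ext x
  simp

lemma BlockData.freshCount (hσ : BlockData σ K a r c) {h : ℕ} (hh : h ≠ 5) :
    (freshCountE h).eval σ ρ = freshCount K a r c (ρ h) := by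
  simp only [freshCountE, Expr.eval_count, Expr.true_and, Expr.true_not, Expr.true_get1, hσ.hit,
    hσ.block, hσ.short, Function.update_self, Function.update_of_ne hh,
    VectorConnectivity.freshCount]
  congr 1
  ext x
  simp

lemma BlockData.attainable (hσ : BlockData σ K a r c) {h : ℕ} (hh : h ≠ 5) :
    Expr.IsTrue σ ρ (attainableE h) ↔ Attainable K a r c (ρ h) := by
  have : (Finset.univ.filter fun x => x ∈ K) = K := by ext; simp
  simp only [attainableE, Expr.true_and, Expr.true_le, Expr.eval_add, Expr.eval_idx,
    hσ.freshCount hh, hσ.hitCount, Expr.eval_count, Expr.true_get1, hσ.block, Function.update_self,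
    Attainable]
  rw [← this]
  simp

lemma BlockData.price (hσ : BlockData σ K a r c) {h : ℕ} (hh : h ≠ 5) :
    (priceE h).eval σ ρ = price K a r c (ρ h) := by
  simp only [priceE, Expr.eval_count, Expr.eval_add, Expr.eval_idx, Expr.true_and, Expr.true_get1,
    hσ.hit, hσ.block, hσ.short, Function.update_self, Function.update_of_ne hh,
    VectorConnectivity.price]
  congr 2
  ext x
  simp

lemma BlockData.isBest (hσ : BlockData σ K a r c) {h : ℕ} (hh : h ≠ 5) (hh' : h ≠ 4) :
    Expr.IsTrue σ ρ (isBestE h) ↔ IsBest K a r c (ρ h) := by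
  simp only [isBestE, Expr.true_and, Expr.true_all, Expr.true_or, Expr.true_not, Expr.true_lt,
    Expr.true_eq, Expr.true_le, hσ.attainable hh, hσ.price hh,
    hσ.attainable (show 4 ≠ 5 by decide), hσ.price (show 4 ≠ 5 by decide), Expr.eval_idx,
    Function.update_self, Function.update_of_ne hh', IsBest, Fin.val_fin_le, imp_iff_not_or]

lemma BlockData.chosen (hσ : BlockData σ K a r c) {h x : ℕ} (hh : h ≠ 5) (hx : x ≠ 5) :
    Expr.IsTrue σ ρ (chosenE h x) ↔ Chosen K a r c (ρ h) (ρ x) := by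
  simp only [chosenE, Expr.true_and, Expr.true_or, Expr.true_not, Expr.true_lt, Expr.eval_add,
    Expr.eval_count, Expr.eval_idx, Expr.true_get1, hσ.hit, hσ.block, hσ.short, hσ.freshCount hh,
    hσ.hitCount, Function.update_self, Function.update_of_ne hh, Function.update_of_ne hx, Chosen,
    Fin.val_fin_lt]
  have : ∀ p : Fin n → Prop, ∀ [DecidablePred p] [DecidablePred fun i => i ∈ K ∧ p i],
      (Finset.univ.filter fun i => i ∈ K ∧ p i) = K.filter p := by
    intros; ext; simp
  rw [this]

end

section

open Classical

variable {n : ℕ} {G : SimpleGraph (Fin n)} {F : Set (Fin n)} {r : Fin n → ℕ} {σ : Mem n}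

/-- The vertices whose entry in vector `a` is not `0`. -/
def support (σ : Mem n) (a : ℕ) : Finset (Fin n) := Finset.univ.filter fun x => σ.one a x ≠ 0

lemma mem_support {a : ℕ} {x : Fin n} : x ∈ support σ a ↔ σ.one a x ≠ 0 := by simp [support]

lemma Data.hitStmt (hσ : Data G F r σ) (ρ : ℕ → Fin n) (x : Fin n) :
    (VectorConnectivity.hitStmt.exec ρ σ).one 4 x ≠ 0 ↔
      Hit G (ρ 10) ((support σ 3 : Set (Fin n)) ∪ F) x := by
  simp only [VectorConnectivity.hitStmt, Stmt.exec, Function.update_self, Expr.eval_ind,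
    Expr.true_ex, Expr.true_and, Expr.true_or, Expr.true_eq, Expr.true_get1, Expr.true_get2,
    Expr.eval_get2, Expr.eval_add, hσ.reach, hσ.free]
  simp only [ne_eq, ite_eq_right_iff, one_ne_zero, imp_false, not_not, Hit, Set.mem_union,
    Finset.mem_coe, mem_support]
  simp only [Function.update_self, Function.update_of_ne, ne_eq, not_false_eq_true,
    OfNat.ofNat_ne_zero, OfNat.zero_ne_ofNat, Nat.reduceEqDiff]
  refine exists_congr fun w => ?_
  constructor
  · rintro ⟨⟨h1, h2⟩, h3, h4⟩
    rw [hσ.dist _ _ h1, hσ.dist _ _ h2, hσ.dist _ _ (h1.trans h2)] at h3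
    exact ⟨h4, h1, h2, h3.symm⟩
  · rintro ⟨h4, h1, h2, h3⟩
    rw [hσ.dist _ _ h1, hσ.dist _ _ h2, hσ.dist _ _ (h1.trans h2)]
    exact ⟨⟨h1, h2⟩, h3.symm, h4⟩

lemma Data.capacityStmt (hσ : Data G F r σ) (ρ : ℕ → Fin n) {A : Set (Fin n)}
    (hA : ∀ x, σ.one 4 x ≠ 0 ↔ Hit G (ρ 10) A x) (x : Fin n) :
    (VectorConnectivity.capacityStmt.exec ρ σ).one 5 x = capacity G (ρ 10) F A x := by
  simp only [VectorConnectivity.capacityStmt, Stmt.exec, Function.update_self, Expr.eval_ind,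
    Expr.true_and, Expr.true_eq, Expr.true_get1, Expr.true_get2, Expr.eval_count, Expr.eval_num,
    Expr.eval_get2, Expr.eval_add, hσ.free, hσ.adj, hA]
  simp only [Function.update_self, Function.update_of_ne, ne_eq, not_false_eq_true,
    OfNat.ofNat_ne_zero, zero_ne_one, OfNat.ofNat_ne_one]
  rw [capacity]
  congr 2
  ext u
  simp only [Finset.mem_filter, Finset.mem_univ, true_and, mem_hitKids]
  refine and_congr_right fun hxu => ?_
  constructor
  -- Matrix `2` is meaningful only at reachable pairs; here reachability comes from `u` being hit.
  · rintro ⟨⟨w, hw, hb⟩, h2⟩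
    have h3 := hb.left.trans hxu.symm.reachable
    rw [hσ.dist _ _ hb.left, hσ.dist _ _ h3] at h2
    exact ⟨h2, w, hw, hb⟩
  · rintro ⟨h2, w, hw, hb⟩
    have h3 := hb.left.trans hxu.symm.reachable
    rw [hσ.dist _ _ hb.left, hσ.dist _ _ h3]
    exact ⟨⟨w, hw, hb⟩, h2⟩

lemma Data.blockStmt (hσ : Data G F r σ) (ρ : ℕ → Fin n) (hρ : G.Reachable (ρ 10) (ρ 12))
    (x : Fin n) : (VectorConnectivity.blockStmt.exec ρ σ).one 6 x ≠ 0 ↔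
      x ∈ sibs G (ρ 10) (ρ 12) := by
  simp only [VectorConnectivity.blockStmt, Stmt.exec, Function.update_self, Expr.eval_ind,
    Expr.true_and, Expr.true_or, Expr.true_eq, Expr.true_get2, Expr.eval_idx, Expr.eval_get2,
    hσ.adj]
  simp only [ne_eq, ite_eq_right_iff, one_ne_zero, imp_false, not_not, mem_sibs, Sib]
  simp only [Function.update_of_ne, ne_eq, not_false_eq_true, OfNat.ofNat_ne_zero]
  rw [Fin.val_inj]
  refine or_congr_right (and_congr_right fun h => ?_)
  rw [hσ.dist _ _ hρ, hσ.dist _ _ (hρ.trans h.reachable)]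

/-- The effect of treating a block. -/
lemma Data.chooseStmt (hσ : Data G F r σ) (ρ : ℕ → Fin n) :
    Data G F r (chooseStmt.exec ρ σ) ∧ (chooseStmt.exec ρ σ).one 1 = σ.one 1 ∧
    ∃ X : Finset (Fin n), support (chooseStmt.exec ρ σ) 3 = support σ 3 ∪ X ∧
      (¬ (G.Reachable (ρ 10) (ρ 12) ∧ ρ 12 ≠ ρ 10 ∧ G.dist (ρ 10) (ρ 12) + ρ 11 + 1 = n ∧
        ∀ u < ρ 12, ¬ Sib G (ρ 10) (ρ 12) u) → X = ∅) ∧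
      ((G.Reachable (ρ 10) (ρ 12) ∧ ρ 12 ≠ ρ 10 ∧ G.dist (ρ 10) (ρ 12) + ρ 11 + 1 = n ∧
        ∀ u < ρ 12, ¬ Sib G (ρ 10) (ρ 12) u) → ∀ x, x ∈ X ↔ ∃ h : Fin n,
          IsBest (sibs G (ρ 10) (ρ 12)) (Hit G (ρ 10) ((support σ 3 : Set (Fin n)) ∪ F)) r
            (capacity G (ρ 10) F ((support σ 3 : Set (Fin n)) ∪ F)) h ∧
          Chosen (sibs G (ρ 10) (ρ 12)) (Hit G (ρ 10) ((support σ 3 : Set (Fin n)) ∪ F)) r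
            (capacity G (ρ 10) F ((support σ 3 : Set (Fin n)) ∪ F)) h x) := by
  set A := (support σ 3 : Set (Fin n)) ∪ F with hA
  set σ1 := VectorConnectivity.hitStmt.exec ρ σ with hσ1
  set σ2 := VectorConnectivity.capacityStmt.exec ρ σ1 with hσ2
  set σ3 := VectorConnectivity.blockStmt.exec ρ σ2 with hσ3
  have h1 : ∀ b, b ≠ 4 → σ1.one b = σ.one b := fun b hb => by
    simp [hσ1, VectorConnectivity.hitStmt, Stmt.exec, hb]
  have h2 : ∀ b, b ≠ 5 → σ2.one b = σ1.one b := fun b hb => by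
    simp [hσ2, VectorConnectivity.capacityStmt, Stmt.exec, hb]
  have h3 : ∀ b, b ≠ 6 → σ3.one b = σ2.one b := fun b hb => by
    simp [hσ3, VectorConnectivity.blockStmt, Stmt.exec, hb]
  have d1 : Data G F r σ1 := hσ.congr (h1 0 (by decide)) (h1 2 (by decide)) rfl
  have d2 : Data G F r σ2 := d1.congr (h2 0 (by decide)) (h2 2 (by decide)) rfl
  have d3 : Data G F r σ3 := d2.congr (h3 0 (by decide)) (h3 2 (by decide)) rfl
  have e1 : ∀ x, σ1.one 4 x ≠ 0 ↔ Hit G (ρ 10) A x := hσ.hitStmt ρ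
  have e2 : ∀ x, σ2.one 5 x = capacity G (ρ 10) F A x := d1.capacityStmt ρ e1
  set τ := VectorConnectivity.chooseStmt.exec ρ σ with hτ
  have h4 : ∀ b, b ≠ 3 → τ.one b = σ3.one b := fun b hb => by
    simp [hτ, VectorConnectivity.chooseStmt, Stmt.exec, hb, hσ1, hσ2, hσ3]
  have hmem : ∀ x, τ.one 3 x ≠ 0 ↔ σ3.one 3 x ≠ 0 ∨
      (Expr.IsTrue σ3 (Function.update ρ 0 x) activeE ∧ ∃ h,
        Expr.IsTrue σ3 (Function.update (Function.update ρ 0 x) 3 h) (isBestE 3) ∧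
        Expr.IsTrue σ3 (Function.update (Function.update ρ 0 x) 3 h) (chosenE 3 0)) := by
    intro x
    have : τ.one 3 x ≠ 0 ↔ Expr.IsTrue σ3 (Function.update ρ 0 x)
        (.or (.get1 3 0) (.and activeE (.ex 3 (.and (isBestE 3) (chosenE 3 0))))) := by
      simp only [hτ, VectorConnectivity.chooseStmt, Stmt.exec, Function.update_self, Expr.IsTrue,
        hσ3, hσ2, hσ1]
    rw [this]
    simp only [Expr.true_or, Expr.true_and, Expr.true_ex, Expr.true_get1, Function.update_self]
  have h33 : σ3.one 3 = σ.one 3 := by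
    rw [h3 3 (by decide), h2 3 (by decide), h1 3 (by decide)]
  have hact : ∀ x, Expr.IsTrue σ3 (Function.update ρ 0 x) activeE ↔
      (G.Reachable (ρ 10) (ρ 12) ∧ ρ 12 ≠ ρ 10 ∧ G.dist (ρ 10) (ρ 12) + ρ 11 + 1 = n ∧
        ∀ u < ρ 12, ¬ Sib G (ρ 10) (ρ 12) u) := by
    intro x
    -- Counting a true constant over all vertices yields `n`. Round `d` thus treats depth `n - 1 -
    -- d`, so that depths decrease.
    have hn : Expr.eval σ3 (.count 5 (.num 1)) (Function.update ρ 0 x) = n := by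
      simp [Expr.eval_count, Expr.IsTrue]
    simp only [activeE, Expr.true_and, Expr.true_not, Expr.true_or, Expr.true_all, Expr.true_eq,
      Expr.true_lt, Expr.eval_add, Expr.eval_idx, Expr.eval_get2, Expr.eval_num, Expr.true_get1,
      Expr.true_get2, hn, d3.reach]
    simp only [Function.update_self, Function.update_of_ne, ne_eq,
      not_false_eq_true, OfNat.ofNat_ne_zero, Nat.reduceEqDiff, Fin.val_inj, Fin.val_fin_lt]
    rw [and_assoc]
    refine and_congr_right fun hr => ?_
    rw [d3.dist _ _ hr]
    refine and_congr_right fun _ => and_congr_right fun _ => forall_congr' fun u => ?_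
    rw [← mem_sibs, ← d2.blockStmt ρ hr u, imp_iff_not_or]
  refine ⟨d3.congr (h4 0 (by decide)) (h4 2 (by decide)) rfl, ?_,
    Finset.univ.filter fun x => Expr.IsTrue σ3 (Function.update ρ 0 x) activeE ∧ ∃ h,
        Expr.IsTrue σ3 (Function.update (Function.update ρ 0 x) 3 h) (isBestE 3) ∧
        Expr.IsTrue σ3 (Function.update (Function.update ρ 0 x) 3 h) (chosenE 3 0), ?_, ?_, ?_⟩
  · rw [h4 1 (by decide), h3 1 (by decide), h2 1 (by decide), h1 1 (by decide)]
  · ext x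
    rw [mem_support, hmem, h33, Finset.mem_union, mem_support, Finset.mem_filter]
    simp
  · intro hn
    rw [Finset.filter_eq_empty_iff]
    intro x _ hx
    exact hn ((hact x).1 hx.1)
  · intro hp x
    have hb : BlockData σ3 (sibs G (ρ 10) (ρ 12)) (Hit G (ρ 10) A) r
        (capacity G (ρ 10) F A) := by
      refine ⟨fun x => by rw [d3.req], fun x => ?_, fun x => ?_, d2.blockStmt ρ hp.1⟩
      · rw [h3 4 (by decide), h2 4 (by decide), e1]
      · rw [h3 5 (by decide), e2]
    rw [Finset.mem_filter]
    simp only [Finset.mem_univ, true_and, hact, and_iff_right hp, hb.isBest (show 3 ≠ 5 by decide)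
      (show 3 ≠ 4 by decide), hb.chosen (show 3 ≠ 5 by decide) (show 0 ≠ 5 by decide),
      Function.update_self, Function.update_of_ne (show (0 : ℕ) ≠ 3 by decide)]

end

end VectorConnectivity

namespace VectorConnectivity

open SimpleGraph RAM

/-! ### The greedy choice for a given root -/

/-- Vector `3` becomes a smallest feasible set of the component of variable `10` that contains this
vertex. -/
def greedyStmt : Stmt := .seq (.vec 3 (.num 0)) (.seq (.loop 11 (.loop 12 chooseStmt))
  (.vec 3 (.or (.get1 3 0) (.eq (.idx 0) (.idx 10)))))

variable {n : ℕ} {G : SimpleGraph (Fin n)} {F : Set (Fin n)} {r : Fin n → ℕ}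

/-- The vertices treated before vertex `j` in round `d` when the root is `ρ`. -/
def treated (G : SimpleGraph (Fin n)) (ρ : Fin n) (d j : ℕ) : Set (Fin n) :=
  {x | G.Reachable ρ x ∧ x ≠ ρ ∧ (n < G.dist ρ x + d + 1 ∨
    (G.dist ρ x + d + 1 = n ∧ ∃ u, Sib G ρ x u ∧ (u : ℕ) < j))}

/-- Every feasible set of the component of `ρ` that contains `ρ` can be replaced by one that is not
larger and meets `D` in `S`. -/
def Extendable (G : SimpleGraph (Fin n)) (ρ : Fin n) (F : Set (Fin n)) (r : Fin n → ℕ)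
    (D : Set (Fin n)) (S : Finset (Fin n)) : Prop :=
  ∀ T₀ : Finset (Fin n), ρ ∈ T₀ → (∀ x ∈ T₀, G.Reachable ρ x) → Feasible G ρ F r T₀ →
    ∃ T : Finset (Fin n), ρ ∈ T ∧ (∀ x ∈ T, G.Reachable ρ x) ∧ Feasible G ρ F r T ∧
      T.card ≤ T₀.card ∧ ∀ x, x ∈ S ↔ x ∈ T ∧ x ∈ D

/-- A class of the current depth is treated as a whole at its first vertex. If `v` is a later vertex
of its class, the class is already covered by a smaller sibling. -/
lemma treated_succ_of_inactive (hG : IsBlockGraph G) {ρ v : Fin n} {d : ℕ}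
    (h : ¬ (G.Reachable ρ v ∧ v ≠ ρ ∧ G.dist ρ v + d + 1 = n ∧ ∀ u < v, ¬ Sib G ρ v u)) :
    treated G ρ d (v + 1) = treated G ρ d v := by
  ext x
  refine and_congr_right fun hx => and_congr_right fun hxρ => or_congr_right
    (and_congr_right fun hd => ⟨?_, fun ⟨u, hu, hlt⟩ => ⟨u, hu, by omega⟩⟩)
  rintro ⟨u, hu, hlt⟩
  by_cases huv : u = v
  · subst huv
    by_contra hno
    refine h ⟨hu.reachable hx, hu.ne hx hxρ, by rw [hu.dist_eq]; exact hd, fun w hw hs => hno ?_⟩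
    exact ⟨w, hG.sib_trans (hu.reachable hx) (hu.ne hx hxρ) hu.symm hs, hw⟩
  · exact ⟨u, hu, by have : (u : ℕ) ≠ v := fun h => huv (Fin.ext h); omega⟩

lemma treated_succ_of_active {ρ v : Fin n} {d : ℕ} (hv : G.Reachable ρ v)
    (hvρ : v ≠ ρ) (hd : G.dist ρ v + d + 1 = n) (x : Fin n) :
    x ∈ treated G ρ d (v + 1) ↔ x ∈ treated G ρ d v ∨ Sib G ρ v x := by
  constructor
  · rintro ⟨hx, hxρ, h | ⟨h, u, hu, hlt⟩⟩
    · exact .inl ⟨hx, hxρ, .inl h⟩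
    · by_cases huv : u = v
      · subst huv; exact .inr hu.symm
      · exact .inl ⟨hx, hxρ, .inr ⟨h, u, hu, by
          have : (u : ℕ) ≠ v := fun h => huv (Fin.ext h); omega⟩⟩
  · rintro (⟨hx, hxρ, h | ⟨h, u, hu, hlt⟩⟩ | h)
    · exact ⟨hx, hxρ, .inl h⟩
    · exact ⟨hx, hxρ, .inr ⟨h, u, hu, by omega⟩⟩
    · exact ⟨h.reachable hv, h.ne hv hvρ, .inr ⟨by rw [h.dist_eq]; exact hd, v, h.symm, by omega⟩⟩

open Classical in
-- The chosen set is locally optimal by `chosen_optimal`, so `IsBlockGraph.exchange` builds it into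
-- the set that extends `S`. The class has fewer than `n` vertices because it omits the root.
lemma Extendable.step (hG : IsBlockGraph G) {ρ v : Fin n} {d : ℕ} {S X : Finset (Fin n)}
    (h : Extendable G ρ F r (treated G ρ d v) S)
    (hv : G.Reachable ρ v) (hvρ : v ≠ ρ) (hd : G.dist ρ v + d + 1 = n)
    (hfirst : ∀ u < v, ¬ Sib G ρ v u)
    (hX : ∀ x, x ∈ X ↔ ∃ h : Fin n, IsBest (sibs G ρ v) (Hit G ρ ((S : Set (Fin n)) ∪ F)) r
      (capacity G ρ F ((S : Set (Fin n)) ∪ F)) h ∧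
      Chosen (sibs G ρ v) (Hit G ρ ((S : Set (Fin n)) ∪ F)) r
        (capacity G ρ F ((S : Set (Fin n)) ∪ F)) h x) :
    Extendable G ρ F r (treated G ρ d (v + 1)) (S ∪ X) := by
  have hK : (sibs G ρ v).card < n := by
    have h1 : sibs G ρ v ⊂ Finset.univ := by
      rw [Finset.ssubset_univ_iff]
      intro h
      have : ρ ∈ sibs G ρ v := h ▸ Finset.mem_univ ρ
      exact (mem_sibs.1 this).ne hv hvρ rfl
    simpa using Finset.card_lt_card h1
  obtain ⟨h1, h2, h3⟩ := chosen_optimal hK hX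
  have hloc : ∀ Y, LocalOK G ρ F r ((S : Set (Fin n)) ∪ F) (sibs G ρ v) Y ↔
      ∀ u ∈ sibs G ρ v, u ∉ Y → ¬ Short (Hit G ρ ((S : Set (Fin n)) ∪ F)) r
        (capacity G ρ F ((S : Set (Fin n)) ∪ F)) u
        (hits G ρ ((S : Set (Fin n)) ∪ F) (sibs G ρ v) Y) := by
    intro Y
    simp only [LocalOK, Short, not_lt]
  have hhits : ∀ Y : Finset (Fin n), ((sibs G ρ v).filter fun u =>
      Hit G ρ ((S : Set (Fin n)) ∪ F) u ∨ u ∈ Y).card =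
        hits G ρ ((S : Set (Fin n)) ∪ F) (sibs G ρ v) Y := by
    intro Y
    rw [hits]
    congr
  simp only [hhits] at h2 h3
  intro T₀ hρ₀ hr₀ hf₀
  obtain ⟨T, hρ, hr, hf, hc, hS⟩ := h T₀ hρ₀ hr₀ hf₀
  obtain ⟨T', hρ', hr', hf', hc', hS'⟩ := hG.exchange hv hvρ (D := treated G ρ d v)
    (fun x hx hlt => ⟨hx, by rintro rfl; simp at hlt, .inl (by omega)⟩)
    (by rintro x ⟨-, -, h | h⟩ <;> omega)
    (by
      rintro x ⟨hx, hxρ, h | ⟨h, u, hu, hlt⟩⟩ hs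
      · have := hs.dist_eq; omega
      · exact hfirst u hlt (hG.sib_trans hx hxρ hs.symm hu))
    hS hρ hr hf h1 ((hloc X).2 h2) (fun Y hY hok => h3 Y hY ((hloc Y).1 hok))
  refine ⟨T', hρ', hr', hf', hc'.trans hc, fun x => ?_⟩
  rw [treated_succ_of_active hv hvρ hd]
  convert hS' x

/-- When everything but the root has been treated, being extendable leaves no freedom: with the root
added, the computed set equals a feasible set not larger than any given competitor. -/
lemma Data.greedyStmt {σ : Mem n} (hG : IsBlockGraph G) (hσ : Data G F r σ)
    (ρ : ℕ → Fin n) :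
    let τ := VectorConnectivity.greedyStmt.exec ρ σ
    Data G F r τ ∧ τ.one 1 = σ.one 1 ∧ ρ 10 ∈ support τ 3 ∧
      (∀ x ∈ support τ 3, G.Reachable (ρ 10) x) ∧ Feasible G (ρ 10) F r (support τ 3) ∧
      ∀ T : Finset (Fin n), ρ 10 ∈ T → (∀ x ∈ T, G.Reachable (ρ 10) x) →
        Feasible G (ρ 10) F r T → (support τ 3).card ≤ T.card := by
  classical
  intro τ
  set σ0 := (Stmt.vec 3 (.num 0)).exec ρ σ with hσ0
  set σ1 := (Stmt.loop 11 (.loop 12 VectorConnectivity.chooseStmt)).exec ρ σ0 with hσ1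
  have h0 : Data G F r σ0 := hσ.congr (by simp [hσ0, Stmt.exec]) (by simp [hσ0, Stmt.exec]) rfl
  have hinit : treated G (ρ 10) 0 0 = ∅ := by
    ext x
    simp only [treated, Set.mem_ofPred_eq, Set.mem_empty_iff_false, iff_false]
    rintro ⟨hx, -, h | ⟨-, u, -, h⟩⟩
    · have := dist_lt_of_reachable hx; omega
    · omega
  have hround : ∀ d, treated G (ρ 10) d n = treated G (ρ 10) (d + 1) 0 := by
    intro d
    ext x
    refine and_congr_right fun hx => and_congr_right fun hxρ => ?_
    constructor
    · rintro (h | ⟨h, -⟩) <;> exact .inl (by omega)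
    · rintro (h | ⟨-, u, -, h⟩)
      · by_cases hn : n < G.dist (ρ 10) x + d + 1
        · exact .inl hn
        · exact .inr ⟨by omega, x, .inl rfl, x.2⟩
      · omega
  have hloop : Data G F r σ1 ∧ σ1.one 1 = σ0.one 1 ∧
      Extendable G (ρ 10) F r (treated G (ρ 10) n 0) (support σ1 3) := by
    rw [hσ1, Stmt.exec]
    refine loopN_induction (fun d (τ : Mem n) => Data G F r τ ∧ τ.one 1 = σ0.one 1 ∧
      Extendable G (ρ 10) F r (treated G (ρ 10) d 0) (support τ 3)) ⟨h0, rfl, ?_⟩ ?_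
    · intro T hρ hr hf
      refine ⟨T, hρ, hr, hf, le_rfl, fun x => ?_⟩
      simp [hinit, mem_support, hσ0, Stmt.exec]
    · rintro d τ ⟨g1, g2, g3⟩
      rw [Stmt.exec, ← hround]
      refine loopN_induction (fun j (τ : Mem n) => Data G F r τ ∧ τ.one 1 = σ0.one 1 ∧
        Extendable G (ρ 10) F r (treated G (ρ 10) d j) (support τ 3)) ⟨g1, g2, g3⟩ ?_
      rintro v τ ⟨g1, g2, g3⟩
      obtain ⟨k1, k2, X, k3, k4, k5⟩ :=
        g1.chooseStmt (Function.update (Function.update ρ 11 d) 12 v)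
      simp only [Function.update_self, Function.update_of_ne, ne_eq, not_false_eq_true,
        Nat.reduceEqDiff] at k4 k5
      refine ⟨k1, k2.trans g2, ?_⟩
      by_cases hact : G.Reachable (ρ 10) v ∧ ¬ v = ρ 10 ∧ G.dist (ρ 10) v + d + 1 = n ∧
          ∀ u < v, ¬ Sib G (ρ 10) v u
      · have := g3.step hG hact.1 hact.2.1 hact.2.2.1 hact.2.2.2 (k5 hact)
        convert this using 1
      · rw [treated_succ_of_inactive hG hact, k3, k4 hact, Finset.union_empty]
        exact g3
  obtain ⟨g1, g2, g3⟩ := hloop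
  have hτ : τ = (Stmt.vec 3 (.or (.get1 3 0) (.eq (.idx 0) (.idx 10)))).exec ρ σ1 := rfl
  have hmem : ∀ x, x ∈ support τ 3 ↔ x ∈ support σ1 3 ∨ x = ρ 10 := by
    intro x
    rw [mem_support, mem_support]
    have : τ.one 3 x ≠ 0 ↔ Expr.IsTrue σ1 (Function.update ρ 0 x)
        (.or (.get1 3 0) (.eq (.idx 0) (.idx 10))) := by
      simp only [hτ, Stmt.exec, Function.update_self, Expr.IsTrue]
    rw [this]
    simp [Expr.true_get1, Fin.val_inj]
  have hlast : ∀ x, x ∈ treated G (ρ 10) n 0 ↔ G.Reachable (ρ 10) x ∧ x ≠ ρ 10 := by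
    intro x
    refine and_congr_right fun hx => ⟨fun h => h.1, fun h => ⟨h, .inl ?_⟩⟩
    have := hx.pos_dist_of_ne h.symm
    omega
  have hext : ∀ T₀ : Finset (Fin n), ρ 10 ∈ T₀ → (∀ x ∈ T₀, G.Reachable (ρ 10) x) →
      Feasible G (ρ 10) F r T₀ → (∀ x ∈ support τ 3, G.Reachable (ρ 10) x) ∧
        Feasible G (ρ 10) F r (support τ 3) ∧ (support τ 3).card ≤ T₀.card := by
    intro T₀ k1 k2 k3
    obtain ⟨T, l1, l2, l3, l4, l5⟩ := g3 T₀ k1 k2 k3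
    have : support τ 3 = T := by
      ext x
      rw [hmem, l5, hlast]
      constructor
      · rintro (h | rfl)
        · exact h.1
        · exact l1
      · intro h
        by_cases hx : x = ρ 10
        · exact .inr hx
        · exact .inl ⟨h, l2 x h, hx⟩
    rw [this]
    exact ⟨l2, l3, l4⟩
  -- Feasibility of the result needs at least one competitor; the whole component is one.
  obtain ⟨k1, k2, -⟩ := hext (Finset.univ.filter fun x => G.Reachable (ρ 10) x)
    (by simp) (by simp) (fun v hv hv' => absurd (by simpa using hv) hv')
  refine ⟨g1.congr (by simp [hτ, Stmt.exec]) (by simp [hτ, Stmt.exec]) rfl, ?_,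
    (hmem _).2 (.inr rfl), k1, k2, fun T h1 h2 h3 => (hext T h1 h2 h3).2.2⟩
  rw [show τ.one 1 = σ1.one 1 by simp [hτ, Stmt.exec], g2]
  simp [hσ0, Stmt.exec]

/-! ### The algorithm -/

/-- The formula for `FirstStep`. -/
def firstStepE (v x w : ℕ) : Expr :=
  .or (.and (.eq (.idx x) (.idx v)) (.eq (.idx w) (.idx v)))
    (.and (.get2 0 v x) (.and (.get2 1 v w) (.eq (.get2 2 v w) (.add (.get2 2 x w) (.num 1)))))

/-- The formula saying that vector `1` is feasible on the component of variable `10`. -/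
def feasibleE : Expr :=
  .all 1 (.or (.not (.get2 1 10 1)) (.or (.get1 1 1) (.le (.get1 0 1) (.count 2 (.ex 3
    (.and (.or (.get1 1 3) (.get1 2 3)) (firstStepE 1 2 3)))))))

/-- The formula saying that vector `1` is feasible on the component of variable `10`, and is not
larger there than vector `3`. -/
def keepE : Expr :=
  .and feasibleE (.le (.count 1 (.and (.get2 1 10 1) (.get1 1 1))) (.count 1 (.get1 3 1)))

/-- Replace vector `1` by vector `3` on the component of variable `10` if this is better. -/
def updateStmt : Stmt :=
  .vec 1 (.ite (.and (.get2 1 10 0) (.not keepE)) (.get1 3 0) (.get1 1 0))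

/-- Vector `1` becomes a smallest vector connectivity set. -/
def solveStmt : Stmt := .seq distances (.loop 10 (.seq greedyStmt updateStmt))

lemma Data.firstStepE {σ : Mem n} (hσ : Data G F r σ) {ρ : ℕ → Fin n} {v x w : ℕ} :
    Expr.IsTrue σ ρ (VectorConnectivity.firstStepE v x w) ↔ FirstStep G (ρ v) (ρ x) (ρ w) := by
  simp only [VectorConnectivity.firstStepE, Expr.true_or, Expr.true_and, Expr.true_eq,
    Expr.true_get2, Expr.eval_idx, Expr.eval_get2, Expr.eval_add, Expr.eval_num, hσ.adj, hσ.reach,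
    FirstStep, Fin.val_inj]
  refine or_congr_right (and_congr_right fun h => and_congr_right fun h' => ?_)
  rw [hσ.dist _ _ h', hσ.dist _ _ (h.symm.reachable.trans h')]

open Classical in
lemma Data.feasibleE {σ : Mem n} (hσ : Data G F r σ) {ρ : ℕ → Fin n} :
    Expr.IsTrue σ ρ VectorConnectivity.feasibleE ↔ Feasible G (ρ 10) F r (support σ 1) := by
  simp only [VectorConnectivity.feasibleE, Expr.true_all, Expr.true_or, Expr.true_not,
    Expr.true_get2, Expr.true_get1, Expr.true_le, Expr.eval_get1, Expr.eval_count, Expr.true_ex,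
    Expr.true_and, hσ.firstStepE, hσ.reach, hσ.free, hσ.req]
  simp only [Function.update_self, Function.update_of_ne, ne_eq, not_false_eq_true,
    OfNat.ofNat_ne_one, OfNat.one_ne_ofNat, Nat.reduceEqDiff]
  refine forall_congr' fun v => ?_
  rw [mem_support, imp_iff_not_or, imp_iff_not_or, not_not]
  refine or_congr_right (or_congr_right ?_)
  rw [dirs]
  simp only [Set.mem_union, Finset.mem_coe, mem_support, ne_eq]

/-! ### From rooted solutions to all components -/

lemma dirs_congr {v : Fin n} {S T : Set (Fin n)} (h : ∀ x, G.Reachable v x → (x ∈ S ↔ x ∈ T)) :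
    dirs G v S = dirs G v T := by
  ext x
  simp only [mem_dirs]
  refine exists_congr fun w => and_congr_left fun hw => h w (hw.btw.left.trans hw.btw.right)

lemma Feasible.congr {ρ : Fin n} {S T : Finset (Fin n)} (hS : Feasible G ρ F r S)
    (h : ∀ x, G.Reachable ρ x → (x ∈ S ↔ x ∈ T)) : Feasible G ρ F r T := by
  intro v hv hvT
  rw [← dirs_congr (S := (S : Set (Fin n)) ∪ F) fun x hx => by
    simp [h x (hv.trans hx)]]
  exact hS v hv fun hvS => hvT ((h v hv).1 hvS)

lemma Feasible.of_reachable {ρ v : Fin n} {S : Finset (Fin n)} (hS : Feasible G ρ F r S)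
    (h : G.Reachable ρ v) : Feasible G v F r S := fun u hu huS => hS u (h.trans hu) huS

open Classical in
/-- The set `S` is at least as good on the component of `v` as `T`. -/
def BetterOn (G : SimpleGraph (Fin n)) (F : Set (Fin n)) (r : Fin n → ℕ) (v : Fin n)
    (S T : Finset (Fin n)) : Prop :=
  Feasible G v F r S ∧
    (S.filter fun x => G.Reachable v x).card ≤ (T.filter fun x => G.Reachable v x).card

lemma BetterOn.trans {v : Fin n} {S T U : Finset (Fin n)} (h : BetterOn G F r v S T)
    (h' : BetterOn G F r v T U) : BetterOn G F r v S U := ⟨h.1, h.2.trans h'.2⟩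

lemma BetterOn.congr {v : Fin n} {S S' T : Finset (Fin n)} (h : BetterOn G F r v S T)
    (hS : ∀ x, G.Reachable v x → (x ∈ S ↔ x ∈ S')) : BetterOn G F r v S' T := by
  refine ⟨h.1.congr hS, le_trans (le_of_eq ?_) h.2⟩
  congr 1
  ext x
  simp only [Finset.mem_filter]
  exact and_congr_left fun hx => (hS x hx).symm

open Classical in
lemma BetterOn.of_reachable {ρ v : Fin n} {S T : Finset (Fin n)} (h : BetterOn G F r ρ S T)
    (hv : G.Reachable ρ v) : BetterOn G F r v S T := by
  have : ∀ x, G.Reachable v x ↔ G.Reachable ρ x := fun x => ⟨hv.trans, hv.symm.trans⟩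
  refine ⟨h.1.of_reachable hv, ?_⟩
  simp only [this]
  exact h.2

/-- The set `S` is at least as good as every feasible set that avoids the component in question or
meets it in a vertex less than `k`. -/
def BestUpTo (G : SimpleGraph (Fin n)) (F : Set (Fin n)) (r : Fin n → ℕ) (k : ℕ)
    (S : Finset (Fin n)) : Prop :=
  ∀ v (T : Finset (Fin n)), Feasible G v F r T →
    ((∃ x ∈ T, G.Reachable v x ∧ (x : ℕ) < k) ∨ ∀ x ∈ T, ¬ G.Reachable v x) → BetterOn G F r v S T

open Classical in
lemma Data.updateStmt {σ : Mem n} (hσ : Data G F r σ) (ρ : ℕ → Fin n) :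
    let τ := VectorConnectivity.updateStmt.exec ρ σ
    Data G F r τ ∧
      (Feasible G (ρ 10) F r (support σ 1) ∧
          ((support σ 1).filter fun x => G.Reachable (ρ 10) x).card ≤ (support σ 3).card →
        support τ 1 = support σ 1) ∧
      (¬ (Feasible G (ρ 10) F r (support σ 1) ∧
          ((support σ 1).filter fun x => G.Reachable (ρ 10) x).card ≤ (support σ 3).card) →
        (∀ x, G.Reachable (ρ 10) x → (x ∈ support τ 1 ↔ x ∈ support σ 3)) ∧
        ∀ x, ¬ G.Reachable (ρ 10) x → (x ∈ support τ 1 ↔ x ∈ support σ 1)) := by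
  intro τ
  have hkeep : ∀ x, Expr.IsTrue σ (Function.update ρ 0 x) keepE ↔
      (Feasible G (ρ 10) F r (support σ 1) ∧
        ((support σ 1).filter fun x => G.Reachable (ρ 10) x).card ≤ (support σ 3).card) := by
    intro x
    simp only [keepE, Expr.true_and, hσ.feasibleE, Expr.true_le, Expr.eval_count, Expr.true_get1,
      Expr.true_get2, hσ.reach]
    simp only [Function.update_self, Function.update_of_ne, ne_eq, not_false_eq_true,
      OfNat.ofNat_ne_one, OfNat.ofNat_ne_zero]
    refine and_congr_right fun _ => ?_
    rw [show (support σ 1).filter (fun x => G.Reachable (ρ 10) x) =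
      Finset.univ.filter fun i => G.Reachable (ρ 10) i ∧ ¬ σ.one 1 i = 0 by
        ext i; simp [mem_support, and_comm],
      show support σ 3 = Finset.univ.filter fun i => ¬ σ.one 3 i = 0 by ext i; simp [mem_support]]
  have hval : ∀ x, τ.one 1 x = if G.Reachable (ρ 10) x ∧
      ¬ (Feasible G (ρ 10) F r (support σ 1) ∧
        ((support σ 1).filter fun x => G.Reachable (ρ 10) x).card ≤ (support σ 3).card)
      then σ.one 3 x else σ.one 1 x := by
    intro x
    simp only [τ, VectorConnectivity.updateStmt, Stmt.exec, Function.update_self, Expr.eval_ite,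
      Expr.true_and, Expr.true_not, hkeep, Expr.true_get2, hσ.reach, Expr.eval_get1]
    simp only [Function.update_of_ne, ne_eq, not_false_eq_true, OfNat.ofNat_ne_zero]
  refine ⟨hσ.congr (by simp [τ, VectorConnectivity.updateStmt, Stmt.exec])
    (by simp [τ, VectorConnectivity.updateStmt, Stmt.exec]) rfl, fun h => ?_, fun h => ⟨fun x hx => ?_,
      fun x hx => ?_⟩⟩
  · ext x
    rw [mem_support, mem_support, hval, if_neg fun hx => hx.2 h]
  · rw [mem_support, mem_support, hval, if_pos ⟨hx, h⟩]
  · rw [mem_support, mem_support, hval, if_neg fun h => hx h.1]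

open Classical in
/-- The best feasible sets containing a vertex `ρ` improve the set found so far. -/
lemma BestUpTo.succ {ρ : Fin n} {S S' U : Finset (Fin n)} (hS : BestUpTo G F r ρ S)
    (hρ : ρ ∈ U) (hUr : ∀ x ∈ U, G.Reachable ρ x) (hU : Feasible G ρ F r U)
    (hUmin : ∀ T : Finset (Fin n), ρ ∈ T → (∀ x ∈ T, G.Reachable ρ x) →
      Feasible G ρ F r T → U.card ≤ T.card)
    (hkeep : Feasible G ρ F r S ∧ (S.filter fun x => G.Reachable ρ x).card ≤ U.card → S' = S)
    (hchange : ¬ (Feasible G ρ F r S ∧ (S.filter fun x => G.Reachable ρ x).card ≤ U.card) →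
      (∀ x, G.Reachable ρ x → (x ∈ S' ↔ x ∈ U)) ∧ ∀ x, ¬ G.Reachable ρ x → (x ∈ S' ↔ x ∈ S)) :
    BestUpTo G F r (ρ + 1) S' := by
  have hUf : U.filter (fun x => G.Reachable ρ x) = U := Finset.filter_true_of_mem hUr
  have hsmaller : ∀ (v : Fin n) (T : Finset (Fin n)), ¬ (ρ ∈ T ∧ G.Reachable v ρ) →
      ((∃ x ∈ T, G.Reachable v x ∧ (x : ℕ) < ρ + 1) ∨ ∀ x ∈ T, ¬ G.Reachable v x) →
      ((∃ x ∈ T, G.Reachable v x ∧ (x : ℕ) < ρ) ∨ ∀ x ∈ T, ¬ G.Reachable v x) := by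
    rintro v T hn (⟨x, hx, hr, hlt⟩ | h)
    · refine .inl ⟨x, hx, hr, ?_⟩
      have : (x : ℕ) ≠ ρ := fun h => hn (by obtain rfl := Fin.ext h; exact ⟨hx, hr⟩)
      omega
    · exact .inr h
  intro v T hT hcase
  by_cases hv : G.Reachable ρ v
  · have hTρ : Feasible G ρ F r T := hT.of_reachable hv.symm
    -- A competitor containing `ρ` is beaten by `U`. For any other competitor the old set `S` is
    -- feasible and at least as good, so `S` can only be rejected because `U` is smaller.
    have hUT : ρ ∈ T → BetterOn G F r ρ U T := by
      refine fun hρT => ⟨hU, ?_⟩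
      rw [hUf]
      exact hUmin _ (by simp [hρT]) (by simp) (hTρ.congr fun x hx => by simp [hx])
    have hold : ρ ∉ T → BetterOn G F r ρ S T := fun hρT =>
      (hS v T hT (hsmaller v T (fun h => hρT h.1) hcase)).of_reachable hv.symm
    refine BetterOn.of_reachable ?_ hv
    by_cases hk : Feasible G ρ F r S ∧ (S.filter fun x => G.Reachable ρ x).card ≤ U.card
    · rw [hkeep hk]
      by_cases hρT : ρ ∈ T
      · refine BetterOn.trans ⟨hk.1, ?_⟩ (hUT hρT)
        rw [hUf]
        exact hk.2
      · exact hold hρT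
    · refine BetterOn.congr ?_ fun x hx => ((hchange hk).1 x hx).symm
      by_cases hρT : ρ ∈ T
      · exact hUT hρT
      · have h1 := hold hρT
        refine BetterOn.trans ⟨hU, ?_⟩ h1
        rw [hUf]
        exact le_of_not_ge fun h => hk ⟨h1.1, h⟩
  · have h1 := hS v T hT (hsmaller v T (fun h => hv h.2.symm) hcase)
    by_cases hk : Feasible G ρ F r S ∧ (S.filter fun x => G.Reachable ρ x).card ≤ U.card
    · rw [hkeep hk]; exact h1
    · exact h1.congr fun x hx => ((hchange hk).2 x fun h => hv (h.trans hx.symm)).symm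

/-- The program finds a set that is best on every component. -/
lemma exec_solveStmt (hG : IsBlockGraph G) (ρ : ℕ → Fin n) {σ : Mem n} (h0 : σ.one 0 = r)
    (h2 : ∀ v, σ.one 2 v ≠ 0 ↔ v ∈ F) (hadj : ∀ u v, σ.two 0 u v ≠ 0 ↔ G.Adj u v)
    (hd : ∀ u v, σ.two 2 u v = 0) (h1 : ∀ v, σ.one 1 v = 0) :
    BestUpTo G F r n (support (solveStmt.exec ρ σ) 1) := by
  obtain ⟨g1, g2, g3, g4⟩ := exec_distances ρ hadj hd
  have hσ : Data G F r (distances.exec ρ σ) :=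
    ⟨by rw [g1, h0], by rw [g1]; exact h2, by rw [g2]; exact hadj, g3, g4⟩
  have key : Data G F r (solveStmt.exec ρ σ) ∧
      BestUpTo G F r n (support (solveStmt.exec ρ σ) 1) := by
    rw [solveStmt, Stmt.exec, Stmt.exec]
    refine loopN_induction (fun k (τ : Mem n) => Data G F r τ ∧ BestUpTo G F r k (support τ 1))
      ⟨hσ, ?_⟩ ?_
    -- Before any root is tried, the only competitors avoid the component altogether, and the
    -- initial empty set agrees with them there.
    · intro v T hT hcase
      have hno : ∀ x ∈ T, ¬ G.Reachable v x := by
        rcases hcase with ⟨x, -, -, h⟩ | h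
        · omega
        · exact h
      have hemp : ∀ x, x ∉ support (distances.exec ρ σ) 1 := by
        intro x
        simp [mem_support, g1, h1]
      refine ⟨hT.congr fun x hx => ⟨fun h => absurd hx (hno x h), fun h => absurd h (hemp x)⟩, ?_⟩
      rw [Finset.eq_empty_of_forall_notMem hemp]
      simp
    · rintro k τ ⟨k1, k2⟩
      have hg := k1.greedyStmt hG (Function.update ρ 10 k)
      obtain ⟨l1, l2, l3, l4, l5, l6⟩ := hg
      obtain ⟨m1, m2, m3⟩ := l1.updateStmt (Function.update ρ 10 k)
      rw [Stmt.exec]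
      refine ⟨m1, ?_⟩
      have hsup : support (greedyStmt.exec (Function.update ρ 10 k) τ) 1 = support τ 1 := by
        ext x; rw [mem_support, mem_support, l2]
      simp only [Function.update_self] at l3 l4 l5 l6 m2 m3
      rw [hsup] at m2 m3
      exact k2.succ l3 l4 l5 l6 m2 m3
  exact key.2

lemma IsBlockGraph.isFreeVCSet_iff (hG : IsBlockGraph G) {F S : Finset (Fin n)} :
    IsFreeVCSet G F r S ↔ ∀ ρ, Feasible G ρ F r S := by
  constructor
  · exact fun h ρ v _ hvS => hG.isLinked_iff.1 (h v hvS)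
  · exact fun h v hvS => hG.isLinked_iff.2 (h v v .rfl hvS)

/-- For `k = n` every feasible set is a competitor on every component. Comparison with the set of
all vertices yields feasibility, and summing the comparisons over the components yields minimality.
-/
lemma IsBlockGraph.solvesFreeVecCon (hG : IsBlockGraph G) {F S : Finset (Fin n)}
    (hS : BestUpTo G F r n S) : SolvesFreeVecCon G F r S := by
  classical
  have hall : ∀ T, IsFreeVCSet G F r T → ∀ v, BetterOn G F r v S T := by
    intro T hT v
    refine hS v T (hG.isFreeVCSet_iff.1 hT v) ?_
    by_cases h : ∃ x ∈ T, G.Reachable v x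
    · obtain ⟨x, hx, hr⟩ := h
      exact .inl ⟨x, hx, hr, x.2⟩
    · exact .inr fun x hx hr => h ⟨x, hx, hr⟩
  refine ⟨hG.isFreeVCSet_iff.2 fun v => (hall Finset.univ ?_ v).1, fun T hT => ?_⟩
  · exact fun v hv => absurd (Finset.mem_univ v) hv
  · let f : Fin n → G.ConnectedComponent := G.connectedComponentMk
    rw [Finset.card_eq_sum_card_fiberwise (f := f) (s := S) (t := Finset.univ.image f)
        fun x _ => Finset.mem_coe.2 (Finset.mem_image_of_mem f (Finset.mem_univ x)),
      Finset.card_eq_sum_card_fiberwise (f := f) (s := T) (t := Finset.univ.image f)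
        fun x _ => Finset.mem_coe.2 (Finset.mem_image_of_mem f (Finset.mem_univ x))]
    refine Finset.sum_le_sum fun c hc => ?_
    obtain ⟨v, -, rfl⟩ := Finset.mem_image.1 hc
    have h := (hall T hT v).2
    have hiff : ∀ x, f x = f v ↔ G.Reachable v x := fun x => by
      simp only [f, ConnectedComponent.eq]
      exact ⟨fun h => h.symm, fun h => h.symm⟩
    simp only [hiff]
    convert h

/-! ### The program on its inputs -/

lemma eval_mono_nat (q : Polynomial ℕ) {m n : ℕ} (h : m ≤ n) : q.eval m ≤ q.eval n := by
  rw [Polynomial.eval_eq_sum_range, Polynomial.eval_eq_sum_range]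
  exact Finset.sum_le_sum fun i _ => Nat.mul_le_mul_left _ (Nat.pow_le_pow_left h i)

lemma le_instanceLength (r : Fin n → ℕ) : n ≤ instanceLength r := by
  rw [instanceLength]; omega

open Classical in
lemma holds_freeVecConInput (G : SimpleGraph (Fin n)) (F : Finset (Fin n)) (r : Fin n → ℕ) :
    Holds (n := n)
      ⟨fun a i => if a = 0 then r i else if a = 2 then (if i ∈ F then 1 else 0) else 0,
        fun a i j => if a = 0 then (if G.Adj i j then 1 else 0) else 0⟩
      (freeVecConInput G F r) := by
  constructor
  · intro a i
    match a with
    | 0 => simp [loc1, freeVecConInput]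
    | 1 => simp [loc1, freeVecConInput]
    | 2 => simp [loc1, freeVecConInput, Fin.val_inj]
    | a + 3 => simp [loc1, freeVecConInput]
  · intro a i j
    match a with
    | 0 =>
      have : (∃ u v : Fin n, (i : ℕ) * n + j = u * n + v ∧ G.Adj u v) ↔ G.Adj i j := by
        constructor
        · rintro ⟨u, v, h, huv⟩
          obtain ⟨rfl, rfl⟩ := row_position h
          exact huv
        · exact fun h => ⟨i, j, rfl, h⟩
      simp [loc2, freeVecConInput, this]
    | a + 1 => simp [loc2, freeVecConInput]

theorem exists_program_freeVecCon : ∃ (p : RAM.Prog) (q : Polynomial ℕ),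
    ∀ (n : ℕ) (G : SimpleGraph (Fin n)) (F : Finset (Fin n)) (r : Fin n → ℕ), IsBlockGraph G →
      ∃ (s : RAM.Store) (t : ℕ), RAM.Runs p (freeVecConInput G F r) s t ∧
        t ≤ q.eval (instanceLength r) ∧ SolvesFreeVecCon G F r (outputSet n s) := by
  classical
  obtain ⟨q, hq0, hq⟩ := does_program solveStmt
  refine ⟨solveStmt.program, q, fun n G F r hG => ?_⟩
  rcases Nat.eq_zero_or_pos n with rfl | hn
  · obtain ⟨s, t, h1, h2, -⟩ := hq0 (freeVecConInput G F r) rfl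
    refine ⟨s, t, h1, h2.trans (eval_mono_nat q (Nat.zero_le _)), fun v => v.elim0, fun T _ => ?_⟩
    rw [Finset.card_eq_zero.2 (Subsingleton.elim _ _)]
    exact Nat.zero_le _
  · obtain ⟨s, t, h1, h2, h3⟩ := hq n ⟨0, hn⟩ _ (freeVecConInput G F r) rfl rfl
      (fun x hx => by simp [freeVecConInput, hx]) (holds_freeVecConInput G F r)
    refine ⟨s, t, h1, h2.trans (eval_mono_nat q (le_instanceLength r)), ?_⟩
    have hb := exec_solveStmt (F := F) (r := r) hG (fun _ => ⟨0, hn⟩)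
      (σ := ⟨fun a i => if a = 0 then r i else if a = 2 then (if i ∈ F then 1 else 0) else 0,
        fun a i j => if a = 0 then (if G.Adj i j then 1 else 0) else 0⟩)
      (by simp) (by simp) (by simp) (by simp) (by simp)
    have hout : outputSet n s = support (solveStmt.exec (fun _ => ⟨0, hn⟩)
        (⟨fun a i => if a = 0 then r i else if a = 2 then (if i ∈ F then 1 else 0) else 0,
          fun a i j => if a = 0 then (if G.Adj i j then 1 else 0) else 0⟩ : Mem n)) 1 := by
      ext v
      rw [mem_support, ← h3.one 1 v]
      simp [outputSet, loc1]
    rw [hout]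
    exact hG.solvesFreeVecCon hb

/-- An absent free set and an empty one look the same in memory, as array `2` is zero in both cases.
So one program solves both problems. -/
lemma vecConInput_eq {n : ℕ} (G : SimpleGraph (Fin n)) (r : Fin n → ℕ) :
    vecConInput G r = freeVecConInput G ∅ r := by
  simp [vecConInput, freeVecConInput]

lemma solvesFreeVecCon_empty {n : ℕ} {G : SimpleGraph (Fin n)} {r : Fin n → ℕ}
    {S : Finset (Fin n)} : SolvesFreeVecCon G ∅ r S ↔ SolvesVecCon G r S := by
  simp [SolvesFreeVecCon, SolvesVecCon, IsFreeVCSet, IsVCSet]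

end VectorConnectivity

theorem mainTheorem4 :
    (∃ (p : RAM.Prog) (q : Polynomial ℕ),
      ∀ (n : ℕ) (G : SimpleGraph (Fin n)) (r : Fin n → ℕ),
        VectorConnectivity.IsBlockGraph G →
          ∃ (s : RAM.Store) (t : ℕ),
            RAM.Runs p (VectorConnectivity.vecConInput G r) s t ∧
            t ≤ q.eval (VectorConnectivity.instanceLength r) ∧
            VectorConnectivity.SolvesVecCon G r (VectorConnectivity.outputSet n s)) ∧
    (∃ (p : RAM.Prog) (q : Polynomial ℕ),
      ∀ (n : ℕ) (G : SimpleGraph (Fin n)) (F : Finset (Fin n)) (r : Fin n → ℕ),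
        VectorConnectivity.IsBlockGraph G →
          ∃ (s : RAM.Store) (t : ℕ),
            RAM.Runs p (VectorConnectivity.freeVecConInput G F r) s t ∧
            t ≤ q.eval (VectorConnectivity.instanceLength r) ∧
            VectorConnectivity.SolvesFreeVecCon G F r (VectorConnectivity.outputSet n s)) := by
  obtain ⟨p, q, h⟩ := VectorConnectivity.exists_program_freeVecCon
  refine ⟨⟨p, q, fun n G r hG => ?_⟩, p, q, h⟩
  obtain ⟨s, t, h1, h2, h3⟩ := h n G ∅ r hG
  rw [VectorConnectivity.vecConInput_eq]
  exact ⟨s, t, h1, h2, VectorConnectivity.solvesFreeVecCon_empty.1 h3⟩
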